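/- Let $\mathbb{O}_s$ be the eight-dimensional real algebra of pairs of quaternions $a+b\ell$ with product $(a+b\ell)(c+d\ell)=ac+\ell^2\,\bar d b+(da+b\bar c)\ell$, conjugation $\overline{a+b\ell}=\bar a-b\ell$, scalar product $(x,y)=\mathrm{Re}(x\bar y)$ and $N(x)=(x,x)$. For $\ell^2=+1$ these are the split octonions ($N$ has signature $(4,4)$), for $\ell^2=-1$ the octonions ($N$ is Euclidean). Let $e_0=1,e_1=i,e_2=j,e_3=k,e_4=\ell,e_5=\ell i,e_6=\ell j,e_7=\ell k$, and define $\eta_{bc}$ and the structure constants $f^a{}_{bc}$ ($1\le a,b,c\le 7$) by $e_be_c=-\eta_{bc}e_0+f^a{}_{bc}e_a$. Let $\gamma>0$ and let $\mathcal M$ be one of the following: the pseudo-sphere $S^{3,4}=\{N=\gamma^2\}$ or the pseudo-hyperbolic space $H^{4,3}=\{N=-\gamma^2\}$ in the split octonions, or the sphere $S^7=\{N=\gamma^2\}$ in the octonions. Put $\delta=1$ for $S^{3,4}$ and $S^7$, and $\delta=-1$ for $H^{4,3}$. Equip $\mathcal M$ with the metric induced by $(\cdot,\cdot)$ and let $\bar\nabla$,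 with connection forms $\bar\omega$ in orthonormal frames, be its Levi-Civita connection, i.e. the tangential part of the ambient derivative, which is metric-compatible and torsion-free. (1) For every $\alpha\in\mathcal M$ the vector fields ${}^{(\alpha)}t_i^{+}(x)=\gamma^{-1}(e_i\alpha)(\alpha^{-1}x)$ (right multiplication), $i=1,\dots,7$, form a global smooth tangent frame of $\mathcal M$ with $(t_i,t_j)=\delta\,\eta_{ij}$, and so do the vector fields ${}^{(\alpha)}t_i^{-}(x)=\gamma^{-1}(x\alpha^{-1})(\alpha e_i)$ (left multiplication). (The induced metric thus has signature $(3,4)$ on $S^{3,4}$ and $(4,3)$ on $H^{4,3}$.) For each of these frames there is a smooth affine connection $\nabla$ on $\mathcal M$ for which the frame is parallel. It is metric-compatible and flat, and around each point there is a positively oriented smooth local orthonormal frame $E_a$ (with $(E_a,E_b)=\delta\,\eta_{ab}$ and dual coframe $e^a$) in which $$\omega^a{}_b=\bar\omega^a{}_b\pm\frac1\gamma f^a{}_{bc}\,e^c ,\qquad T(E_b,E_c)=\mp\frac{2}{\gamma}f^a{}_{bc}E_a ,$$ with the upper sign for left multiplication and the lower sign for right multiplication. Here "positively oriented" means that $(x,E_1,\dots,E_7)$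 has the orientation of $(e_0,\dots,e_7)$. The values $\pm1/\gamma$ are the only possible ones: if on some non-empty open part of $\mathcal M$ a connection with $\omega^a{}_b=\bar\omega^a{}_b+\beta f^a{}_{bc}e^c$ in some orthonormal frame as above, $\beta\in\mathbb R$, is flat, then $\beta^2=1/\gamma^2$. (2) These are two infinite families of parallelisms: $\mathcal M$ is infinite; two parallelisms of the same family with reference points $\alpha,\beta\in\mathcal M$ come from the same connection if and only if $\beta=\pm\alpha$; no connection belongs to both families. (3) For each of these connections, the torsion breaks the isometry group of $\mathcal M$ (all linear automorphisms that preserve $N$: $O(4,4)$, or $O(8)$ for $S^7$) to the spin group: some isometry of determinant $1$ does not preserve the torsion, and the group of all isometries that preserve it is the image of a faithful representation $\rho$, namely the restriction of an isomorphism from the even Clifford algebra onto the $8\times8$ real matrices, of $Spin^+(3,4)$ for $S^{3,4}$, of $Spin^+(4,3)\cong Spin^+(3,4)$ for $H^{4,3}$, and of $Spin(7)$ for $S^7$. For every $p\in\mathcal M$ the stabiliser $H$ of $p$ is mapped by $\rho$ onto a group that is conjugate in $GL(8,\mathbb R)$ to the automorphism group of the algebra, by a linear map that takes $p$ to $1$.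 This automorphism group is $G^*_{2,2}$ for the split octonions and $G_2$ for the octonions. The map $gH\mapsto\rho(g)p$ is a homeomorphism from the coset space onto $\mathcal M$, and $g\mapsto\rho(g)p$ has smooth local sections, so that it is a diffeomorphism: $$S^{3,4}\cong Spin^+(3,4)/G^*_{2,2},\qquad H^{4,3}\cong Spin^+(4,3)/G^*_{2,2},\qquad S^7\cong Spin(7)/G_2 .$$ -/

import Mathlib

open scoped ContDiff

noncomputable section

/-! ### Octonions and split octonions -/

/-- The eight-dimensional real vector space underlying both the octonions and the split octonions.
An element is given by its components in the basis `e₀ = 1, e₁ = i, e₂ = j, e₃ = k, e₄ = ℓ,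
e₅ = ℓ i, e₆ = ℓ j, e₇ = ℓ k`. (The norm of this space is used for its topology only.) -/
abbrev Oct : Type := Fin 8 → ℝ

/-- The quaternion `a` in `x = a + b ℓ`. -/
def qfst (x : Oct) : Quaternion ℝ := ⟨x 0, x 1, x 2, x 3⟩

/-- The quaternion `b` in `x = a + b ℓ`; note `ℓ i = - i ℓ`, and so on. -/
def qsnd (x : Oct) : Quaternion ℝ := ⟨x 4, -x 5, -x 6, -x 7⟩

@[simp] theorem qfst_re (x : Oct) : (qfst x).re = x 0 := rfl

@[simp] theorem qfst_imI (x : Oct) : (qfst x).imI = x 1 := rfl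

@[simp] theorem qfst_imJ (x : Oct) : (qfst x).imJ = x 2 := rfl

@[simp] theorem qfst_imK (x : Oct) : (qfst x).imK = x 3 := rfl

@[simp] theorem qsnd_re (x : Oct) : (qsnd x).re = x 4 := rfl

@[simp] theorem qsnd_imI (x : Oct) : (qsnd x).imI = -x 5 := rfl

@[simp] theorem qsnd_imJ (x : Oct) : (qsnd x).imJ = -x 6 := rfl

@[simp] theorem qsnd_imK (x : Oct) : (qsnd x).imK = -x 7 := rfl

/-- The element `a + b ℓ`. -/
def ofPair (a b : Quaternion ℝ) : Oct :=
  ![a.re, a.imI, a.imJ, a.imK, b.re, -b.imI, -b.imJ, -b.imK]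

/-- The Cayley-Dickson product `(a + b ℓ)(c + d ℓ) = a c + s d̄ b + (d a + b c̄) ℓ` with `ℓ² = s`:
split octonions for `s = 1`, octonions for `s = -1`. -/
def omul (s : ℝ) (x y : Oct) : Oct :=
  ofPair (qfst x * qfst y + s • (star (qsnd y) * qsnd x))
    (qsnd y * qfst x + qsnd x * star (qfst y))

/-- Octonionic conjugation `a + b ℓ ↦ ā - b ℓ`. -/
def oconj (x : Oct) : Oct := ofPair (star (qfst x)) (-qsnd x)

/-- The scalar product `(x, y)`, the `e₀`-component of `x ȳ`. For `s = 1` it has signature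
`(4,4)`, for `s = -1` it is the Euclidean one. -/
def obilin (s : ℝ) : LinearMap.BilinForm ℝ Oct :=
  LinearMap.mk₂ ℝ (fun x y => omul s x (oconj y) 0)
    (by intro x x' y; simp [omul, oconj, ofPair]; ring)
    (by intro c x y; simp [omul, oconj, ofPair]; ring)
    (by intro x y y'; simp [omul, oconj, ofPair]; ring)
    (by intro c x y; simp [omul, oconj, ofPair]; ring)

/-- The squared norm `N(x) = (x, x)`. -/
def onorm (s : ℝ) : QuadraticForm ℝ Oct := (obilin s).toQuadraticMap

/-- The inverse `x̄ / N(x)`, used where `N(x) ≠ 0`. -/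
def oinv (s : ℝ) (x : Oct) : Oct := (onorm s x)⁻¹ • oconj x

/-- The basis `e₀, …, e₇`. -/
def obasis (i : Fin 8) : Oct := Pi.single i 1

/-- The imaginary unit `e_{i+1}`, for `i = 0, …, 6`. -/
def oim (i : Fin 7) : Oct := obasis i.succ

/-- The metric `η_{ab} = (e_a, e_b)` on imaginary units: signature `(3,4)` for `s = 1`. -/
def oeta (s : ℝ) (a b : Fin 7) : ℝ := obilin s (oim a) (oim b)

/-- The structure constants `f^a_{bc}`, defined by `e_b e_c = - η_{bc} e₀ + f^a_{bc} e_a`. -/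
def ostruct (s : ℝ) (a b c : Fin 7) : ℝ := omul s (oim b) (oim c) a.succ

/-- The group of automorphisms of the algebra: `G*_{2,2}` for the split octonions (`s = 1`),
and the compact group `G₂` for the octonions (`s = -1`). -/
def autOct (s : ℝ) : Subgroup (Oct ≃ₗ[ℝ] Oct) where
  carrier := {g | ∀ x y, g (omul s x y) = omul s (g x) (g y)}
  mul_mem' := by
    intro g h hg hh x y
    simp only [Set.mem_ofPred_eq] at hg hh
    simp [LinearEquiv.mul_apply, hg, hh]
  one_mem' := by intro x y; simp
  inv_mem' := by
    intro g hg x y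
    simp only [Set.mem_ofPred_eq] at hg
    apply g.injective
    have key : ∀ z, g (g⁻¹ z) = z := fun z => g.apply_symm_apply z
    rw [hg, key, key, key]

/-! ### The pseudo-sphere and its connections

The level sets of `N` are treated as submanifolds of the ambient space. Vector fields on (an open
part of) a level set are given by smooth functions on open subsets of the ambient space, tangent to
the level set along it. Along the level set, all the derivatives below are taken in directions
tangent to it, so that they depend only on the restrictions. -/

/-- The level set `N(x) = δ γ²`. For `s = 1` it is the pseudo-sphere `S^{3,4}` (`δ = 1`) or the
pseudo-hyperbolic space `H^{4,3}` (`δ = -1`) of radius `γ`, for `s = -1`, `δ = 1` it is the sphere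
`S⁷` of radius `γ`. -/
def pseudoSphere (s δ γ : ℝ) : Set Oct := {x | onorm s x = δ * γ ^ 2}

/-- The tangent space of the level set of `N` through `x` is the orthogonal complement of `x`. -/
def tangentAt (s : ℝ) (x : Oct) : Submodule ℝ Oct := LinearMap.ker (obilin s x)

/-- The orthogonal projection onto the tangent space at `x`, for `N(x) ≠ 0`. -/
def tproj (s : ℝ) (x w : Oct) : Oct := w - (obilin s x w / onorm s x) • x

/-- `X` is a smooth vector field on the part of the pseudo-sphere inside the open set `W`. -/
structure IsTangentField (s δ γ : ℝ) (W : Set Oct) (X : Oct → Oct) : Prop where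
  smooth : ContDiffOn ℝ ∞ X W
  tangent : ∀ x ∈ pseudoSphere s δ γ ∩ W, X x ∈ tangentAt s x

/-- The covariant derivative `∇_u Y` at `x` for the connection `∇ = ∇̄ + κ`. The first summand is
the Levi-Civita connection `∇̄` of the induced metric, and the tensor field `κ` is the contorsion,
so that `∇_u v = ∇̄_u v + κ(u, v)`. -/
def covD (s : ℝ) (κ : Oct → Oct →ₗ[ℝ] Oct →ₗ[ℝ] Oct) (Y : Oct → Oct) (x u : Oct) : Oct :=
  tproj s x (fderiv ℝ Y x u) + κ x u (Y x)

/-- `κ` is a smooth tensor field on the part of the pseudo-sphere inside the open set `W`, so that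
`∇̄ + κ` is an affine connection there. -/
structure IsConnectionOn (s δ γ : ℝ) (W : Set Oct) (κ : Oct → Oct →ₗ[ℝ] Oct →ₗ[ℝ] Oct) :
    Prop where
  isOpen : IsOpen W
  smooth : ∀ u v, ContDiffOn ℝ ∞ (fun x => κ x u v) W
  tangent : ∀ x ∈ pseudoSphere s δ γ ∩ W, ∀ u ∈ tangentAt s x, ∀ v ∈ tangentAt s x,
    κ x u v ∈ tangentAt s x

/-- `∇̄ + κ` is an affine connection on the whole pseudo-sphere. -/
def IsConnection (s δ γ : ℝ) (κ : Oct → Oct →ₗ[ℝ] Oct →ₗ[ℝ] Oct) : Prop :=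
  ∃ W, pseudoSphere s δ γ ⊆ W ∧ IsConnectionOn s δ γ W κ

/-- Metric compatibility: `u (Y, Z) = (∇_u Y, Z) + (Y, ∇_u Z)`. -/
def IsMetricConn (s δ γ : ℝ) (κ : Oct → Oct →ₗ[ℝ] Oct →ₗ[ℝ] Oct) : Prop :=
  ∀ W, IsOpen W → ∀ Y Z, IsTangentField s δ γ W Y → IsTangentField s δ γ W Z →
    ∀ x ∈ pseudoSphere s δ γ ∩ W, ∀ u ∈ tangentAt s x,
      fderiv ℝ (fun y => obilin s (Y y) (Z y)) x u =
        obilin s (covD s κ Y x u) (Z x) + obilin s (Y x) (covD s κ Z x u)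

/-- The torsion `T(X, Y) = ∇_X Y - ∇_Y X - [X, Y]`, at the point `x`. -/
def torsion (s : ℝ) (κ : Oct → Oct →ₗ[ℝ] Oct →ₗ[ℝ] Oct) (X Y : Oct → Oct) (x : Oct) : Oct :=
  covD s κ Y x (X x) - covD s κ X x (Y x) - VectorField.lieBracket ℝ X Y x

/-- The curvature `R(X, Y) Z = ∇_X ∇_Y Z - ∇_Y ∇_X Z - ∇_{[X, Y]} Z`, at the point `x`. -/
def curvature (s : ℝ) (κ : Oct → Oct →ₗ[ℝ] Oct →ₗ[ℝ] Oct) (X Y Z : Oct → Oct) (x : Oct) : Oct :=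
  covD s κ (fun y => covD s κ Z y (Y y)) x (X x)
    - covD s κ (fun y => covD s κ Z y (X y)) x (Y x)
    - covD s κ Z x (VectorField.lieBracket ℝ X Y x)

/-- The curvature vanishes on the part of the pseudo-sphere inside `W`. -/
def IsFlatOn (s δ γ : ℝ) (W : Set Oct) (κ : Oct → Oct →ₗ[ℝ] Oct →ₗ[ℝ] Oct) : Prop :=
  ∀ X Y Z, IsTangentField s δ γ W X → IsTangentField s δ γ W Y → IsTangentField s δ γ W Z →
    ∀ x ∈ pseudoSphere s δ γ ∩ W, curvature s κ X Y Z x = 0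

/-- The vector field `Y` on the pseudo-sphere is parallel: `∇ Y = 0`. -/
def IsParallel (s δ γ : ℝ) (κ : Oct → Oct →ₗ[ℝ] Oct →ₗ[ℝ] Oct) (Y : Oct → Oct) : Prop :=
  ∀ x ∈ pseudoSphere s δ γ, ∀ u ∈ tangentAt s x, covD s κ Y x u = 0

/-- `E` is a smooth Lorentz (orthonormal) frame on the part of the pseudo-sphere inside `W`. The
induced metric has components `δ η_{ab}` in it: for `s = 1`, its signature is `(3,4)` on `S^{3,4}`
and `(4,3)` on `H^{4,3}`. -/
structure IsLorentzFrame (s δ γ : ℝ) (W : Set Oct) (E : Fin 7 → Oct → Oct) : Prop where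
  tangent : ∀ a, IsTangentField s δ γ W (E a)
  orthonormal : ∀ x ∈ pseudoSphere s δ γ ∩ W, ∀ a b,
    obilin s (E a x) (E b x) = δ * oeta s a b

/-- The frame is positively oriented: `(x, E₁, …, E₇)` has the orientation of `(e₀, …, e₇)`. -/
def IsPosOriented (s δ γ : ℝ) (W : Set Oct) (E : Fin 7 → Oct → Oct) : Prop :=
  ∀ x ∈ pseudoSphere s δ γ ∩ W,
    0 < (Matrix.of (Fin.cons x (fun a => E a x) : Fin 8 → Oct)).det

/-- In the frame `E` with dual coframe `e^a`, the connection forms of `∇ = ∇̄ + κ`, given by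
`∇ E_b = ω^a_b E_a`, are `ω^a_b = ω̄^a_b + β f^a_{bc} e^c`. (Evaluate both sides at `E_c`.) -/
def HasStructForms (s δ γ β : ℝ) (W : Set Oct) (E : Fin 7 → Oct → Oct)
    (κ : Oct → Oct →ₗ[ℝ] Oct →ₗ[ℝ] Oct) : Prop :=
  ∀ x ∈ pseudoSphere s δ γ ∩ W, ∀ b c,
    covD s κ (E b) x (E c x) =
      covD s 0 (E b) x (E c x) + β • ∑ a, ostruct s a b c • E a x

/-! ### The two families of parallelisms -/

/-- Right or left multiplication. -/
inductive Side : Type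
  | right
  | left

/-- The sign `ε` in `ω^a_b = ω̄^a_b + (ε/γ) f^a_{bc} e^c`. -/
def Side.sgn : Side → ℝ
  | .right => -1
  | .left => 1

/-- The frame with reference point `α`: `(e_i α)(α⁻¹ x)` and `(x α⁻¹)(α e_i)`, normalised by the
radius `γ`. For `N(α) = 1`, `α⁻¹ = ᾱ`. -/
def multFrame (s γ : ℝ) (α : Oct) : Side → Fin 7 → Oct → Oct
  | .right, i, x => γ⁻¹ • omul s (omul s (oim i) α) (omul s (oinv s α) x)
  | .left, i, x => γ⁻¹ • omul s (omul s x (oinv s α)) (omul s α (oim i))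

/-! ### Symmetries of the torsion, and the spin group -/

/-- The torsion tensor `T(u, v)` of `∇̄ + κ` at `x`, in terms of the contorsion. -/
def torsionAt (κ : Oct → Oct →ₗ[ℝ] Oct →ₗ[ℝ] Oct) (x u v : Oct) : Oct := κ x u v - κ x v u

/-- `g` preserves `N`; these maps form the isometry group of the pseudo-sphere, `O(4,4)` for
`s = 1`, `O(8)` for `s = -1`. -/
def IsNormIsometry (s : ℝ) (g : Oct ≃ₗ[ℝ] Oct) : Prop := ∀ x, onorm s (g x) = onorm s x

/-- The isometries of the pseudo-sphere that preserve the torsion of `∇̄ + κ`. -/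
def IsTorsionSymmetry (s δ γ : ℝ) (κ : Oct → Oct →ₗ[ℝ] Oct →ₗ[ℝ] Oct) (g : Oct ≃ₗ[ℝ] Oct) :
    Prop :=
  IsNormIsometry s g ∧
    ∀ x ∈ pseudoSphere s δ γ, ∀ u ∈ tangentAt s x, ∀ v ∈ tangentAt s x,
      torsionAt κ (g x) (g u) (g v) = g (torsionAt κ x u v)

/-- The imaginary elements, `x̄ = -x`. -/
def imOct : Submodule ℝ Oct where
  carrier := {x | oconj x = -x}
  add_mem' := by
    intro x y hx hy
    have key : oconj (x + y) = oconj x + oconj y := by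
      ext i; fin_cases i <;> simp [oconj, ofPair] <;> ring
    rw [Set.mem_ofPred_eq] at hx hy ⊢
    rw [key, hx, hy, neg_add]
  zero_mem' := by
    rw [Set.mem_ofPred_eq]
    ext i; fin_cases i <;> simp [oconj, ofPair]
  smul_mem' := by
    intro c x hx
    have key : oconj (c • x) = c • oconj x := by
      ext i; fin_cases i <;> simp [oconj, ofPair]
    rw [Set.mem_ofPred_eq] at hx ⊢
    rw [key, hx, smul_neg]

/-- The quadratic form `δ N` on the imaginary elements, which is the induced metric on the tangent
spaces of the pseudo-sphere. For `s = 1` it has signature `(3,4)` if `δ = 1` and `(4,3)` if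
`δ = -1`; for `s = -1`, `δ = 1` it is Euclidean. Mathlib's `spinGroup` consists of the even
elements `g` of the Clifford group with `g gʳ = 1`, `gʳ` the reversal. So for this form it is the
identity component `Spin⁺(3,4)` (or `Spin⁺(4,3)`) of the spin group, or the compact `Spin(7)`. -/
def imForm (s δ : ℝ) : QuadraticForm ℝ imOct := δ • (onorm s).comp imOct.subtype

/-- The Clifford algebra with its canonical topology of a finite-dimensional real vector space. -/
instance cliffordTopology (s δ : ℝ) : TopologicalSpace (CliffordAlgebra (imForm s δ)) :=
  moduleTopology ℝ (CliffordAlgebra (imForm s δ))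

/-- The symmetry group of the torsion of `∇̄ + κ` is the spin group, and as a homogeneous space of
it the pseudo-sphere is `Spin⁺(3,4) / G*_{2,2}` (`Spin(7) / G₂` for `s = -1`). Here
* `ρ` is a spin representation, the restriction to the spin group of an isomorphism `Ψ` from the
  even Clifford algebra to the endomorphisms of the eight-dimensional space; it is injective, and
  its image consists of all the isometries that preserve the torsion;
* the stabiliser `H` of any point `p` is conjugate to the automorphism group of the algebra;
* `g H ↦ ρ(g) p` is a homeomorphism from the coset space to the pseudo-sphere;
* the orbit map `g ↦ ρ(g) p`, which is the restriction of a linear map, has smooth local sections,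
  so this homeomorphism is a diffeomorphism. -/
def SpinHomogeneous (s δ γ : ℝ) (κ : Oct → Oct →ₗ[ℝ] Oct →ₗ[ℝ] Oct) : Prop :=
  ∃ (Ψ : CliffordAlgebra.even (imForm s δ) ≃ₐ[ℝ] Module.End ℝ Oct)
    (ρ : spinGroup (imForm s δ) →* (Oct ≃ₗ[ℝ] Oct)),
    (∀ g : spinGroup (imForm s δ),
      (ρ g : Oct →ₗ[ℝ] Oct) =
        Ψ ⟨(g : CliffordAlgebra (imForm s δ)), spinGroup.mem_even g.2⟩) ∧
    Function.Injective ρ ∧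
    (∀ T : Oct ≃ₗ[ℝ] Oct, T ∈ ρ.range ↔ IsTorsionSymmetry s δ γ κ T) ∧
    ∀ p ∈ pseudoSphere s δ γ, ∃ H : Subgroup (spinGroup (imForm s δ)),
      (∀ g, g ∈ H ↔ ρ g p = p) ∧
      (∃ h : Oct ≃ₗ[ℝ] Oct, h p = obasis 0 ∧
        (H.map ρ).map (MulAut.conj h).toMonoidHom = autOct s) ∧
      (∃ Φ : (spinGroup (imForm s δ) ⧸ H) ≃ₜ pseudoSphere s δ γ,
        ∀ g : spinGroup (imForm s δ),
          (Φ (QuotientGroup.mk g : spinGroup (imForm s δ) ⧸ H) : Oct) = ρ g p) ∧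
      ∀ q ∈ pseudoSphere s δ γ, ∃ W, IsOpen W ∧ q ∈ W ∧ ∃ σ : Oct → Oct →ₗ[ℝ] Oct,
        (∀ v, ContDiffOn ℝ ∞ (fun x => σ x v) W) ∧ ∀ x ∈ pseudoSphere s δ γ ∩ W,
          σ x p = x ∧ ∃ g, σ x = ρ g

end

noncomputable section

/-! ### Algebra of the Cayley-Dickson product -/

section Coordinates

variable (s : ℝ) (x y : Oct)

/-! The whole theorem is read off from the triple product `otri`, (v x̄)u. A chart `S` is a linear
map that multiplies N by δ/γ², so it carries the level set to the elements of norm 1. The fields x ↦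
S⁻¹(a·Sx) with `a` imaginary are tangent; their derivative along `u` is S⁻¹(a·Su), and `a` is
recovered from the value `v` as Sv times the conjugate of Sx. Hence these fields are parallel
exactly when the contorsion is minus the tangential part of S⁻¹((Sv·conj(Sx))Su), which on tangent
vectors is the antisymmetrised expression `contorsion`. In components with respect to the parallel
frame, covariant differentiation is ordinary differentiation along the level set, and flatness is
the symmetry of second derivatives (`contorsion_isFlatOn`). The Moufang identity `omul_moufang`
shows that both families of frames arise in this way, with S a multiple of right multiplication by
α, or that of ᾱ preceded by conjugation (`multFrame_eq_sFrame`).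

Two reference points of one family give the same connection only if ᾱβ lies in the middle nucleus of
the algebra, which is ℝ. A connection common to both families would make the algebra commutative.

The coefficients are bounded by sectional curvature: pairing R(X,Y)Y with X, a flat connection with
skew contorsion κ satisfies N(κ(X,Y)) = (δγ²)⁻¹(N(X)N(Y) − (X,Y)²) (`onorm_contorsion_of_flat`). Two
units of a frame whose product is again a unit then determine β².

On vectors orthogonal to the base point the torsion is twice the triple product up to a metric term,
so its symmetries are, up to conjugation by `S`, the group `triGroup` (`isTorsionSymmetry_iff`).
Left multiplication L_a by an imaginary `a` is a similitude of the triple product, again by Moufang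
identities. Conversely, an element T of `triGroup` satisfies T L_a = L_{A(a)} T with `A` orthogonal;
undoing `A` by reflections and applying Schur's lemma writes T as a product of evenly many L_a, up
to a scalar. The same products describe the spin group under the isomorphism `spinHom`, which gives
`mem_range_spinRep`. The stabiliser of 1 in `triGroup` is the automorphism group, since (x 1̄)y =
xy. Finally, explicit products of two left multiplications take 1 to any `x` of norm 1 and depend
smoothly on `x` near a suitable point; they give transitivity, the local sections, and the adapted
frames in which the contorsion becomes the structure constants. -/

theorem omul_zero_coord : omul s x y 0 = x 0 * y 0 - x 1 * y 1 - x 2 * y 2 - x 3 * y 3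
    + s * (x 4 * y 4 + x 5 * y 5 + x 6 * y 6 + x 7 * y 7) := by
  simp only [omul, ofPair]; simp; ring_nf; simp

theorem omul_one_coord : omul s x y 1 = x 0 * y 1 + x 1 * y 0 + x 2 * y 3 - x 3 * y 2
    + s * (y 5 * x 4 - y 4 * x 5 + y 7 * x 6 - y 6 * x 7) := by
  simp only [omul, ofPair]; simp; ring_nf; simp

theorem omul_two_coord : omul s x y 2 = x 0 * y 2 - x 1 * y 3 + x 2 * y 0 + x 3 * y 1
    + s * (y 6 * x 4 - y 4 * x 6 + y 5 * x 7 - y 7 * x 5) := by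
  simp only [omul, ofPair]; simp; ring_nf; simp

theorem omul_three_coord : omul s x y 3 = x 0 * y 3 + x 1 * y 2 - x 2 * y 1 + x 3 * y 0
    + s * (y 7 * x 4 - y 4 * x 7 + y 6 * x 5 - y 5 * x 6) := by
  simp only [omul, ofPair]; simp; ring_nf; simp

theorem omul_four_coord : omul s x y 4 = y 4 * x 0 + y 5 * x 1 + y 6 * x 2 + y 7 * x 3
    + x 4 * y 0 - x 5 * y 1 - x 6 * y 2 - x 7 * y 3 := by
  simp [omul, ofPair]; ring

theorem omul_five_coord : omul s x y 5 = x 7 * y 2 + x 4 * y 1 + x 5 * y 0 - x 6 * y 3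
    - y 7 * x 2 + y 6 * x 3 + y 5 * x 0 - y 4 * x 1 := by
  simp [omul, ofPair]; ring

theorem omul_six_coord : omul s x y 6 = -(x 7 * y 1) + x 6 * y 0 + x 5 * y 3 + x 4 * y 2
    + y 7 * x 1 + y 6 * x 0 - y 5 * x 3 - y 4 * x 2 := by
  simp [omul, ofPair]; ring

theorem omul_seven_coord : omul s x y 7 = x 7 * y 0 + x 6 * y 1 + x 4 * y 3 - x 5 * y 2
    + y 7 * x 0 - y 6 * x 1 + y 5 * x 2 - y 4 * x 3 := by
  simp [omul, ofPair]; ring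

theorem oconj_zero_coord : oconj x 0 = x 0 := by simp [oconj, ofPair]
theorem oconj_one_coord : oconj x 1 = -x 1 := by simp [oconj, ofPair]
theorem oconj_two_coord : oconj x 2 = -x 2 := by simp [oconj, ofPair]
theorem oconj_three_coord : oconj x 3 = -x 3 := by simp [oconj, ofPair]
theorem oconj_four_coord : oconj x 4 = -x 4 := by simp [oconj, ofPair]
theorem oconj_five_coord : oconj x 5 = -x 5 := by simp [oconj, ofPair]
theorem oconj_six_coord : oconj x 6 = -x 6 := by simp [oconj, ofPair]
theorem oconj_seven_coord : oconj x 7 = -x 7 := by simp [oconj, ofPair]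

theorem obilin_coord : obilin s x y = x 0 * y 0 + x 1 * y 1 + x 2 * y 2 + x 3 * y 3
    - s * (x 4 * y 4 + x 5 * y 5 + x 6 * y 6 + x 7 * y 7) := by
  simp only [obilin, LinearMap.mk₂_apply, omul_zero_coord, oconj_zero_coord, oconj_one_coord,
    oconj_two_coord, oconj_three_coord, oconj_four_coord, oconj_five_coord, oconj_six_coord,
    oconj_seven_coord]
  ring

theorem onorm_eq_obilin : onorm s x = obilin s x x := rfl

end Coordinates

section Identities

variable (s : ℝ)

/-- The product as a bilinear map. -/
def omulB : Oct →ₗ[ℝ] Oct →ₗ[ℝ] Oct :=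
  LinearMap.mk₂ ℝ (omul s)
    (by
      intro x x' y; ext i; fin_cases i <;> simp [omul_zero_coord, omul_one_coord, omul_two_coord,
        omul_three_coord, omul_four_coord, omul_five_coord, omul_six_coord, omul_seven_coord] <;>
        ring)
    (by
      intro c x y; ext i; fin_cases i <;> simp [omul_zero_coord, omul_one_coord, omul_two_coord,
        omul_three_coord, omul_four_coord, omul_five_coord, omul_six_coord, omul_seven_coord] <;>
        ring)
    (by
      intro x y y'; ext i; fin_cases i <;> simp [omul_zero_coord, omul_one_coord, omul_two_coord,
        omul_three_coord, omul_four_coord, omul_five_coord, omul_six_coord, omul_seven_coord] <;>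
        ring)
    (by
      intro c x y; ext i; fin_cases i <;> simp [omul_zero_coord, omul_one_coord, omul_two_coord,
        omul_three_coord, omul_four_coord, omul_five_coord, omul_six_coord, omul_seven_coord] <;>
        ring)

@[simp] theorem omulB_apply (x y : Oct) : omulB s x y = omul s x y := rfl

theorem omul_add (x y z : Oct) : omul s x (y + z) = omul s x y + omul s x z :=
  map_add (omulB s x) y z
theorem add_omul (x y z : Oct) : omul s (x + y) z = omul s x z + omul s y z :=
  LinearMap.congr_fun (map_add (omulB s) x y) z
theorem omul_smul (c : ℝ) (x y : Oct) : omul s x (c • y) = c • omul s x y :=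
  map_smul (omulB s x) c y
theorem smul_omul (c : ℝ) (x y : Oct) : omul s (c • x) y = c • omul s x y :=
  LinearMap.congr_fun (map_smul (omulB s) c x) y
theorem omul_neg (x y : Oct) : omul s x (-y) = -omul s x y := map_neg (omulB s x) y
theorem neg_omul (x y : Oct) : omul s (-x) y = -omul s x y :=
  LinearMap.congr_fun (map_neg (omulB s) x) y
theorem omul_sub (x y z : Oct) : omul s x (y - z) = omul s x y - omul s x z :=
  map_sub (omulB s x) y z
theorem sub_omul (x y z : Oct) : omul s (x - y) z = omul s x z - omul s y z :=
  LinearMap.congr_fun (map_sub (omulB s) x y) z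

/-- Conjugation as a linear equivalence. -/
def oconjL : Oct ≃ₗ[ℝ] Oct :=
  LinearEquiv.ofInvolutive
    { toFun := oconj
      map_add' := by
        intro x y; ext i; fin_cases i <;> simp [oconj, ofPair] <;> ring
      map_smul' := by
        intro c x; ext i; fin_cases i <;> simp [oconj, ofPair] }
    (by intro x; ext i; fin_cases i <;> simp [oconj, ofPair])

@[simp] theorem oconjL_apply (x : Oct) : oconjL x = oconj x := rfl
@[simp] theorem oconjL_symm_apply (x : Oct) : oconjL.symm x = oconj x := rfl

@[simp] theorem oconj_oconj (x : Oct) : oconj (oconj x) = x := oconjL.symm_apply_apply x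
theorem oconj_add (x y : Oct) : oconj (x + y) = oconj x + oconj y := map_add oconjL x y
theorem oconj_neg (x : Oct) : oconj (-x) = -oconj x := map_neg oconjL x
theorem oconj_smul (c : ℝ) (x : Oct) : oconj (c • x) = c • oconj x := map_smul oconjL c x

theorem oconj_omul (x y : Oct) : oconj (omul s x y) = omul s (oconj y) (oconj x) := by
  ext i
  fin_cases i <;>
  simp [omul_zero_coord, omul_one_coord, omul_two_coord, omul_three_coord, omul_four_coord,
    omul_five_coord, omul_six_coord, omul_seven_coord, oconj_zero_coord, oconj_one_coord,
    oconj_two_coord, oconj_three_coord, oconj_four_coord, oconj_five_coord, oconj_six_coord,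
    oconj_seven_coord] <;> ring

theorem obilin_comm (x y : Oct) : obilin s x y = obilin s y x := by
  simp only [obilin_coord]; ring

theorem obilin_oconj (x y : Oct) : obilin s (oconj x) (oconj y) = obilin s x y := by
  simp only [obilin_coord, oconj_zero_coord, oconj_one_coord,
    oconj_two_coord, oconj_three_coord, oconj_four_coord, oconj_five_coord, oconj_six_coord,
    oconj_seven_coord]
  ring

@[simp] theorem onorm_oconj (x : Oct) : onorm s (oconj x) = onorm s x := obilin_oconj s x x

/-- Left alternativity in the form in which it is used throughout: it yields the composition law,
the inverses and, polarised, the Clifford relations. It is checked in coordinates for every `s`. -/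
theorem oconj_omul_omul (x y : Oct) : omul s (oconj x) (omul s x y) = onorm s x • y := by
  ext i
  fin_cases i <;>
  simp [omul_zero_coord, omul_one_coord, omul_two_coord, omul_three_coord, omul_four_coord,
    omul_five_coord, omul_six_coord, omul_seven_coord, oconj_zero_coord, oconj_one_coord,
    oconj_two_coord, oconj_three_coord, oconj_four_coord, oconj_five_coord, oconj_six_coord,
    oconj_seven_coord, onorm_eq_obilin, obilin_coord] <;> ring

theorem omul_oconj_omul (x y : Oct) : omul s x (omul s (oconj x) y) = onorm s x • y := by
  simpa using oconj_omul_omul s (oconj x) y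

theorem omul_omul_oconj (x y : Oct) : omul s (omul s y x) (oconj x) = onorm s x • y := by
  have h := congrArg oconj (omul_oconj_omul s x (oconj y))
  simpa [oconj_omul, oconj_smul] using h

theorem omul_oconj_omul_self (x y : Oct) : omul s (omul s y (oconj x)) x = onorm s x • y := by
  simpa using omul_omul_oconj s (oconj x) y

theorem obilin_omul_left (x y z : Oct) :
    obilin s (omul s x y) z = obilin s y (omul s (oconj x) z) := by
  simp only [omul_zero_coord, omul_one_coord, omul_two_coord, omul_three_coord, omul_four_coord,
    omul_five_coord, omul_six_coord, omul_seven_coord, oconj_zero_coord, oconj_one_coord,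
    oconj_two_coord, oconj_three_coord, oconj_four_coord, oconj_five_coord, oconj_six_coord,
    oconj_seven_coord, obilin_coord]
  ring

theorem obilin_omul_right (x y z : Oct) :
    obilin s (omul s x y) z = obilin s x (omul s z (oconj y)) := by
  rw [← obilin_oconj, oconj_omul, obilin_omul_left, ← obilin_oconj]
  simp [oconj_omul]

theorem obilin_omul_omul_left (x y z : Oct) :
    obilin s (omul s x y) (omul s x z) = onorm s x * obilin s y z := by
  rw [obilin_omul_left, oconj_omul_omul, map_smul, smul_eq_mul]

theorem obilin_omul_omul_right (x y z : Oct) :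
    obilin s (omul s y x) (omul s z x) = onorm s x * obilin s y z := by
  rw [obilin_omul_right, omul_omul_oconj, map_smul, smul_eq_mul]

theorem onorm_omul (x y : Oct) : onorm s (omul s x y) = onorm s x * onorm s y :=
  obilin_omul_omul_left s x y y

@[simp] theorem one_omul (x : Oct) : omul s (obasis 0) x = x := by
  ext i
  fin_cases i <;>
  simp [omul_zero_coord, omul_one_coord, omul_two_coord, omul_three_coord, omul_four_coord,
    omul_five_coord, omul_six_coord, omul_seven_coord, obasis]

@[simp] theorem omul_one (x : Oct) : omul s x (obasis 0) = x := by
  ext i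
  fin_cases i <;>
  simp [omul_zero_coord, omul_one_coord, omul_two_coord, omul_three_coord, omul_four_coord,
    omul_five_coord, omul_six_coord, omul_seven_coord, obasis]

@[simp] theorem oconj_one : oconj (obasis 0) = obasis 0 := by
  ext i
  fin_cases i <;> simp [oconj, ofPair, obasis]

theorem omul_oconj (x : Oct) : omul s x (oconj x) = onorm s x • obasis 0 := by
  simpa using omul_oconj_omul s x (obasis 0)

theorem oconj_omul_self (x : Oct) : omul s (oconj x) x = onorm s x • obasis 0 := by
  simpa using oconj_omul_omul s x (obasis 0)

theorem obilin_one (x : Oct) : obilin s (obasis 0) x = x 0 := by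
  simp [obilin_coord, obasis]

@[simp] theorem onorm_one : onorm s (obasis 0) = 1 := by
  rw [onorm_eq_obilin, obilin_one]; simp [obasis]

theorem onorm_smul (c : ℝ) (x : Oct) : onorm s (c • x) = c ^ 2 * onorm s x := by
  rw [QuadraticMap.map_smul, smul_eq_mul, pow_two]

theorem onorm_add (x y : Oct) :
    onorm s (x + y) = onorm s x + onorm s y + 2 * obilin s x y := by
  simp only [onorm_eq_obilin, map_add, LinearMap.add_apply, obilin_comm s y x]; ring

theorem oconj_eq (x : Oct) : oconj x = (2 * x 0) • obasis 0 - x := by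
  ext i
  fin_cases i <;> simp [oconj, ofPair, obasis]; ring

/-- Polarisation of x̄(xz) = N(x)z. For imaginary elements this is the Clifford relation of left
multiplications. -/
theorem oconj_omul_add (x y z : Oct) :
    omul s (oconj x) (omul s y z) + omul s (oconj y) (omul s x z) = (2 * obilin s x y) • z := by
  have h := oconj_omul_omul s (x + y) z
  rw [oconj_add, add_omul, add_omul, omul_add, omul_add, oconj_omul_omul, oconj_omul_omul,
    onorm_add, add_smul, add_smul] at h
  rw [← sub_eq_zero] at h ⊢
  rw [← h]; abel

theorem omul_oconj_add (x y z : Oct) :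
    omul s (omul s z (oconj x)) y + omul s (omul s z (oconj y)) x = (2 * obilin s x y) • z := by
  have h := congrArg oconj (oconj_omul_add s x y (oconj z))
  simp only [oconj_add, oconj_omul, oconj_oconj, oconj_smul] at h
  rw [← h, add_comm]

/-- A Moufang identity. -/
theorem omul_moufang (a b u : Oct) :
    omul s (omul s b a) (omul s (oconj a) u) = omul s (omul s b (omul s u a)) (oconj a) := by
  ext i
  fin_cases i <;>
  simp only [Fin.zero_eta, Fin.mk_one, Fin.reduceFinMk, omul_zero_coord, omul_one_coord,
    omul_two_coord, omul_three_coord, omul_four_coord,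
    omul_five_coord, omul_six_coord, omul_seven_coord, oconj_zero_coord, oconj_one_coord,
    oconj_two_coord, oconj_three_coord, oconj_four_coord, oconj_five_coord, oconj_six_coord,
    oconj_seven_coord] <;> ring

theorem obilin_nondegenerate {s : ℝ} (hs : s ≠ 0) {x : Oct} (h : ∀ y, obilin s x y = 0) :
    x = 0 := by
  ext i
  have := h (obasis i)
  fin_cases i <;> simpa [obilin_coord, obasis, hs] using this

end Identities


/-! ### The triple product -/

section Triple

variable (s : ℝ)

/-- The triple product `(v x̄) u`. -/
def otri (v x u : Oct) : Oct := omul s (omul s v (oconj x)) u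

theorem otri_self_left (x u : Oct) : otri s x x u = onorm s x • u := by
  rw [otri, omul_oconj, smul_omul, one_omul]

theorem otri_self_right (v x : Oct) : otri s v x x = onorm s x • v :=
  omul_oconj_omul_self s x v

theorem omul_oconj_add_omul_oconj (x y : Oct) :
    omul s x (oconj y) + omul s y (oconj x) = (2 * obilin s x y) • obasis 0 := by
  have := oconj_omul_add s (oconj x) (oconj y) (obasis 0)
  simpa [obilin_oconj] using this

theorem otri_swap_left (v x u : Oct) :
    otri s v x u = (2 * obilin s v x) • u - otri s x v u := by
  rw [eq_sub_iff_add_eq, otri, otri, ← add_omul, omul_oconj_add_omul_oconj, smul_omul, one_omul]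

theorem otri_swap_right (v x u : Oct) :
    otri s v x u = (2 * obilin s x u) • v - otri s v u x := by
  rw [eq_sub_iff_add_eq, otri, otri, omul_oconj_add]

/-- Three transpositions of neighbours: up to terms with scalar products the triple product is
alternating. -/
theorem otri_swap_outer (v x u : Oct) :
    otri s v x u = (2 * obilin s x u) • v - (2 * obilin s v u) • x + (2 * obilin s v x) • u
      - otri s u x v := by
  rw [otri_swap_left, otri_swap_right s x v u, otri_swap_left s x u v]
  abel

/-- The adjoint of left multiplication by u x̄ is left multiplication by x ū, and the two add up to
2(u,x). With `obilin_otri_outer`, the same fact for the outer slot, this makes the contorsion skew.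
-/
theorem obilin_otri_middle (v x u w : Oct) :
    obilin s (otri s u x v) w + obilin s v (otri s u x w) =
      2 * obilin s u x * obilin s v w := by
  have h : obilin s (otri s u x v) w = obilin s v (otri s x u w) := by
    rw [otri, obilin_omul_left, oconj_omul, oconj_oconj, otri]
  rw [h, otri_swap_left s u x w, map_sub, map_smul, smul_eq_mul]
  ring

theorem obilin_otri_outer (v x u w : Oct) :
    obilin s (otri s v x u) w + obilin s v (otri s w x u) =
      2 * obilin s x u * obilin s v w := by
  have h : obilin s (otri s v x u) w = obilin s v (otri s w u x) := by
    rw [otri, obilin_omul_right, obilin_omul_right, oconj_oconj, otri]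
  rw [h, otri_swap_right s w x u, map_sub, map_smul, smul_eq_mul]
  ring

variable {s}

theorem otri_add_left (v v' x u : Oct) : otri s (v + v') x u = otri s v x u + otri s v' x u := by
  simp only [otri, add_omul]
theorem otri_add_middle (v x x' u : Oct) :
    otri s v (x + x') u = otri s v x u + otri s v x' u := by
  simp only [otri, add_omul, omul_add, oconj_add]
theorem otri_add_right (v x u u' : Oct) : otri s v x (u + u') = otri s v x u + otri s v x u' := by
  simp only [otri, omul_add]
theorem otri_smul_left (c : ℝ) (v x u : Oct) : otri s (c • v) x u = c • otri s v x u := by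
  simp only [otri, smul_omul]
theorem otri_smul_middle (c : ℝ) (v x u : Oct) : otri s v (c • x) u = c • otri s v x u := by
  simp only [otri, smul_omul, omul_smul, oconj_smul]
theorem otri_smul_right (c : ℝ) (v x u : Oct) : otri s v x (c • u) = c • otri s v x u := by
  simp only [otri, omul_smul]

end Triple

/-! ### Calculus on the level sets -/

section Calculus

variable {F : Type*} [NormedAddCommGroup F] [NormedSpace ℝ F]

theorem mem_tangentAt {s : ℝ} {x u : Oct} : u ∈ tangentAt s x ↔ obilin s x u = 0 := Iff.rfl

theorem mem_pseudoSphere {s δ γ : ℝ} {x : Oct} :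
    x ∈ pseudoSphere s δ γ ↔ onorm s x = δ * γ ^ 2 := Iff.rfl

theorem onorm_add_smul_of_tangent {s : ℝ} {x u : Oct} (hu : obilin s x u = 0) (t : ℝ) :
    onorm s (x + t • u) = onorm s x + t ^ 2 * onorm s u := by
  rw [onorm_add, onorm_smul, map_smul, hu]; simp

/-- A function that vanishes on the level set has vanishing tangential derivatives. -/
theorem fderiv_tangent_eq_zero {s δ γ : ℝ} (hn : δ * γ ^ 2 ≠ 0) {W : Set Oct} (hW : IsOpen W)
    {f : Oct → F} (hf : ∀ y ∈ pseudoSphere s δ γ ∩ W, f y = 0) {x : Oct}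
    (hx : x ∈ pseudoSphere s δ γ ∩ W) (hd : DifferentiableAt ℝ f x) {u : Oct}
    (hu : u ∈ tangentAt s x) : fderiv ℝ f x u = 0 := by
  obtain ⟨hxM, hxW⟩ := hx
  rw [mem_pseudoSphere] at hxM
  -- Since N(x + tu) = N(x)(1 + t²k) for tangent `u`, dividing by the root of 1 + t²k gives a curve
  -- in the level set with velocity `u` at t = 0.
  set k : ℝ := onorm s u / (δ * γ ^ 2) with hk
  let r : ℝ → ℝ := fun t => (√(1 + t ^ 2 * k))⁻¹
  let c : ℝ → Oct := fun t => r t • (x + t • u)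
  have hr0 : r 0 = 1 := by simp [r]
  have hr : HasDerivAt r 0 0 := by
    have h1 : HasDerivAt (fun t : ℝ => 1 + t ^ 2 * k) 0 0 := by
      have := ((hasDerivAt_pow 2 (0 : ℝ)).mul_const k).const_add 1
      simpa using this
    have h2 := (h1.sqrt (by simp)).inv (by simp)
    refine HasDerivAt.congr_deriv (f := r) h2 ?_
    simp
  have hc : HasDerivAt c u 0 := by
    have h1 : HasDerivAt (fun t : ℝ => x + t • u) u 0 := by
      simpa using ((hasDerivAt_id (0 : ℝ)).smul_const u).const_add x
    have := hr.smul h1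
    refine HasDerivAt.congr_deriv (f := c) this ?_
    simp [hr0]
  have hc0 : c 0 = x := by simp [c, hr0]
  have hpos : ∀ᶠ t in nhds (0 : ℝ), 0 < 1 + t ^ 2 * k := by
    have : ContinuousAt (fun t : ℝ => 1 + t ^ 2 * k) 0 := by fun_prop
    exact this.eventually (lt_mem_nhds (by simp))
  have hWt : ∀ᶠ t in nhds (0 : ℝ), c t ∈ W :=
    hc.continuousAt.eventually (hW.mem_nhds (by rwa [hc0]))
  have hzero : (fun t => f (c t)) =ᶠ[nhds 0] fun _ => 0 := by
    filter_upwards [hpos, hWt] with t ht hw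
    refine hf _ ⟨?_, hw⟩
    rw [mem_pseudoSphere]
    simp only [c, r]
    rw [onorm_smul, onorm_add_smul_of_tangent hu, hxM, inv_pow, Real.sq_sqrt ht.le]
    have : onorm s u = k * (δ * γ ^ 2) := by rw [hk, div_mul_cancel₀ _ hn]
    rw [this, inv_mul_eq_iff_eq_mul₀ ht.ne']
    ring
  have hfd : HasFDerivAt f (fderiv ℝ f x) (c 0) := by rw [hc0]; exact hd.hasFDerivAt
  have h1 : HasDerivAt (fun t => f (c t)) (fderiv ℝ f x u) 0 := hfd.comp_hasDerivAt 0 hc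
  have h2 : HasDerivAt (fun t => f (c t)) 0 0 := (hasDerivAt_const 0 (0 : F)).congr_of_eventuallyEq hzero
  exact h1.unique h2

/-- This justifies replacing a field, under a tangential derivative, by any other extension of its
values on the level set; all iterated covariant derivatives are computed in this way. -/
theorem fderiv_tangent_congr {s δ γ : ℝ} (hn : δ * γ ^ 2 ≠ 0) {W : Set Oct} (hW : IsOpen W)
    {f g : Oct → F} (hfg : ∀ y ∈ pseudoSphere s δ γ ∩ W, f y = g y) {x : Oct}
    (hx : x ∈ pseudoSphere s δ γ ∩ W) (hf : DifferentiableAt ℝ f x) (hg : DifferentiableAt ℝ g x)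
    {u : Oct} (hu : u ∈ tangentAt s x) : fderiv ℝ f x u = fderiv ℝ g x u := by
  have := fderiv_tangent_eq_zero hn hW (f := f - g)
    (fun y hy => by simp [hfg y hy]) hx (hf.sub hg) hu
  rw [fderiv_sub hf hg] at this
  simpa [sub_eq_zero] using this

theorem DifferentiableAt.bilin (b : Oct →ₗ[ℝ] Oct →ₗ[ℝ] F) {f g : Oct → Oct} {x : Oct}
    (hf : DifferentiableAt ℝ f x) (hg : DifferentiableAt ℝ g x) :
    DifferentiableAt ℝ (fun y => b (f y) (g y)) x :=
  ((b.toContinuousBilinearMap).hasFDerivAt_of_bilinear hf.hasFDerivAt hg.hasFDerivAt).differentiableAt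

theorem fderiv_bilin (b : Oct →ₗ[ℝ] Oct →ₗ[ℝ] F) {f g : Oct → Oct} {x : Oct}
    (hf : DifferentiableAt ℝ f x) (hg : DifferentiableAt ℝ g x) (u : Oct) :
    fderiv ℝ (fun y => b (f y) (g y)) x u = b (fderiv ℝ f x u) (g x) + b (f x) (fderiv ℝ g x u) := by
  have := ((b.toContinuousBilinearMap).hasFDerivAt_of_bilinear hf.hasFDerivAt hg.hasFDerivAt).fderiv
  simp only [LinearMap.toContinuousBilinearMap_apply] at this
  rw [this]
  simp [add_comm]

theorem ContDiffOn.bilin (b : Oct →ₗ[ℝ] Oct →ₗ[ℝ] F) {f g : Oct → Oct} {W : Set Oct} {n : WithTop ℕ∞}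
    (hf : ContDiffOn ℝ n f W) (hg : ContDiffOn ℝ n g W) :
    ContDiffOn ℝ n (fun y => b (f y) (g y)) W :=
  (b.toContinuousBilinearMap).isBoundedBilinearMap.contDiff.comp_contDiffOn (hf.prodMk hg)

end Calculus

/-! ### Metric compatibility and torsion of the tangential derivative -/

section LeviCivita

variable {s δ γ : ℝ} {W : Set Oct}

theorem IsTangentField.differentiableAt {X : Oct → Oct} (hX : IsTangentField s δ γ W X)
    (hW : IsOpen W) {x : Oct} (hx : x ∈ W) : DifferentiableAt ℝ X x :=
  (hX.smooth.contDiffAt (hW.mem_nhds hx)).differentiableAt (by simp)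

theorem tproj_eq_self {x w : Oct} (h : w ∈ tangentAt s x) : tproj s x w = w := by
  simp [tproj, mem_tangentAt.1 h]

theorem tproj_self {x : Oct} (h : onorm s x ≠ 0) : tproj s x x = 0 := by
  rw [tproj, ← onorm_eq_obilin, div_self h, one_smul, sub_self]

theorem tproj_add (x v w : Oct) : tproj s x (v + w) = tproj s x v + tproj s x w := by
  simp only [tproj, map_add, add_div, add_smul]; abel
theorem tproj_smul (c : ℝ) (x w : Oct) : tproj s x (c • w) = c • tproj s x w := by
  simp only [tproj, map_smul, smul_eq_mul, smul_sub, smul_smul, mul_div_assoc]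
theorem tproj_sub (x v w : Oct) : tproj s x (v - w) = tproj s x v - tproj s x w := by
  simp only [tproj, map_sub, sub_div, sub_smul]; abel

theorem tproj_mem {x : Oct} (h : onorm s x ≠ 0) (w : Oct) : tproj s x w ∈ tangentAt s x := by
  rw [mem_tangentAt, tproj, map_sub, map_smul, smul_eq_mul, ← onorm_eq_obilin,
    div_mul_cancel₀ _ h, sub_self]

theorem obilin_tproj {x z : Oct} (hz : z ∈ tangentAt s x) (w : Oct) :
    obilin s (tproj s x w) z = obilin s w z := by
  rw [tproj, map_sub, map_smul, LinearMap.sub_apply, LinearMap.smul_apply, mem_tangentAt.1 hz]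
  simp

/-- The connection with contorsion `κ` is metric if `κ` takes skew-symmetric values. -/
theorem isMetricConn_of_skew (κ : Oct → Oct →ₗ[ℝ] Oct →ₗ[ℝ] Oct)
    (hκ : ∀ x ∈ pseudoSphere s δ γ, ∀ u v w, obilin s (κ x u v) w + obilin s v (κ x u w) = 0) :
    IsMetricConn s δ γ κ := by
  intro W hW Y Z hY hZ x hx u hu
  have hYx := hY.tangent x hx
  have hZx := hZ.tangent x hx
  rw [fderiv_bilin _ (hY.differentiableAt hW hx.2) (hZ.differentiableAt hW hx.2)]
  simp only [covD, map_add, LinearMap.add_apply]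
  rw [obilin_tproj hZx, obilin_comm s (Y x) (tproj s x _), obilin_tproj hYx,
    obilin_comm s _ (Y x)]
  linear_combination -(hκ x hx.1 u (Y x) (Z x))

/-- Differentiate (y, Y(y)) = 0 along the level set. This is the second fundamental form. -/
theorem obilin_fderiv_tangentField (hn : δ * γ ^ 2 ≠ 0) (hW : IsOpen W) {Y : Oct → Oct}
    (hY : IsTangentField s δ γ W Y) {x : Oct} (hx : x ∈ pseudoSphere s δ γ ∩ W) {u : Oct}
    (hu : u ∈ tangentAt s x) : obilin s x (fderiv ℝ Y x u) = -obilin s u (Y x) := by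
  have hd := hY.differentiableAt hW hx.2
  have h := fderiv_tangent_eq_zero hn hW (f := fun y => obilin s y (Y y))
    (fun y hy => hY.tangent y hy) hx (differentiableAt_id.bilin _ hd) hu
  have h2 := fderiv_bilin (obilin s) (differentiableAt_id (𝕜 := ℝ) (x := x)) hd u
  simp only [id, fderiv_id, ContinuousLinearMap.id_apply] at h2
  rw [h2] at h
  linarith

/-- The normal components of the two derivatives in the bracket agree because the second fundamental
form is symmetric. -/
theorem lieBracket_mem_tangentAt (hn : δ * γ ^ 2 ≠ 0) (hW : IsOpen W) {X Y : Oct → Oct}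
    (hX : IsTangentField s δ γ W X) (hY : IsTangentField s δ γ W Y) {x : Oct}
    (hx : x ∈ pseudoSphere s δ γ ∩ W) :
    VectorField.lieBracket ℝ X Y x ∈ tangentAt s x := by
  rw [mem_tangentAt, VectorField.lieBracket, map_sub,
    obilin_fderiv_tangentField hn hW hY hx (hX.tangent x hx),
    obilin_fderiv_tangentField hn hW hX hx (hY.tangent x hx), obilin_comm s (X x)]
  ring

/-- The bracket is tangent, so the projected derivatives cancel it and only the contorsion remains.
For κ = 0 it says that the tangential derivative is torsion-free. -/
theorem torsion_eq_torsionAt (hn : δ * γ ^ 2 ≠ 0) (κ : Oct → Oct →ₗ[ℝ] Oct →ₗ[ℝ] Oct)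
    (hW : IsOpen W) {X Y : Oct → Oct}
    (hX : IsTangentField s δ γ W X) (hY : IsTangentField s δ γ W Y) {x : Oct}
    (hx : x ∈ pseudoSphere s δ γ ∩ W) :
    torsion s κ X Y x = torsionAt κ x (X x) (Y x) := by
  have h := tproj_eq_self (lieBracket_mem_tangentAt hn hW hX hY hx)
  rw [torsion, covD, covD, torsionAt]
  nth_rewrite 1 [← h]
  rw [VectorField.lieBracket, tproj_sub]
  abel

end LeviCivita


/-! ### The connections -/

section Smoothness

variable {s δ γ : ℝ} {W : Set Oct} {κ : Oct → Oct →ₗ[ℝ] Oct →ₗ[ℝ] Oct}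

/-- Smoothness of `κ` is assumed for fixed arguments only, so varying arguments are expanded in the
basis. -/
theorem IsConnectionOn.differentiableAt (hκ : IsConnectionOn s δ γ W κ) {Y Z : Oct → Oct} {x : Oct}
    (hx : x ∈ W) (hY : DifferentiableAt ℝ Y x) (hZ : DifferentiableAt ℝ Z x) :
    DifferentiableAt ℝ (fun y => κ y (Y y) (Z y)) x := by
  have h : ∀ y, κ y (Y y) (Z y) = ∑ i, ∑ j, (Y y i * Z y j) • κ y (obasis i) (obasis j) := by
    intro y
    have hb : ∀ v : Oct, v = ∑ i, v i • obasis i := fun v => by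
      simpa [obasis] using (pi_eq_sum_univ' v)
    conv_lhs => rw [hb (Y y), hb (Z y)]
    simp only [map_sum, LinearMap.sum_apply, map_smul, LinearMap.smul_apply, smul_smul,
      Finset.smul_sum]
    rw [Finset.sum_comm]
    simp only [mul_comm]
  simp_rw [h]
  have h1 : ∀ u v, DifferentiableAt ℝ (fun y => κ y u v) x := fun u v =>
    ((hκ.smooth u v).contDiffAt (hκ.isOpen.mem_nhds hx)).differentiableAt (by simp)
  have h2 := differentiableAt_pi.1 hY
  have h3 := differentiableAt_pi.1 hZ
  exact DifferentiableAt.fun_sum fun i _ => DifferentiableAt.fun_sum fun j _ =>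
    ((h2 i).mul (h3 j)).smul (h1 _ _)

theorem differentiableAt_fderiv_apply (hW : IsOpen W) {Y Z : Oct → Oct} {x : Oct} (hx : x ∈ W)
    (hZ : ContDiffOn ℝ ∞ Z W) (hY : DifferentiableAt ℝ Y x) :
    DifferentiableAt ℝ (fun y => fderiv ℝ Z y (Y y)) x := by
  have h : ContDiffAt ℝ 1 (fderiv ℝ Z) x :=
    (hZ.contDiffAt (hW.mem_nhds hx)).fderiv_right (m := 1) (by norm_cast)
  exact (h.differentiableAt (by simp)).clm_apply hY

theorem differentiableAt_tproj {f : Oct → Oct} {x : Oct} (hx : onorm s x ≠ 0)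
    (hf : DifferentiableAt ℝ f x) : DifferentiableAt ℝ (fun y => tproj s y (f y)) x := by
  simp only [tproj]
  have h1 : DifferentiableAt ℝ (fun y => obilin s y (f y)) x :=
    differentiableAt_id.bilin (obilin s) hf
  have h2 : DifferentiableAt ℝ (fun y => onorm s y) x :=
    (differentiableAt_id (𝕜 := ℝ) (x := x)).bilin (obilin s) differentiableAt_id
  have h3 : DifferentiableAt ℝ (fun y => obilin s y (f y) / onorm s y) x := by
    simp only [div_eq_mul_inv]
    exact h1.mul (h2.inv hx)
  exact hf.sub (h3.smul differentiableAt_id)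

theorem IsConnectionOn.differentiableAt_covD (hκ : IsConnectionOn s δ γ W κ) {Y Z : Oct → Oct}
    {x : Oct} (hx : x ∈ W) (hn : onorm s x ≠ 0) (hY : DifferentiableAt ℝ Y x)
    (hZ : ContDiffOn ℝ ∞ Z W) :
    DifferentiableAt ℝ (fun y => covD s κ Z y (Y y)) x := by
  have hdZ : DifferentiableAt ℝ Z x :=
    (hZ.contDiffAt (hκ.isOpen.mem_nhds hx)).differentiableAt (by simp)
  exact (differentiableAt_tproj hn (differentiableAt_fderiv_apply hκ.isOpen hx hZ hY)).add
    (hκ.differentiableAt hx hY hdZ)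

end Smoothness

/-! ### The flat connection attached to a chart -/

section Contorsion

variable (s : ℝ) (S : Oct ≃ₗ[ℝ] Oct)

/-- The frame fields `x ↦ S⁻¹ (a (S x))`, as a bilinear map in `a` and `x`. -/
def sFrame : Oct →ₗ[ℝ] Oct →ₗ[ℝ] Oct :=
  ((omulB s).compl₂ S.toLinearMap).compr₂ S.symm.toLinearMap

@[simp] theorem sFrame_apply (a x : Oct) : sFrame s S a x = S.symm (omul s a (S x)) := rfl

/-- The contorsion of the connection for which the frame fields `sFrame s S a`, with `a`
imaginary, are parallel. -/
def contorsion (x : Oct) : Oct →ₗ[ℝ] Oct →ₗ[ℝ] Oct :=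
  LinearMap.mk₂ ℝ
    (fun u v => (1 / 2 : ℝ) • S.symm (otri s (S u) (S x) (S v) - otri s (S v) (S x) (S u)))
    (by
      intro u u' v
      simp only [map_add, map_sub, otri_add_left, otri_add_right]
      module)
    (by
      intro c u v
      simp only [map_sub, map_smul, otri_smul_left, otri_smul_right]
      module)
    (by
      intro u v v'
      simp only [map_add, map_sub, otri_add_left, otri_add_right]
      module)
    (by
      intro c u v
      simp only [map_sub, map_smul, otri_smul_left, otri_smul_right]
      module)

theorem contorsion_apply (x u v : Oct) : contorsion s S x u v =
    (1 / 2 : ℝ) • S.symm (otri s (S u) (S x) (S v) - otri s (S v) (S x) (S u)) := rfl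

theorem contorsion_swap (x u v : Oct) : contorsion s S x u v = -contorsion s S x v u := by
  rw [contorsion_apply, contorsion_apply, ← smul_neg, ← map_neg, neg_sub]

theorem contorsion_smooth (u v : Oct) : ContDiff ℝ ∞ (fun x => contorsion s S x u v) := by
  let f : Oct →ₗ[ℝ] Oct :=
    { toFun := fun x => contorsion s S x u v
      map_add' := by
        intro x x'
        simp only [contorsion_apply, map_add, map_sub, otri_add_middle]
        module
      map_smul' := by
        intro c x
        simp only [contorsion_apply, RingHom.id_apply, map_smul, map_sub, otri_smul_middle]
        module }
  exact (LinearMap.toContinuousLinearMap f).contDiff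

/-- `S` maps the level set `N = δ γ²` to the level set `N = 1`, and preserves `N` up to a
factor. -/
def IsUnitChart (δ γ : ℝ) : Prop := ∀ x, onorm s (S x) = δ / γ ^ 2 * onorm s x

variable {s S} {δ γ : ℝ} (hS : IsUnitChart s S δ γ)
include hS

theorem IsUnitChart.obilin (x y : Oct) :
    _root_.obilin s (S x) (S y) = δ / γ ^ 2 * _root_.obilin s x y := by
  have h := hS (x + y)
  rw [map_add, onorm_add, onorm_add, hS x, hS y] at h
  linarith

variable (hδ : δ ^ 2 = 1) (hγ : γ ≠ 0)
include hδ hγ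

theorem IsUnitChart.obilin_symm (x y : Oct) :
    _root_.obilin s (S.symm x) y = δ * γ ^ 2 * _root_.obilin s x (S y) := by
  have h := hS.obilin (S.symm x) y
  rw [S.apply_symm_apply] at h
  rw [h]
  field_simp
  rw [hδ, mul_one]

theorem IsUnitChart.onorm_eq_one {x : Oct} (hx : x ∈ pseudoSphere s δ γ) : onorm s (S x) = 1 := by
  rw [hS, mem_pseudoSphere.1 hx]
  field_simp
  exact hδ

/-- The maps v ↦ (u x̄)v and v ↦ (v x̄)u have the same symmetric part (x,u)·id, so their difference
is skew; up to a factor, the adjoint of S⁻¹ is `S`. -/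
theorem contorsion_skew (x u v w : Oct) :
    obilin s (contorsion s S x u v) w + obilin s v (contorsion s S x u w) = 0 := by
  rw [obilin_comm s v, contorsion_apply, contorsion_apply, map_smul, map_smul,
    LinearMap.smul_apply, LinearMap.smul_apply, hS.obilin_symm hδ hγ, hS.obilin_symm hδ hγ,
    map_sub, map_sub, LinearMap.sub_apply, LinearMap.sub_apply, smul_eq_mul, smul_eq_mul]
  have h1 := obilin_otri_middle s (S v) (S x) (S u) (S w)
  have h2 := obilin_otri_outer s (S v) (S x) (S u) (S w)
  rw [obilin_comm s (S v)] at h1 h2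
  rw [obilin_comm s (S u) (S x)] at h1
  linear_combination (1 / 2 * (δ * γ ^ 2)) * (h1 - h2)

/-- By skewness it suffices that κ(u, x) = 0, where both triple products reduce to N(Sx)·Su. -/
theorem contorsion_mem_tangentAt (x u v : Oct) : contorsion s S x u v ∈ tangentAt s x := by
  rw [mem_tangentAt, obilin_comm]
  have h := contorsion_skew hS hδ hγ x u v x
  have h0 : contorsion s S x u x = 0 := by
    rw [contorsion_apply, otri_self_right, otri_self_left, sub_self, map_zero, smul_zero]
  rw [h0] at h
  simpa using h

omit hδ hγ in
-- Exchanging the outer arguments of the first triple product leaves only one scalar product, since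
-- `u` and `v` are orthogonal to `x`.
theorem contorsion_eq {x u v : Oct} (hu : u ∈ tangentAt s x) (hv : v ∈ tangentAt s x) :
    contorsion s S x u v =
      -S.symm (otri s (S v) (S x) (S u)) - obilin s (S u) (S v) • x := by
  rw [contorsion_apply, otri_swap_outer s (S u), hS.obilin x v, hS.obilin u x, obilin_comm s u x,
    mem_tangentAt.1 hu, mem_tangentAt.1 hv]
  simp only [mul_zero, zero_smul, map_sub, map_add, map_smul, map_zero, S.symm_apply_apply]
  module

theorem contorsion_eq_tproj {x u v : Oct} (hx : x ∈ pseudoSphere s δ γ)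
    (hu : u ∈ tangentAt s x) (hv : v ∈ tangentAt s x) :
    contorsion s S x u v = -tproj s x (S.symm (otri s (S v) (S x) (S u))) := by
  have hn : onorm s x ≠ 0 := by
    rw [mem_pseudoSphere.1 hx]
    have : δ ≠ 0 := by rintro rfl; norm_num at hδ
    positivity
  rw [← tproj_eq_self (contorsion_mem_tangentAt hS hδ hγ x u v), contorsion_eq hS hu hv, tproj_sub, tproj_smul,
    tproj_self hn, ← neg_one_smul ℝ (S.symm _), tproj_smul]
  simp

theorem sFrame_mem_tangentAt {a x : Oct} (ha : a 0 = 0) : sFrame s S a x ∈ tangentAt s x := by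
  rw [mem_tangentAt, obilin_comm, sFrame_apply, hS.obilin_symm hδ hγ, obilin_omul_right,
    omul_oconj, map_smul, obilin_comm, obilin_one, ha]
  simp

/-- The element Sv·conj(Sx) consists of the components of `v` in the parallel frame;
`sFrame_coord_zero` says that it is imaginary for tangent `v`. -/
theorem sFrame_coord {x : Oct} (hx : x ∈ pseudoSphere s δ γ) (v : Oct) :
    sFrame s S (omul s (S v) (oconj (S x))) x = v := by
  rw [sFrame_apply, omul_oconj_omul_self, hS.onorm_eq_one hδ hγ hx, one_smul, S.symm_apply_apply]

omit hδ hγ in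
theorem sFrame_coord_zero {x v : Oct} (hv : v ∈ tangentAt s x) :
    omul s (S v) (oconj (S x)) 0 = 0 := by
  have : omul s (S v) (oconj (S x)) 0 = obilin s (S v) (S x) := rfl
  rw [this, hS.obilin, obilin_comm, mem_tangentAt.1 hv, mul_zero]

/-- The heart of the definition of the contorsion: as (a·Sx)·conj(Sx) = a, it cancels the tangential
derivative of the frame field along `u`. -/
theorem contorsion_sFrame {x u a : Oct} (hx : x ∈ pseudoSphere s δ γ)
    (hu : u ∈ tangentAt s x) (ha : a 0 = 0) :
    contorsion s S x u (sFrame s S a x) = -tproj s x (sFrame s S a u) := by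
  rw [contorsion_eq_tproj hS hδ hγ hx hu (sFrame_mem_tangentAt hS hδ hγ ha), sFrame_apply,
    S.apply_symm_apply, otri, omul_omul_oconj, hS.onorm_eq_one hδ hγ hx, one_smul, sFrame_apply]

/-- The covariant derivative in terms of components with respect to the parallel frame. -/
theorem covD_of_sFrame {W : Set Oct} (hW : IsOpen W) {Z w : Oct → Oct}
    (hZ : ∀ y ∈ pseudoSphere s δ γ ∩ W, Z y = sFrame s S (w y) y)
    (hw : ∀ y ∈ pseudoSphere s δ γ ∩ W, w y 0 = 0)
    {x u : Oct} (hx : x ∈ pseudoSphere s δ γ ∩ W) (hu : u ∈ tangentAt s x)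
    (hdZ : DifferentiableAt ℝ Z x) (hdw : DifferentiableAt ℝ w x) :
    covD s (contorsion s S) Z x u = sFrame s S (fderiv ℝ w x u) x := by
  have hn : δ * γ ^ 2 ≠ 0 := by
    have : δ ≠ 0 := by rintro rfl; norm_num at hδ
    positivity
  have h1 := fderiv_tangent_congr hn hW hZ hx hdZ (hdw.bilin _ differentiableAt_id) hu
  have h2 := fderiv_bilin (sFrame s S) hdw (differentiableAt_id (𝕜 := ℝ) (x := x)) u
  simp only [id, fderiv_id, ContinuousLinearMap.id_apply] at h2 h1
  -- The components stay imaginary to first order, so the frame vector they define is tangent and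
  -- survives the projection.
  have h3 : fderiv ℝ w x u 0 = 0 := by
    have := fderiv_tangent_eq_zero hn hW (f := fun y => w y 0) hw hx
      (differentiableAt_pi.1 hdw 0) hu
    rw [fderiv_apply hdw] at this
    exact this
  rw [covD, h1, h2, hZ x hx, contorsion_sFrame hS hδ hγ hx.1 hu (hw x hx), tproj_add,
    tproj_eq_self (sFrame_mem_tangentAt hS hδ hγ h3), add_neg_cancel_right]

theorem contorsion_isConnectionOn {W : Set Oct} (hW : IsOpen W) :
    IsConnectionOn s δ γ W (contorsion s S) where
  isOpen := hW
  smooth u v := (contorsion_smooth s S u v).contDiffOn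
  tangent x _ u _ v _ := contorsion_mem_tangentAt hS hδ hγ x u v

/-- In parallel components covariant derivatives are plain derivatives, and R(X,Y)Z becomes the
antisymmetric part of a second derivative; the first-order terms are cancelled by the bracket. -/
theorem contorsion_isFlatOn {W : Set Oct} (hW : IsOpen W) :
    IsFlatOn s δ γ W (contorsion s S) := by
  intro X Y Z hX hY hZ x hx
  have hn : δ * γ ^ 2 ≠ 0 := by
    have : δ ≠ 0 := by rintro rfl; norm_num at hδ
    positivity
  have hnx : onorm s x ≠ 0 := by rwa [mem_pseudoSphere.1 hx.1]
  have hκ := contorsion_isConnectionOn hS hδ hγ hW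
  -- The components of `Z` in the parallel frame.
  let w : Oct → Oct := fun y => omul s (S (Z y)) (oconj (S y))
  have hSc : ContDiff ℝ ∞ S := (LinearMap.toContinuousLinearMap S.toLinearMap).contDiff
  have hCc : ContDiff ℝ ∞ (fun y : Oct => oconj (S y)) :=
    (LinearMap.toContinuousLinearMap (oconjL.toLinearMap ∘ₗ S.toLinearMap)).contDiff
  have hws : ContDiffOn ℝ ∞ w W :=
    ContDiffOn.bilin (omulB s) (hSc.comp_contDiffOn hZ.smooth) hCc.contDiffOn
  have hZw : ∀ y ∈ pseudoSphere s δ γ ∩ W, Z y = sFrame s S (w y) y :=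
    fun y hy => (sFrame_coord hS hδ hγ hy.1 _).symm
  have hw0 : ∀ y ∈ pseudoSphere s δ γ ∩ W, w y 0 = 0 :=
    fun y hy => sFrame_coord_zero hS (hZ.tangent y hy)
  have hdw : ∀ y ∈ W, DifferentiableAt ℝ w y := fun y hy =>
    (hws.contDiffAt (hW.mem_nhds hy)).differentiableAt (by simp)
  have key : ∀ X Y, IsTangentField s δ γ W X → IsTangentField s δ γ W Y →
      covD s (contorsion s S) (fun y => covD s (contorsion s S) Z y (Y y)) x (X x) =
        sFrame s S (fderiv ℝ (fun y => fderiv ℝ w y (Y y)) x (X x)) x := by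
    intro X Y hX hY
    have hdY := fun y (hy : y ∈ W) => hY.differentiableAt hW hy
    have hF : ∀ y ∈ pseudoSphere s δ γ ∩ W,
        covD s (contorsion s S) Z y (Y y) = sFrame s S (fderiv ℝ w y (Y y)) y := fun y hy =>
      covD_of_sFrame hS hδ hγ hW hZw hw0 hy (hY.tangent y hy) (hZ.differentiableAt hW hy.2)
        (hdw y hy.2)
    have hF0 : ∀ y ∈ pseudoSphere s δ γ ∩ W, fderiv ℝ w y (Y y) 0 = 0 := by
      intro y hy
      have := fderiv_tangent_eq_zero hn hW (f := fun y => w y 0) hw0 hy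
        (differentiableAt_pi.1 (hdw y hy.2) 0) (hY.tangent y hy)
      rwa [fderiv_apply (hdw y hy.2)] at this
    exact covD_of_sFrame hS hδ hγ hW hF hF0 hx (hX.tangent x hx)
      (hκ.differentiableAt_covD hx.2 hnx (hdY x hx.2) hZ.smooth)
      (differentiableAt_fderiv_apply hW hx.2 hws (hdY x hx.2))
  have hc : ContDiffAt ℝ ∞ w x := hws.contDiffAt (hW.mem_nhds hx.2)
  have hdd : DifferentiableAt ℝ (fderiv ℝ w) x :=
    (hc.fderiv_right (m := 1) (by norm_cast)).differentiableAt (by simp)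
  have hsymm : IsSymmSndFDerivAt ℝ w x := hc.isSymmSndFDerivAt (by simpa using ENat.LEInfty.out)
  have hexp : ∀ Y : Oct → Oct, DifferentiableAt ℝ Y x → ∀ u,
      fderiv ℝ (fun y => fderiv ℝ w y (Y y)) x u =
        fderiv ℝ (fderiv ℝ w) x u (Y x) + fderiv ℝ w x (fderiv ℝ Y x u) := by
    intro Y hY u
    rw [fderiv_clm_apply hdd hY]
    simp [add_comm]
  rw [curvature, key X Y hX hY, key Y X hY hX,
    covD_of_sFrame hS hδ hγ hW hZw hw0 hx (lieBracket_mem_tangentAt hn hW hX hY hx)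
      (hZ.differentiableAt hW hx.2) (hdw x hx.2),
    hexp Y (hY.differentiableAt hW hx.2), hexp X (hX.differentiableAt hW hx.2),
    VectorField.lieBracket, hsymm.eq (X x) (Y x), ← LinearMap.sub_apply, ← LinearMap.sub_apply,
    ← map_sub, ← map_sub, map_sub (fderiv ℝ w x)]
  convert LinearMap.map_zero₂ (sFrame s S) x using 2
  abel_nf

end Contorsion


/-! ### The charts belonging to the two families of frames -/

section Charts

variable (s : ℝ)

/-- Right multiplication by an element of non-zero norm. -/
def rmulEquiv (α : Oct) (hα : onorm s α ≠ 0) : Oct ≃ₗ[ℝ] Oct :=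
  LinearEquiv.ofLinearMap ((omulB s).flip α) ((onorm s α)⁻¹ • (omulB s).flip (oconj α))
    (by ext1 i; ext1; simp [omul_oconj_omul_self, smul_smul, hα])
    (by ext1 i; ext1; simp [omul_omul_oconj, smul_smul, hα])

variable {s}

@[simp] theorem rmulEquiv_apply (α : Oct) (hα : onorm s α ≠ 0) (x : Oct) :
    rmulEquiv s α hα x = omul s x α := rfl

@[simp] theorem rmulEquiv_symm_apply (α : Oct) (hα : onorm s α ≠ 0) (x : Oct) :
    (rmulEquiv s α hα).symm x = (onorm s α)⁻¹ • omul s x (oconj α) := rfl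

/-- The chart `x ↦ γ⁻² x α`. -/
def rightChart {γ : ℝ} (hγ : γ ≠ 0) (α : Oct) (hα : onorm s α ≠ 0) : Oct ≃ₗ[ℝ] Oct :=
  (rmulEquiv s α hα).trans
    (LinearEquiv.smulOfUnit (Units.mk0 ((γ ^ 2)⁻¹ : ℝ) (inv_ne_zero (pow_ne_zero 2 hγ))))

variable {γ : ℝ} (hγ : γ ≠ 0)

theorem rightChart_apply (α : Oct) (hα : onorm s α ≠ 0) (x : Oct) :
    rightChart hγ α hα x = (γ ^ 2)⁻¹ • omul s x α := rfl

theorem rightChart_symm_apply (α : Oct) (hα : onorm s α ≠ 0) (x : Oct) :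
    (rightChart hγ α hα).symm x = (γ ^ 2 * (onorm s α)⁻¹) • omul s x (oconj α) := by
  rw [LinearEquiv.symm_apply_eq, rightChart_apply, smul_omul, omul_oconj_omul_self]
  simp only [smul_smul]
  field_simp
  simp

theorem onorm_oconj_ne_zero {α : Oct} (hα : onorm s α ≠ 0) : onorm s (oconj α) ≠ 0 := by
  rwa [onorm_oconj]

/-- The chart `x ↦ γ⁻² x α` for right, and `x ↦ γ⁻² x̄ ᾱ` for left multiplication. -/
def sideChart (α : Oct) (hα : onorm s α ≠ 0) : Side → (Oct ≃ₗ[ℝ] Oct)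
  | .right => rightChart hγ α hα
  | .left => oconjL.trans (rightChart hγ (oconj α) (onorm_oconj_ne_zero hα))

theorem sideChart_isUnitChart {δ : ℝ} {α : Oct} (hα : onorm s α ≠ 0)
    (h : α ∈ pseudoSphere s δ γ) (side : Side) : IsUnitChart s (sideChart hγ α hα side) δ γ := by
  intro x
  cases side
  · rw [sideChart, rightChart_apply, onorm_smul, onorm_omul, mem_pseudoSphere.1 h]
    field_simp
  · rw [sideChart, LinearEquiv.trans_apply, oconjL_apply, rightChart_apply, onorm_smul, onorm_omul,
      onorm_oconj, onorm_oconj, mem_pseudoSphere.1 h]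
    field_simp

/-- Conjugating left multiplication by `a` with right multiplication by `α` gives x ↦ (aα)(α⁻¹x), by
the Moufang identity; the powers of γ cancel. -/
theorem sFrame_rightChart (α : Oct) (hα : onorm s α ≠ 0) (a x : Oct) :
    sFrame s (rightChart hγ α hα) a x = (onorm s α)⁻¹ • omul s (omul s a α) (omul s (oconj α) x) := by
  rw [sFrame_apply, rightChart_symm_apply, rightChart_apply, omul_moufang]
  simp only [smul_omul, omul_smul, smul_smul]
  congr 1
  field_simp

theorem oconj_eq_neg {a : Oct} (ha : a 0 = 0) : oconj a = -a := by
  rw [oconj_eq, ha]; simp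

theorem oim_zero (i : Fin 7) : oim i 0 = 0 := by simp [oim, obasis]

/-- The left family is the conjugate of the right one, and conjugation changes the sign of the
imaginary units; hence the factor `-side.sgn`. -/
theorem multFrame_eq_sFrame (α : Oct) (hα : onorm s α ≠ 0) (side : Side) (i : Fin 7) (x : Oct) :
    multFrame s γ α side i x =
      sFrame s (sideChart hγ α hα side) ((-side.sgn / γ) • oim i) x := by
  rw [map_smul, LinearMap.smul_apply]
  cases side
  · rw [sideChart, sFrame_rightChart, multFrame, oinv, Side.sgn]
    simp only [smul_omul, omul_smul, smul_smul]
    congr 1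
    ring
  · have : sFrame s (sideChart hγ α hα .left) (oim i) x =
        oconj (sFrame s (rightChart hγ (oconj α) (onorm_oconj_ne_zero hα)) (oim i) (oconj x)) :=
      rfl
    rw [this, sFrame_rightChart, multFrame, oinv, Side.sgn]
    simp only [oconj_smul, oconj_omul, oconj_oconj, oconj_eq_neg (oim_zero i), onorm_oconj,
      smul_omul, omul_smul, smul_smul, omul_neg, smul_neg, ← neg_smul]
    congr 1
    ring

/-- The triple product transported by a chart. -/
def chartTriple (S : Oct ≃ₗ[ℝ] Oct) (v x u : Oct) : Oct := S.symm (otri s (S v) (S x) (S u))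

/-- Two uses of the Moufang identity move `α` into the inner factors. In this form the dependence on
the reference point is explicit enough to be compared. -/
theorem chartTriple_rightChart (α : Oct) (hα : onorm s α ≠ 0) (v x u : Oct) :
    chartTriple (s := s) (rightChart hγ α hα) v x u =
      ((γ ^ 2)⁻¹ ^ 2) • omul s (omul s v (omul s (oconj x) α)) (omul s (oconj α) u) := by
  rw [chartTriple, rightChart_symm_apply]
  simp only [rightChart_apply, otri, smul_omul, omul_smul, oconj_smul, oconj_omul, smul_smul]
  rw [omul_moufang s α v (oconj x), ← omul_moufang, omul_oconj_omul_self, smul_omul, smul_smul]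
  congr 1
  field_simp

theorem chartTriple_leftChart (α : Oct) (hα : onorm s α ≠ 0) (v x u : Oct) :
    chartTriple (s := s) (sideChart hγ α hα .left) v x u =
      ((γ ^ 2)⁻¹ ^ 2) • omul s (omul s u (oconj α)) (omul s (omul s α (oconj x)) v) := by
  have : chartTriple (s := s) (sideChart hγ α hα .left) v x u =
      oconj (chartTriple (s := s) (rightChart hγ (oconj α) (onorm_oconj_ne_zero hα))
        (oconj v) (oconj x) (oconj u)) := rfl
  rw [this, chartTriple_rightChart]
  simp only [oconj_smul, oconj_omul, oconj_oconj]

/-- The associators with three pairs of basis units already force all seven imaginary coordinates of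
`c` to vanish. -/
theorem eq_smul_one_of_nucleus {c : Oct}
    (h : ∀ v w, omul s v (omul s c w) = omul s (omul s v c) w) : c = c 0 • obasis 0 := by
  have h12 := h (obasis 1) (obasis 2)
  have h14 := h (obasis 1) (obasis 4)
  have h24 := h (obasis 2) (obasis 4)
  have e4 := congrFun h12 4
  have e5 := congrFun h12 5
  have e6 := congrFun h12 6
  have e7 := congrFun h12 7
  have f2 := congrFun h14 6
  have f3 := congrFun h14 7
  have f1 := congrFun h24 7
  simp [omul_zero_coord, omul_one_coord, omul_two_coord, omul_three_coord, omul_four_coord,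
    omul_five_coord, omul_six_coord, omul_seven_coord, obasis] at e4 e5 e6 e7 f1 f2 f3
  ext i
  fin_cases i <;> simp [obasis] <;> linarith

/-- At the base point α the first triple product is a multiple of v(ᾱu). Substituting u = βw, and
then v = 1, shows that ᾱβ is in the middle nucleus; so β is a real multiple of α, of the same norm.
-/
theorem eq_or_eq_neg_of_chartTriple_eq {α β : Oct} (hα : onorm s α ≠ 0)
    (hβ : onorm s β ≠ 0) (hN : onorm s β = onorm s α)
    (h : ∀ u v, chartTriple (s := s) (rightChart hγ α hα) v α u =
      chartTriple (s := s) (rightChart hγ β hβ) v α u) : β = α ∨ β = -α := by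
  have h1 : ∀ v w, omul s v (omul s (oconj α) (omul s β w)) =
      omul s (omul s v (omul s (oconj α) β)) w := by
    intro v w
    have := h (omul s β w) v
    rw [chartTriple_rightChart, chartTriple_rightChart] at this
    have := smul_right_injective Oct (by positivity) this
    simp only [oconj_omul_self, omul_smul, smul_omul, omul_one, oconj_omul_omul, hN] at this
    exact smul_right_injective Oct hα this
  have h2 : ∀ w, omul s (oconj α) (omul s β w) = omul s (omul s (oconj α) β) w := by
    intro w
    simpa using h1 (obasis 0) w
  have h3 := eq_smul_one_of_nucleus (c := omul s (oconj α) β) (fun v w => by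
    rw [← h1, h2])
  obtain ⟨r, hr⟩ : ∃ r : ℝ, β = r • α := by
    have := congrArg (omul s α) h3
    rw [omul_oconj_omul, omul_smul, omul_one] at this
    exact ⟨(onorm s α)⁻¹ * (omul s (oconj α) β 0), by
      rw [mul_smul, ← this, smul_smul, inv_mul_cancel₀ hα, one_smul]⟩
  rw [hr, onorm_smul] at hN
  have : r ^ 2 = 1 := mul_right_cancel₀ hα (by rw [hN, one_mul])
  rcases mul_self_eq_one_iff.1 (by rwa [← pow_two] : r * r = 1) with h | h
  · left; rw [hr, h, one_smul]
  · right; rw [hr, h, neg_one_smul]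

/-- Setting u = β makes ᾱβ central, hence real, so β = ±α. What is left of the hypothesis is v(ᾱu) =
(uᾱ)v, and this forces commutativity, against e₁e₂ = −e₂e₁. -/
theorem chartTriple_right_ne_left {α β : Oct} (hα : onorm s α ≠ 0)
    (hβ : onorm s β ≠ 0) (hN : onorm s β = onorm s α)
    (h : ∀ u v, chartTriple (s := s) (rightChart hγ α hα) v α u =
      chartTriple (s := s) (sideChart hγ β hβ .left) v α u) : False := by
  have h1 : ∀ u v, onorm s α • omul s v (omul s (oconj α) u) =
      omul s (omul s u (oconj β)) (omul s (omul s β (oconj α)) v) := by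
    intro u v
    have := h u v
    rw [chartTriple_rightChart, chartTriple_leftChart] at this
    have := smul_right_injective Oct (by positivity) this
    simpa only [oconj_omul_self, omul_smul, smul_omul, omul_one] using this
  -- the element `ᾱ β` commutes with everything
  have h2 : ∀ v, omul s v (omul s (oconj α) β) = omul s (omul s β (oconj α)) v := by
    intro v
    have := h1 β v
    rw [omul_oconj, smul_omul, one_omul, hN] at this
    exact smul_right_injective Oct hα this
  have h3 : omul s (oconj α) β = omul s β (oconj α) := by simpa using h2 (obasis 0)
  have hc : ∀ c : Oct, (∀ v, omul s v c = omul s c v) → c = c 0 • obasis 0 := by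
    intro c hc
    have e1 := hc (obasis 1)
    have e2 := hc (obasis 2)
    have a2 := congrFun e1 3
    have a3 := congrFun e1 2
    have a4 := congrFun e1 5
    have a5 := congrFun e1 4
    have a6 := congrFun e1 7
    have a7 := congrFun e1 6
    have a1 := congrFun e2 3
    simp [omul_two_coord, omul_three_coord, omul_four_coord,
      omul_five_coord, omul_six_coord, omul_seven_coord, obasis] at a1 a2 a3 a4 a5 a6 a7
    ext i
    fin_cases i <;> simp [obasis] <;> linarith
  have h4 := hc (omul s (oconj α) β) (fun v => by rw [h2, h3])
  obtain ⟨r, hr⟩ : ∃ r : ℝ, β = r • α := by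
    have := congrArg (omul s α) h4
    rw [omul_oconj_omul, omul_smul, omul_one] at this
    exact ⟨(onorm s α)⁻¹ * (omul s (oconj α) β 0), by
      rw [mul_smul, ← this, smul_smul, inv_mul_cancel₀ hα, one_smul]⟩
  have hr2 : r ^ 2 = 1 := by
    rw [hr, onorm_smul] at hN
    exact mul_right_cancel₀ hα (by rw [hN, one_mul])
  have h5 : ∀ u v, omul s v (omul s (oconj α) u) = omul s (omul s u (oconj α)) v := by
    intro u v
    have := h1 u v
    rw [hr, oconj_smul, smul_omul, omul_oconj, omul_smul, smul_omul, smul_omul, smul_omul, one_omul,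
      smul_smul, omul_smul, smul_smul] at this
    have h6 : r * (r * onorm s α) = onorm s α := by rw [← mul_assoc, ← pow_two, hr2, one_mul]
    rw [h6] at this
    exact smul_right_injective Oct hα this
  have h6 : ∀ w v, omul s v w = omul s w v := by
    intro w v
    -- Here u = α w / N(α), so that ᾱu = w is arbitrary; v = 1 then identifies the other factor uᾱ
    -- with w.
    have h7 := h5 ((onorm s α)⁻¹ • omul s α w)
    have h8 : omul s (oconj α) ((onorm s α)⁻¹ • omul s α w) = w := by
      rw [omul_smul, oconj_omul_omul, smul_smul, inv_mul_cancel₀ hα, one_smul]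
    rw [h8] at h7
    have h9 := h7 (obasis 0)
    rw [one_omul, omul_one] at h9
    rw [h7, ← h9]
  have := congrFun (h6 (obasis 1) (obasis 2)) 3
  simp [omul_three_coord, obasis] at this
  linarith

end Charts

/-! ### Uniqueness of the connection with a given parallel frame -/

section Parallelisms

variable {s δ γ : ℝ} {S : Oct ≃ₗ[ℝ] Oct} (hS : IsUnitChart s S δ γ) (hδ : δ ^ 2 = 1) (hγ : γ ≠ 0)
include hS hδ hγ

/-- The components with respect to the frame are constant. -/
theorem covD_contorsion_sFrame {a x u : Oct} (ha : a 0 = 0) (hx : x ∈ pseudoSphere s δ γ)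
    (hu : u ∈ tangentAt s x) : covD s (contorsion s S) (sFrame s S a) x u = 0 := by
  have hd : DifferentiableAt ℝ (sFrame s S a) x :=
    (LinearMap.toContinuousLinearMap (sFrame s S a)).differentiableAt
  have h := covD_of_sFrame hS hδ hγ isOpen_univ (Z := sFrame s S a) (w := fun _ => a)
    (fun _ _ => rfl) (fun _ _ => ha) ⟨hx, Set.mem_univ x⟩ hu hd (differentiableAt_const a)
  simpa using h

/-- A connection with the same parallel frame is the same connection. -/
theorem eq_contorsion_of_isParallel {κ : Oct → Oct →ₗ[ℝ] Oct →ₗ[ℝ] Oct} {r : ℝ} (hr : r ≠ 0)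
    (h : ∀ i, IsParallel s δ γ κ (sFrame s S (r • oim i))) {x u v : Oct}
    (hx : x ∈ pseudoSphere s δ γ) (hu : u ∈ tangentAt s x) (hv : v ∈ tangentAt s x) :
    κ x u v = contorsion s S x u v := by
  have h1 : ∀ i, κ x u (sFrame s S (oim i) x) = contorsion s S x u (sFrame s S (oim i) x) := by
    intro i
    have ha : (r • oim i) 0 = 0 := by simp [oim_zero]
    have h2 := h i x hx u hu
    rw [← covD_contorsion_sFrame hS hδ hγ ha hx hu] at h2
    have h3 := add_left_cancel h2
    simp only [map_smul, LinearMap.smul_apply] at h3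
    exact smul_right_injective Oct hr h3
  have h2 : omul s (S v) (oconj (S x)) =
      ∑ i : Fin 7, (omul s (S v) (oconj (S x)) i.succ) • oim i := by
    conv_lhs => rw [pi_eq_sum_univ' (omul s (S v) (oconj (S x)))]
    rw [Fin.sum_univ_succ, sFrame_coord_zero hS hv, zero_smul, zero_add]
    rfl
  rw [← sFrame_coord hS hδ hγ hx v, h2]
  simp only [map_sum, LinearMap.sum_apply, map_smul, LinearMap.smul_apply, h1]

/-- The contorsion determines the transported triple product. -/
theorem chartTriple_eq_of_contorsion_eq {S' : Oct ≃ₗ[ℝ] Oct} (hS' : IsUnitChart s S' δ γ) {x : Oct}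
    (hx : x ∈ pseudoSphere s δ γ)
    (h : ∀ u ∈ tangentAt s x, ∀ v ∈ tangentAt s x,
      contorsion s S x u v = contorsion s S' x u v) (u v : Oct) :
    chartTriple (s := s) S v x u = chartTriple (s := s) S' v x u := by
  have hn : onorm s x ≠ 0 := by
    rw [mem_pseudoSphere.1 hx]
    have : δ ≠ 0 := by rintro rfl; norm_num at hδ
    positivity
  -- Each outer argument is split into a tangential part and a multiple of `x`. With `x` in an outer
  -- slot the transported product does not depend on the chart, so the contorsion decides the rest.
  have hdec : ∀ w, w = tproj s x w + (obilin s x w / onorm s x) • x := by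
    intro w; rw [tproj, sub_add_cancel]
  have key : ∀ u ∈ tangentAt s x, ∀ v ∈ tangentAt s x,
      chartTriple (s := s) S v x u = chartTriple (s := s) S' v x u := by
    intro u hu v hv
    have h1 := h u hu v hv
    rw [contorsion_eq hS hu hv, contorsion_eq hS' hu hv, hS.obilin, hS'.obilin] at h1
    exact neg_injective (sub_left_injective h1)
  have hr : ∀ {T : Oct ≃ₗ[ℝ] Oct}, IsUnitChart s T δ γ → ∀ v,
      chartTriple (s := s) T v x x = v := by
    intro T hT v
    rw [chartTriple, otri_self_right, hT.onorm_eq_one hδ hγ hx, one_smul, T.symm_apply_apply]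
  have hl : ∀ {T : Oct ≃ₗ[ℝ] Oct}, IsUnitChart s T δ γ → ∀ v,
      chartTriple (s := s) T x x v = v := by
    intro T hT v
    rw [chartTriple, otri_self_left, hT.onorm_eq_one hδ hγ hx, one_smul, T.symm_apply_apply]
  have hadd : ∀ (T : Oct ≃ₗ[ℝ] Oct) (v v' u u' : Oct) (c d : ℝ),
      chartTriple (s := s) T (v + c • v') x (u + d • u') = chartTriple (s := s) T v x u +
        d • chartTriple (s := s) T v x u' + c • chartTriple (s := s) T v' x u +
        (c * d) • chartTriple (s := s) T v' x u' := by
    intro T v v' u u' c d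
    simp only [chartTriple, map_add, map_smul, otri_add_left, otri_add_right, otri_smul_left,
      otri_smul_right]
    module
  rw [hdec u, hdec v, hadd, hadd, hr hS, hr hS', hl hS, hl hS', hr hS, hr hS',
    key _ (tproj_mem hn u) _ (tproj_mem hn v)]

end Parallelisms

/-! ### Comparison of reference points and sides -/

section TwoFamilies

variable {s δ γ : ℝ} (hδ : δ ^ 2 = 1) (hγ : γ ≠ 0)
include hδ hγ

theorem onorm_ne_zero_of_mem {α : Oct} (hα : α ∈ pseudoSphere s δ γ) : onorm s α ≠ 0 := by
  rw [mem_pseudoSphere.1 hα]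
  have : δ ≠ 0 := by rintro rfl; norm_num at hδ
  positivity

omit hδ in
theorem Side.sgn_div_ne_zero (side : Side) : -side.sgn / γ ≠ 0 := by
  cases side <;> simp [Side.sgn, hγ]

theorem isParallel_multFrame {α : Oct} (hα : α ∈ pseudoSphere s δ γ) (side : Side) (i : Fin 7) :
    IsParallel s δ γ (contorsion s (sideChart hγ α (onorm_ne_zero_of_mem hδ hγ hα) side))
      (multFrame s γ α side i) := by
  intro x hx u hu
  rw [funext (multFrame_eq_sFrame hγ α (onorm_ne_zero_of_mem hδ hγ hα) side i)]
  exact covD_contorsion_sFrame (sideChart_isUnitChart hγ _ hα side) hδ hγ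
    (by simp [oim_zero]) hx hu

theorem contorsion_eq_of_isParallel_multFrame {κ : Oct → Oct →ₗ[ℝ] Oct →ₗ[ℝ] Oct} {α : Oct}
    (hα : α ∈ pseudoSphere s δ γ) (side : Side)
    (h : ∀ i, IsParallel s δ γ κ (multFrame s γ α side i)) {x : Oct}
    (hx : x ∈ pseudoSphere s δ γ) : ∀ u ∈ tangentAt s x, ∀ v ∈ tangentAt s x, κ x u v =
      contorsion s (sideChart hγ α (onorm_ne_zero_of_mem hδ hγ hα) side) x u v := by
  intro u hu v hv
  refine eq_contorsion_of_isParallel (sideChart_isUnitChart hγ _ hα side) hδ hγ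
    (Side.sgn_div_ne_zero hγ side) (fun i => ?_) hx hu hv
  have := h i
  rwa [funext (multFrame_eq_sFrame hγ α (onorm_ne_zero_of_mem hδ hγ hα) side i)] at this

/-- A connection that belongs to two frames has the same transported triple products. -/
theorem chartTriple_eq_of_isParallel {κ : Oct → Oct →ₗ[ℝ] Oct →ₗ[ℝ] Oct} {α β : Oct}
    (hα : α ∈ pseudoSphere s δ γ) (hβ : β ∈ pseudoSphere s δ γ) (side side' : Side)
    (h : ∀ i, IsParallel s δ γ κ (multFrame s γ α side i))
    (h' : ∀ i, IsParallel s δ γ κ (multFrame s γ β side' i)) (u v : Oct) :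
    chartTriple (s := s) (sideChart hγ α (onorm_ne_zero_of_mem hδ hγ hα) side) v α u =
      chartTriple (s := s) (sideChart hγ β (onorm_ne_zero_of_mem hδ hγ hβ) side') v α u :=
  chartTriple_eq_of_contorsion_eq (sideChart_isUnitChart hγ _ hα side) hδ hγ
    (sideChart_isUnitChart hγ _ hβ side') hα (fun u hu v hv => by
      rw [← contorsion_eq_of_isParallel_multFrame hδ hγ hα side h hα u hu v hv,
        ← contorsion_eq_of_isParallel_multFrame hδ hγ hβ side' h' hα u hu v hv]) u v

theorem not_isParallel_right_left {κ : Oct → Oct →ₗ[ℝ] Oct →ₗ[ℝ] Oct} {α β : Oct}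
    (hα : α ∈ pseudoSphere s δ γ) (hβ : β ∈ pseudoSphere s δ γ)
    (h : ∀ i, IsParallel s δ γ κ (multFrame s γ α .right i))
    (h' : ∀ i, IsParallel s δ γ κ (multFrame s γ β .left i)) : False :=
  chartTriple_right_ne_left hγ (onorm_ne_zero_of_mem hδ hγ hα) (onorm_ne_zero_of_mem hδ hγ hβ)
    (by rw [mem_pseudoSphere.1 hα, mem_pseudoSphere.1 hβ])
    (chartTriple_eq_of_isParallel hδ hγ hα hβ .right .left h h')

theorem eq_or_eq_neg_of_isParallel {κ : Oct → Oct →ₗ[ℝ] Oct →ₗ[ℝ] Oct} {α β : Oct}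
    (hα : α ∈ pseudoSphere s δ γ) (hβ : β ∈ pseudoSphere s δ γ) (side : Side)
    (h : ∀ i, IsParallel s δ γ κ (multFrame s γ α side i))
    (h' : ∀ i, IsParallel s δ γ κ (multFrame s γ β side i)) : β = α ∨ β = -α := by
  have hN : onorm s β = onorm s α := by rw [mem_pseudoSphere.1 hα, mem_pseudoSphere.1 hβ]
  have key := chartTriple_eq_of_isParallel hδ hγ hα hβ side side h h'
  cases side
  · exact eq_or_eq_neg_of_chartTriple_eq hγ _ _ hN key
  -- Conjugation turns the left charts of α and β into the right charts of their conjugates.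
  · have hα' := onorm_oconj_ne_zero (onorm_ne_zero_of_mem hδ hγ hα)
    have hβ' := onorm_oconj_ne_zero (onorm_ne_zero_of_mem hδ hγ hβ)
    have := eq_or_eq_neg_of_chartTriple_eq hγ hα' hβ' (by simpa using hN) (fun u v => by
      have := key (oconj u) (oconj v)
      have e : ∀ (β : Oct) (hβ : onorm s β ≠ 0) (hβ' : onorm s (oconj β) ≠ 0),
          chartTriple (s := s) (sideChart hγ β hβ .left) (oconj v) α (oconj u) =
          oconj (chartTriple (s := s) (rightChart hγ (oconj β) hβ') v (oconj α) u) := by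
        intro β hβ hβ'
        rw [chartTriple, sideChart, LinearEquiv.symm_trans_apply]
        simp only [LinearEquiv.trans_apply, oconjL_apply, oconj_oconj, oconjL_symm_apply,
          chartTriple]
      rw [e α _ hα', e β _ hβ'] at this
      exact oconjL.injective this)
    rcases this with h | h
    · left; exact oconjL.injective h
    · right; apply oconjL.injective; simpa [oconj_neg] using h

omit hδ hγ in
theorem multFrame_neg (α : Oct) (side : Side) : multFrame s γ (-α) side = multFrame s γ α side := by
  have h : oinv s (-α) = -oinv s α := by
    rw [oinv, oinv, oconj_neg, QuadraticMap.map_neg, smul_neg]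
  funext i x
  cases side <;> simp only [multFrame, h, neg_omul, omul_neg, neg_neg]

/-- Right multiplication by `Sx`, of norm 1, is an isometry; S⁻¹ contributes δγ² to the scalar
product and the normalisation 1/γ². -/
theorem multFrame_isLorentzFrame {α : Oct} (hα : α ∈ pseudoSphere s δ γ) (side : Side) :
    IsLorentzFrame s δ γ Set.univ (multFrame s γ α side) := by
  have hS := sideChart_isUnitChart hγ (onorm_ne_zero_of_mem hδ hγ hα) hα side
  have e := fun i => funext (multFrame_eq_sFrame hγ α (onorm_ne_zero_of_mem hδ hγ hα) side i)
  refine ⟨fun i => ⟨?_, fun x _ => ?_⟩, fun x hx a b => ?_⟩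
  · rw [e]
    exact (LinearMap.toContinuousLinearMap (sFrame s _ _)).contDiff.contDiffOn
  · rw [e]
    exact sFrame_mem_tangentAt hS hδ hγ (by simp [oim_zero])
  · rw [e, e, sFrame_apply, sFrame_apply, hS.obilin_symm hδ hγ, LinearEquiv.apply_symm_apply,
      obilin_omul_omul_right, hS.onorm_eq_one hδ hγ hx.1]
    simp only [map_smul, LinearMap.smul_apply, smul_eq_mul, oeta]
    cases side <;> simp only [Side.sgn] <;> field_simp

end TwoFamilies

/-- In each case some coordinate plane carries δ times the Euclidean form, and the level set
contains a circle in it. Its points are separated by one coordinate c in [0, γ]. -/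
theorem infinite_pseudoSphere {s δ γ : ℝ} (hγ : 0 < γ)
    (hs : s = 1 ∧ (δ = 1 ∨ δ = -1) ∨ s = -1 ∧ δ = 1) : (pseudoSphere s δ γ).Infinite := by
  have key : ∀ i j : Fin 8, i ≠ j →
      (∀ a b : ℝ, onorm s (a • obasis i + b • obasis j) = δ * (a ^ 2 + b ^ 2)) →
      (pseudoSphere s δ γ).Infinite := by
    intro i j hij h
    refine Set.Infinite.of_image (fun x => x i) ((Set.Icc_infinite hγ).mono ?_)
    intro c hc
    refine ⟨c • obasis i + √(γ ^ 2 - c ^ 2) • obasis j, ?_, ?_⟩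
    · rw [mem_pseudoSphere, h, Real.sq_sqrt]
      · ring
      · nlinarith [hc.1, hc.2]
    · simp [obasis, hij]
  rcases hs with ⟨rfl, rfl | rfl⟩ | ⟨rfl, rfl⟩
  · exact key 0 1 (by decide) fun a b => by
      simp [onorm_eq_obilin, obilin_coord, obasis]; ring
  · exact key 4 5 (by decide) fun a b => by
      simp [onorm_eq_obilin, obilin_coord, obasis]; ring
  · exact key 0 1 (by decide) fun a b => by
      simp [onorm_eq_obilin, obilin_coord, obasis]; ring


/-! ### Sectional curvature -/

section Curvature

variable {s δ γ : ℝ} {W : Set Oct} {κ : Oct → Oct →ₗ[ℝ] Oct →ₗ[ℝ] Oct}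

theorem isConnectionOn_zero (hW : IsOpen W) : IsConnectionOn s δ γ W 0 where
  isOpen := hW
  smooth _ _ := contDiffOn_const
  tangent _ _ _ _ _ _ := Submodule.zero_mem _

theorem fderiv_fderiv_apply (hW : IsOpen W) {Y Z : Oct → Oct} {x : Oct} (hx : x ∈ W)
    (hZ : ContDiffOn ℝ ∞ Z W) (hY : DifferentiableAt ℝ Y x) (u : Oct) :
    fderiv ℝ (fun y => fderiv ℝ Z y (Y y)) x u =
      fderiv ℝ (fderiv ℝ Z) x u (Y x) + fderiv ℝ Z x (fderiv ℝ Y x u) := by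
  have h : ContDiffAt ℝ 1 (fderiv ℝ Z) x :=
    (hZ.contDiffAt (hW.mem_nhds hx)).fderiv_right (m := 1) (by norm_cast)
  rw [fderiv_clm_apply (h.differentiableAt (by simp)) hY]
  simp [add_comm]

/-- The Gauss equation: the curvature of the Levi-Civita connection of the level set. -/
theorem curvature_zero_eq (hn : δ * γ ^ 2 ≠ 0) (hW : IsOpen W) {X Y Z : Oct → Oct}
    (hX : IsTangentField s δ γ W X) (hY : IsTangentField s δ γ W Y) (hZ : IsTangentField s δ γ W Z)
    {x : Oct} (hx : x ∈ pseudoSphere s δ γ ∩ W) :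
    curvature s 0 X Y Z x = (δ * γ ^ 2)⁻¹ •
      (obilin s (Y x) (Z x) • X x - obilin s (X x) (Z x) • Y x) := by
  have hnx : onorm s x ≠ 0 := by rwa [mem_pseudoSphere.1 hx.1]
  have hdX := hX.differentiableAt hW hx.2
  have hdY := hY.differentiableAt hW hx.2
  have hdZ := hZ.differentiableAt hW hx.2
  have key : ∀ X Y, IsTangentField s δ γ W X → IsTangentField s δ γ W Y →
      covD s 0 (fun y => covD s 0 Z y (Y y)) x (X x) =
        tproj s x (fderiv ℝ (fderiv ℝ Z) x (X x) (Y x) + fderiv ℝ Z x (fderiv ℝ Y x (X x))) +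
          ((δ * γ ^ 2)⁻¹ * obilin s (Y x) (Z x)) • X x := by
    intro X Y hX hY
    have hdY := hY.differentiableAt hW hx.2
    -- Along the level set the normal part of the derivative is known from the second fundamental
    -- form. This writes the covariant derivative without a projection, so that it can be
    -- differentiated again.
    let g : Oct → Oct := fun y =>
      fderiv ℝ Z y (Y y) + ((δ * γ ^ 2)⁻¹ * obilin s (Y y) (Z y)) • y
    have hg : ∀ y ∈ pseudoSphere s δ γ ∩ W, covD s 0 Z y (Y y) = g y := by
      intro y hy
      simp only [covD, g, Pi.zero_apply, LinearMap.zero_apply, add_zero, tproj]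
      rw [obilin_fderiv_tangentField hn hW hZ hy (hY.tangent y hy), mem_pseudoSphere.1 hy.1,
        neg_div, neg_smul, sub_neg_eq_add, div_eq_inv_mul]
    have hb := hdY.bilin (obilin s) hdZ
    have hd1 := differentiableAt_fderiv_apply hW hx.2 hZ.smooth hdY
    have hd2 : DifferentiableAt ℝ (fun y => ((δ * γ ^ 2)⁻¹ * obilin s (Y y) (Z y)) • y) x :=
      (hb.const_mul _).smul differentiableAt_id
    have hd3 : fderiv ℝ (fun y => ((δ * γ ^ 2)⁻¹ * obilin s (Y y) (Z y)) • y) x (X x) =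
        ((δ * γ ^ 2)⁻¹ * obilin s (Y x) (Z x)) • X x +
          (fderiv ℝ (fun y => (δ * γ ^ 2)⁻¹ * obilin s (Y y) (Z y)) x (X x)) • x := by
      rw [fderiv_fun_smul (hb.const_mul _) differentiableAt_fun_id]
      simp
    have h1 := fderiv_tangent_congr hn hW hg hx
      ((isConnectionOn_zero (δ := δ) (γ := γ) hW).differentiableAt_covD hx.2 hnx hdY hZ.smooth) (hd1.add hd2)
      (hX.tangent x hx)
    rw [covD, h1]
    simp only [g]
    rw [fderiv_fun_add hd1 hd2, add_apply, hd3,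
      fderiv_fderiv_apply hW hx.2 hZ.smooth hdY, tproj_add, tproj_add _ (_ • X x), tproj_smul _ x x,
      tproj_self hnx, tproj_smul, tproj_eq_self (hX.tangent x hx)]
    simp
  have hsymm : IsSymmSndFDerivAt ℝ Z x :=
    (hZ.smooth.contDiffAt (hW.mem_nhds hx.2)).isSymmSndFDerivAt (by simpa using ENat.LEInfty.out)
  rw [curvature, key X Y hX hY, key Y X hY hX, hsymm.eq (X x) (Y x), covD, VectorField.lieBracket,
    map_sub, tproj_add, tproj_add, tproj_sub]
  simp only [Pi.zero_apply, LinearMap.zero_apply]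
  module

/-- If `∇̄ + κ` with totally skew-symmetric `κ` is flat, then for fields `X`, `Y` whose product
`κ(X, Y)` extends to a field `V`, the norm of `V` is given by the curvature of `∇̄`. -/
theorem onorm_contorsion_of_flat (hn : δ * γ ^ 2 ≠ 0) (hκ : IsConnectionOn s δ γ W κ)
    (hflat : IsFlatOn s δ γ W κ)
    (hskew : ∀ x ∈ pseudoSphere s δ γ ∩ W, ∀ u ∈ tangentAt s x, ∀ v ∈ tangentAt s x,
      κ x u v = -κ x v u)
    (hmetric : ∀ x ∈ pseudoSphere s δ γ ∩ W, ∀ u ∈ tangentAt s x, ∀ v ∈ tangentAt s x,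
      ∀ w ∈ tangentAt s x, obilin s (κ x u v) w + obilin s v (κ x u w) = 0)
    {X Y V : Oct → Oct}
    (hX : IsTangentField s δ γ W X) (hY : IsTangentField s δ γ W Y) (hV : IsTangentField s δ γ W V)
    (hXY : ∀ y ∈ pseudoSphere s δ γ ∩ W, κ y (X y) (Y y) = V y)
    {c : ℝ} (hVX : ∀ y ∈ pseudoSphere s δ γ ∩ W, obilin s (V y) (X y) = c)
    {x : Oct} (hx : x ∈ pseudoSphere s δ γ ∩ W) :
    onorm s (V x) = (δ * γ ^ 2)⁻¹ *
      (onorm s (Y x) * onorm s (X x) - obilin s (X x) (Y x) ^ 2) := by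
  have hW := hκ.isOpen
  have hnx : onorm s x ≠ 0 := by rwa [mem_pseudoSphere.1 hx.1]
  have hXx := hX.tangent x hx
  have hYx := hY.tangent x hx
  have hVx := hV.tangent x hx
  have hdX := hX.differentiableAt hW hx.2
  have hdY := hY.differentiableAt hW hx.2
  have hdV := hV.differentiableAt hW hx.2
  have hself : ∀ y ∈ pseudoSphere s δ γ ∩ W, ∀ u ∈ tangentAt s y, κ y u u = 0 :=
    fun y hy u hu => self_eq_neg.1 (hskew y hy u hu u hu)
  have h0 := hflat X Y Y hX hY hY x hx
  have hR := curvature_zero_eq hn hW hX hY hY hx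
  -- abbreviations for the Levi-Civita derivatives
  have hcov : ∀ Y u, covD s κ Y x u = covD s 0 Y x u + κ x u (Y x) := by
    intro Y u; simp [covD]
  have hF1 : ∀ y ∈ pseudoSphere s δ γ ∩ W, covD s κ Y y (Y y) = covD s 0 Y y (Y y) := by
    intro y hy
    simp [covD, hself y hy _ (hY.tangent y hy)]
  have hF2 : ∀ y ∈ pseudoSphere s δ γ ∩ W, covD s κ Y y (X y) = covD s 0 Y y (X y) + V y := by
    intro y hy
    simp [covD, hXY y hy]
  have hz := isConnectionOn_zero (s := s) (δ := δ) (γ := γ) hW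
  have hc1 : ∀ U, IsTangentField s δ γ W U → DifferentiableAt ℝ (fun y => covD s 0 Y y (U y)) x :=
    fun U hU => hz.differentiableAt_covD hx.2 hnx (hU.differentiableAt hW hx.2) hY.smooth
  have hc2 : ∀ U, IsTangentField s δ γ W U → DifferentiableAt ℝ (fun y => covD s κ Y y (U y)) x :=
    fun U hU => hκ.differentiableAt_covD hx.2 hnx (hU.differentiableAt hW hx.2) hY.smooth
  have e1 : covD s κ (fun y => covD s κ Y y (Y y)) x (X x) =
      covD s 0 (fun y => covD s 0 Y y (Y y)) x (X x) + κ x (X x) (covD s 0 Y x (Y x)) := by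
    rw [hcov, hF1 x hx, covD, fderiv_tangent_congr hn hW hF1 hx (hc2 Y hY) (hc1 Y hY) hXx, covD]
    rfl
  have e2 : covD s κ (fun y => covD s κ Y y (X y)) x (Y x) =
      covD s 0 (fun y => covD s 0 Y y (X y)) x (Y x) + covD s 0 V x (Y x) +
        κ x (Y x) (covD s 0 Y x (X x) + V x) := by
    rw [hcov, hF2 x hx, covD,
      fderiv_tangent_congr hn hW hF2 hx (hc2 X hX) ((hc1 X hX).add hdV) hYx,
      fderiv_fun_add (hc1 X hX) hdV, add_apply, tproj_add]
    simp [covD]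
  have e3 := hcov Y (VectorField.lieBracket ℝ X Y x)
  have hbr := lieBracket_mem_tangentAt hn hW hX hY hx
  have ht : ∀ Y u, covD s 0 Y x u ∈ tangentAt s x := by
    intro Y u
    simpa [covD] using tproj_mem hnx (fderiv ℝ Y x u)
  -- pair the curvature with `X`
  have h1 : curvature s 0 X Y Y x + κ x (X x) (covD s 0 Y x (Y x)) - covD s 0 V x (Y x)
      - κ x (Y x) (covD s 0 Y x (X x)) - κ x (Y x) (V x)
      - κ x (VectorField.lieBracket ℝ X Y x) (Y x) = 0 := by
    rw [← h0, curvature, curvature, e1, e2, e3, map_add]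
    abel
  have h2 := congrArg (fun v => obilin s v (X x)) h1
  simp only [map_sub, map_add, LinearMap.sub_apply, LinearMap.add_apply, map_zero,
    LinearMap.zero_apply] at h2
  have i1 : obilin s (κ x (X x) (covD s 0 Y x (Y x))) (X x) = 0 := by
    have := hmetric x hx _ hXx _ (ht Y (Y x)) _ hXx
    rwa [hself x hx _ hXx, map_zero, add_zero] at this
  -- As (V, X) is constant, the derivative of `V` is traded for one of `X`; this is where `hVX`
  -- enters.
  have i2 : obilin s (covD s 0 V x (Y x)) (X x) = -obilin s (V x) (covD s 0 X x (Y x)) := by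
    have hm := isMetricConn_of_skew (s := s) (δ := δ) (γ := γ) 0 (by simp) W hW V X hV hX x hx _ hYx
    have := fderiv_tangent_congr hn hW (f := fun y => obilin s (V y) (X y)) (g := fun _ => c) hVX hx
      (hdV.bilin _ hdX) (differentiableAt_const _) hYx
    rw [hm] at this
    simp at this
    linarith
  have i3 : obilin s (κ x (Y x) (covD s 0 Y x (X x))) (X x) =
      obilin s (V x) (covD s 0 Y x (X x)) := by
    have := hmetric x hx _ hYx _ (ht Y (X x)) _ hXx
    rw [hskew x hx _ hYx _ hXx, hXY x hx, map_neg, obilin_comm s _ (V x)] at this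
    linarith
  have i4 : obilin s (κ x (Y x) (V x)) (X x) = onorm s (V x) := by
    have := hmetric x hx _ hYx _ hVx _ hXx
    rw [hskew x hx _ hYx _ hXx, hXY x hx, map_neg, ← onorm_eq_obilin] at this
    linarith
  have i5 : obilin s (κ x (VectorField.lieBracket ℝ X Y x) (Y x)) (X x) =
      -obilin s (V x) (VectorField.lieBracket ℝ X Y x) := by
    have := hmetric x hx _ hYx _ hbr _ hXx
    rw [hskew x hx _ hYx _ hXx, hXY x hx, map_neg, obilin_comm s _ (V x)] at this
    rw [hskew x hx _ hbr _ hYx, map_neg, LinearMap.neg_apply]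
    linarith
  -- Torsion-freeness of the Levi-Civita connection: the bracket term cancels the derivative terms
  -- in `i2` and `i3`, leaving only the curvature and N(V).
  have i6 : VectorField.lieBracket ℝ X Y x = covD s 0 Y x (X x) - covD s 0 X x (Y x) := by
    have := torsion_eq_torsionAt hn 0 hW hX hY hx
    rw [torsion, torsionAt] at this
    simp only [Pi.zero_apply, LinearMap.zero_apply, sub_zero] at this
    exact (sub_eq_zero.1 this).symm
  rw [i1, i2, i3, i4, i5, hR, i6] at h2
  simp only [map_sub, map_smul, LinearMap.sub_apply, LinearMap.smul_apply, smul_eq_mul] at h2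
  simp only [onorm_eq_obilin]
  rw [obilin_comm s (Y x) (X x)] at h2
  rw [onorm_eq_obilin] at h2
  linear_combination -h2

end Curvature

/-! ### Orthonormal frames as linear maps -/

section Frames

variable {s : ℝ}

/-- The linear map that takes the imaginary units to the given vectors, and `e₀` to `0`. -/
def frameMap (E : Fin 7 → Oct) : Oct →ₗ[ℝ] Oct where
  toFun a := ∑ i, a i.succ • E i
  map_add' a b := by simp [add_smul, Finset.sum_add_distrib]
  map_smul' c a := by simp [smul_smul, Finset.smul_sum]

theorem frameMap_apply (E : Fin 7 → Oct) (a : Oct) : frameMap E a = ∑ i, a i.succ • E i := rfl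

theorem frameMap_oim (E : Fin 7 → Oct) (i : Fin 7) : frameMap E (oim i) = E i := by
  rw [frameMap_apply, Finset.sum_eq_single i]
  · simp [oim, obasis]
  · intro j _ hj
    simp [oim, obasis, hj]
  · simp

theorem frameMap_one (E : Fin 7 → Oct) : frameMap E (obasis 0) = 0 := by
  simp [frameMap_apply, obasis]

theorem eq_sum_oim {a : Oct} (ha : a 0 = 0) : a = ∑ i : Fin 7, a i.succ • oim i := by
  conv_lhs => rw [pi_eq_sum_univ' a]
  rw [Fin.sum_univ_succ, ha, zero_smul, zero_add]
  rfl

theorem omul_comm_imaginary {a b : Oct} (ha : a 0 = 0) (hb : b 0 = 0) :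
    omul s a b + omul s b a = -((2 * obilin s a b) • obasis 0) := by
  have := omul_oconj_add_omul_oconj s a b
  rw [oconj_eq_neg ha, oconj_eq_neg hb, omul_neg, omul_neg, ← neg_add] at this
  rw [← this, neg_neg]

theorem oeta_eq (a b : Fin 7) : oeta s a b = if a = b then oeta s a a else 0 := by
  fin_cases a <;> fin_cases b <;> simp [oeta, obilin_coord, oim, obasis]

theorem oeta_self_ne_zero (hs : s ≠ 0) (a : Fin 7) : oeta s a a ≠ 0 := by
  fin_cases a <;> simp [oeta, obilin_coord, oim, obasis, hs]

variable {δ : ℝ} {E : Fin 7 → Oct}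
  (hE : ∀ a b, obilin s (E a) (E b) = δ * oeta s a b)
include hE

/-- Only one argument has to be imaginary: the real part of the other is killed by `frameMap` and is
orthogonal to the first. -/
theorem obilin_frameMap {a b : Oct} (ha : a 0 = 0) :
    obilin s (frameMap E a) (frameMap E b) = δ * obilin s a b := by
  have hb : b = b 0 • obasis 0 + (b - b 0 • obasis 0) := by abel
  have hb0 : (b - b 0 • obasis 0) 0 = 0 := by simp [obasis]
  rw [hb, map_add, map_smul, frameMap_one, smul_zero, zero_add, map_add, map_smul,
    obilin_comm s a (obasis 0), obilin_one, ha, smul_zero, zero_add]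
  generalize b - b 0 • obasis 0 = b at hb0
  rw [eq_sum_oim ha, eq_sum_oim hb0]
  simp only [map_sum, map_smul, LinearMap.sum_apply, LinearMap.smul_apply, frameMap_oim, hE,
    Finset.mul_sum, smul_eq_mul, oeta]
  refine Finset.sum_congr rfl fun i _ => Finset.sum_congr rfl fun j _ => ?_
  ring

/-- The vectors `x` and `E a` are eight pairwise orthogonal vectors of non-zero norm, hence a basis;
the coefficients are the orthogonal ones. -/
theorem exists_frameMap_eq (hs : s ≠ 0) (hδ : δ ≠ 0) {x : Oct} (hx : onorm s x ≠ 0)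
    (hxE : ∀ a, obilin s x (E a) = 0) {v : Oct} (hv : obilin s x v = 0) :
    ∃ a : Oct, a 0 = 0 ∧ frameMap E a = v := by
  let b : Fin 8 → Oct := Fin.cons x E
  have hortho : LinearMap.BilinForm.iIsOrtho (obilin s) b := by
    intro i j hij
    change obilin s (b i) (b j) = 0
    revert hij
    refine Fin.cases (fun hij => ?_) (fun i hij => ?_) i
    · refine Fin.cases (fun h => absurd rfl h) (fun j _ => ?_) j hij
      simpa [b] using hxE j
    · refine Fin.cases (fun h => ?_) (fun j hij => ?_) j hij
      · simpa [b, obilin_comm s _ x] using hxE i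
      · have : i ≠ j := fun h => hij (by rw [h])
        simp [b, hE, oeta_eq i j, this]
  have hli : LinearIndependent ℝ b := by
    refine LinearMap.BilinForm.linearIndependent_of_iIsOrtho hortho fun i => ?_
    refine Fin.cases ?_ (fun i => ?_) i
    · exact hx
    · have := mul_ne_zero hδ (oeta_self_ne_zero hs i)
      simpa [b, hE] using this
  have hspan : Submodule.span ℝ (Set.range b) = ⊤ :=
    hli.span_eq_top_of_card_eq_finrank (by simp)
  refine ⟨Fin.cons 0 fun i => obilin s v (E i) / (δ * oeta s i i), rfl, ?_⟩
  have hw : ∀ y, obilin s (v - frameMap E (Fin.cons 0 fun i => obilin s v (E i) / (δ * oeta s i i))) y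
      = 0 := by
    have h1 : obilin s (v - frameMap E (Fin.cons 0 fun i => obilin s v (E i) / (δ * oeta s i i))) = 0 := by
      refine LinearMap.ext_on_range hspan (fun i => ?_)
      rw [LinearMap.zero_apply, obilin_comm]
      refine Fin.cases ?_ (fun i => ?_) i
      · simp [b, frameMap_apply, hv, hxE]
      · have hne := mul_ne_zero hδ (oeta_self_ne_zero hs i)
        simp only [b, Fin.cons_succ, frameMap_apply, map_sub, map_sum, map_smul, hE, smul_eq_mul]
        rw [Finset.sum_eq_single i, div_mul_cancel₀ _ hne, obilin_comm, sub_self]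
        · intro j _ hj
          rw [oeta_eq i j, if_neg hj.symm]; simp
        · simp
    intro y; rw [h1]; rfl
  exact (sub_eq_zero.1 (obilin_nondegenerate hs hw)).symm

end Frames

/-! ### The possible coefficients of flat connections -/

section FlatConnections

variable {s δ γ : ℝ} {W : Set Oct} {κ : Oct → Oct →ₗ[ℝ] Oct →ₗ[ℝ] Oct}

/-- The coefficients of flat connections. -/
theorem sq_eq_of_isFlatOn (hδ : δ ^ 2 = 1) (hγ : γ ≠ 0) (hs : s ≠ 0) {β : ℝ}
    {E : Fin 7 → Oct → Oct}
    (hne : (pseudoSphere s δ γ ∩ W).Nonempty) (hκ : IsConnectionOn s δ γ W κ)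
    (hE : IsLorentzFrame s δ γ W E) (hform : HasStructForms s δ γ β W E κ)
    (hflat : IsFlatOn s δ γ W κ) : β ^ 2 = 1 / γ ^ 2 := by
  obtain ⟨x, hx⟩ := hne
  have hδ0 : δ ≠ 0 := by rintro rfl; norm_num at hδ
  have hn : δ * γ ^ 2 ≠ 0 := by positivity
  have hκE : ∀ y ∈ pseudoSphere s δ γ ∩ W, ∀ b c,
      κ y (E c y) (E b y) = β • frameMap (E · y) (omul s (oim b) (oim c)) := by
    intro y hy b c
    have := hform y hy b c
    simp only [covD, Pi.zero_apply, LinearMap.zero_apply, add_zero] at this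
    exact add_left_cancel this
  -- Bilinear extension to all tangent vectors. Since `frameMap` annihilates e₀, the structure
  -- constants are replaced by the full product, with the factors in reverse order.
  have hκT : ∀ y ∈ pseudoSphere s δ γ ∩ W, ∀ a b : Oct, a 0 = 0 → b 0 = 0 →
      κ y (frameMap (E · y) a) (frameMap (E · y) b) = β • frameMap (E · y) (omul s b a) := by
    intro y hy a b ha hb
    have h1 : omul s b a = ∑ j, ∑ i, (b j.succ * a i.succ) • omul s (oim j) (oim i) := by
      conv_lhs => rw [eq_sum_oim ha, eq_sum_oim hb, ← omulB_apply]
      simp only [map_sum, LinearMap.sum_apply, map_smul, LinearMap.smul_apply, smul_smul,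
        Finset.smul_sum, omulB_apply]
      rw [Finset.sum_comm]
      simp only [mul_comm]
    rw [h1, frameMap_apply (a := a), frameMap_apply (a := b)]
    simp only [map_sum, LinearMap.sum_apply, map_smul, LinearMap.smul_apply, hκE y hy,
      Finset.smul_sum, smul_smul]
    refine Finset.sum_congr rfl fun j _ => Finset.sum_congr rfl fun i _ => ?_
    congr 1; ring
  have hspan : ∀ y ∈ pseudoSphere s δ γ ∩ W, ∀ v ∈ tangentAt s y,
      ∃ a : Oct, a 0 = 0 ∧ frameMap (E · y) a = v := fun y hy v hv =>
    exists_frameMap_eq (hE.orthonormal y hy) hs hδ0 (by rwa [mem_pseudoSphere.1 hy.1])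
      (fun a => (hE.tangent a).tangent y hy) hv
  have h12 : omul s (oim 1) (oim 0) = -oim 2 := by
    ext i
    fin_cases i <;>
    simp [omul_zero_coord, omul_one_coord, omul_two_coord, omul_three_coord, omul_four_coord,
      omul_five_coord, omul_six_coord, omul_seven_coord, oim, obasis]
  have hV : IsTangentField s δ γ W (fun y => -β • E 2 y) :=
    ⟨(hE.tangent 2).smooth.const_smul _, fun y hy =>
      Submodule.smul_mem _ _ ((hE.tangent 2).tangent y hy)⟩
  -- The frame vectors with indices 0, 1, 2 correspond to i, j, k, for which η = 1 whatever `s` is.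
  -- So κ(E₀, E₁) = −βE₂ has norm β²δ, orthogonal to E₀.
  have key := onorm_contorsion_of_flat hn hκ hflat (X := E 0) (Y := E 1)
    (V := fun y => -β • E 2 y) (c := 0) ?_ ?_ (hE.tangent 0) (hE.tangent 1) hV ?_ ?_ hx
  · rw [onorm_smul, onorm_eq_obilin, onorm_eq_obilin, onorm_eq_obilin, hE.orthonormal x hx,
      hE.orthonormal x hx, hE.orthonormal x hx, hE.orthonormal x hx] at key
    simp [oeta, obilin_coord, oim, obasis] at key
    field_simp
    field_simp at key
    exact key
  · intro y hy u hu v hv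
    obtain ⟨a, ha, rfl⟩ := hspan y hy u hu
    obtain ⟨b, hb, rfl⟩ := hspan y hy v hv
    rw [hκT y hy a b ha hb, hκT y hy b a hb ha, ← smul_neg, ← map_neg]
    have := omul_comm_imaginary (s := s) ha hb
    rw [eq_neg_of_add_eq_zero_right
      (a := omul s b a + (2 * obilin s a b) • obasis 0) (b := omul s a b) (by
        rw [add_right_comm, add_comm (omul s b a), this, neg_add_cancel])]
    rw [neg_neg, map_add, map_smul, frameMap_one, smul_zero, add_zero]
  · intro y hy u hu v hv w hw
    obtain ⟨a, ha, rfl⟩ := hspan y hy u hu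
    obtain ⟨b, hb, rfl⟩ := hspan y hy v hv
    obtain ⟨c, hc, rfl⟩ := hspan y hy w hw
    rw [hκT y hy a b ha hb, hκT y hy a c ha hc, map_smul, map_smul, LinearMap.smul_apply,
      obilin_frameMap (hE.orthonormal y hy) hb, obilin_comm,
      obilin_frameMap (hE.orthonormal y hy) hc, obilin_comm, obilin_omul_right, oconj_eq_neg ha,
      omul_neg, map_neg]
    simp
  · intro y hy
    rw [hκE y hy, h12, map_neg, frameMap_oim, smul_neg, neg_smul]
  · intro y hy
    rw [map_smul, LinearMap.smul_apply, hE.orthonormal y hy, oeta_eq]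
    simp

end FlatConnections


/-! ### The spin representation -/

section EvenClifford

theorem mem_imOct {a : Oct} : a ∈ imOct ↔ a 0 = 0 := by
  constructor
  · intro h
    have h1 : oconj a = -a := h
    have := congrFun h1 0
    rw [oconj_zero_coord, Pi.neg_apply] at this
    linarith
  · exact fun h => oconj_eq_neg h

theorem imOct_zero (a : imOct) : (a : Oct) 0 = 0 := mem_imOct.1 a.2

theorem imOct_oconj (a : imOct) : oconj (a : Oct) = -(a : Oct) := a.2

/-- The imaginary units as elements of `imOct`. -/
def imUnit (i : Fin 7) : imOct := ⟨oim i, mem_imOct.2 (oim_zero i)⟩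

/-- Coordinates on the imaginary elements. -/
def imOctEquiv : imOct ≃ₗ[ℝ] (Fin 7 → ℝ) where
  toFun a i := (a : Oct) i.succ
  map_add' _ _ := rfl
  map_smul' _ _ := rfl
  invFun v := ⟨Fin.cons 0 v, mem_imOct.2 rfl⟩
  left_inv a := by
    ext i
    refine Fin.cases ?_ (fun i => ?_) i
    · simp [imOct_zero a]
    · rfl
  right_inv v := by ext i; rfl

theorem finrank_imOct : Module.finrank ℝ imOct = 7 := by
  rw [imOctEquiv.finrank_eq]; simp

theorem imForm_apply (s δ : ℝ) (a : imOct) : imForm s δ a = δ * onorm s a := rfl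

open CliffordAlgebra in
instance finite_cliffordAlgebra {V : Type*} [AddCommGroup V] [Module ℝ V] [Module.Finite ℝ V]
    (Q : QuadraticForm ℝ V) : Module.Finite ℝ (CliffordAlgebra Q) := by
  have b := (Module.finBasis ℝ V).ExteriorAlgebra
  have : Module.Finite ℝ (ExteriorAlgebra ℝ V) := Module.Finite.of_basis b
  exact Module.Finite.equiv (equivExterior Q).symm

open CliffordAlgebra in
theorem finrank_cliffordAlgebra {V : Type*} [AddCommGroup V] [Module ℝ V] [Module.Finite ℝ V]
    (Q : QuadraticForm ℝ V) :
    Module.finrank ℝ (CliffordAlgebra Q) = 2 ^ Module.finrank ℝ V := by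
  rw [(equivExterior Q).finrank_eq,
    Module.finrank_eq_card_basis (Module.finBasis ℝ V).ExteriorAlgebra]
  simp

open CliffordAlgebra in
/-- The even part has half the dimension, if the form does not vanish. -/
theorem two_mul_finrank_even {V : Type*} [AddCommGroup V] [Module ℝ V] [Module.Finite ℝ V]
    (Q : QuadraticForm ℝ V) {v : V} (hv : Q v ≠ 0) :
    2 * Module.finrank ℝ (even Q) = 2 ^ Module.finrank ℝ V := by
  have h1 := Submodule.finrank_add_eq_of_isCompl (evenOdd_isCompl Q)
  have hle : ∀ i j : ZMod 2, i + 1 = j →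
      Module.finrank ℝ (evenOdd Q i) ≤ Module.finrank ℝ (evenOdd Q j) := by
    intro i j hij
    -- Multiplication by an anisotropic vector exchanges the parities and is injective, because its
    -- square is a non-zero scalar.
    let f : evenOdd Q i →ₗ[ℝ] evenOdd Q j :=
      ((LinearMap.mulLeft ℝ (ι Q v)).comp (evenOdd Q i).subtype).codRestrict (evenOdd Q j) (by
        intro x
        have := SetLike.mul_mem_graded (ι_mem_evenOdd_one Q v) x.2
        rwa [add_comm, hij] at this)
    refine LinearMap.finrank_le_finrank_of_injective (f := f) ?_
    intro x y hxy
    have h2 : ι Q v * (x : CliffordAlgebra Q) = ι Q v * y := congrArg Subtype.val hxy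
    have h3 := congrArg (ι Q v * ·) h2
    simp only [← mul_assoc, ι_sq_scalar, ← Algebra.smul_def] at h3
    exact Subtype.ext (smul_right_injective _ hv h3)
  have h2 := hle 0 1 (by decide)
  have h3 := hle 1 0 (by decide)
  have h4 : Module.finrank ℝ (even Q) = Module.finrank ℝ (evenOdd Q 0) := rfl
  rw [finrank_cliffordAlgebra] at h1
  omega

end EvenClifford

/-! ### Left multiplications and the isomorphism with the endomorphisms -/

section SpinRep

variable (s : ℝ)

/-- Left multiplication by imaginary elements. -/
def lmul : imOct →ₗ[ℝ] Module.End ℝ Oct := (omulB s).comp imOct.subtype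

@[simp] theorem lmul_apply (a : imOct) (x : Oct) : lmul s a x = omul s a x := rfl

theorem lmul_mul_self (a : imOct) : lmul s a * lmul s a = (-onorm s a) • 1 := by
  ext1 i; ext1
  have := oconj_omul_omul s a (Pi.single i 1)
  rw [imOct_oconj, neg_omul] at this
  simp [← this]

/-- The even Clifford algebra acts by products of pairs of left multiplications. -/
def spinHom (δ : ℝ) :
    CliffordAlgebra.even (imForm s δ) →ₐ[ℝ] Module.End ℝ Oct :=
  CliffordAlgebra.even.lift _
    -- The square of L_a is −N(a) while the quadratic form is δN; the factor −δ on pairs repairs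
    -- both contraction rules, without using δ² = 1.
    { bilin := LinearMap.mk₂ ℝ (fun a b => (-δ) • (lmul s a * lmul s b))
        (by intro a a' b; simp only [map_add, add_mul, smul_add])
        (by intro c a b; rw [map_smul, smul_mul_assoc, smul_comm])
        (by intro a b b'; simp only [map_add, mul_add, smul_add])
        (by intro c a b; rw [map_smul, mul_smul_comm, smul_comm])
      contract := by
        intro a
        rw [LinearMap.mk₂_apply, lmul_mul_self, smul_smul, Algebra.algebraMap_eq_smul_one,
          imForm_apply]
        congr 1; ring
      contract_mid := by
        intro a b c
        simp only [LinearMap.mk₂_apply, smul_mul_smul_comm, imForm_apply, smul_smul]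
        rw [mul_assoc, ← mul_assoc (lmul s b), lmul_mul_self, smul_mul_assoc, one_mul,
          mul_smul_comm, smul_smul]
        congr 1; ring }

variable {s} {δ : ℝ}

theorem spinHom_ι_mul_ι (a b : imOct) (h) :
    spinHom s δ ⟨CliffordAlgebra.ι _ a * CliffordAlgebra.ι _ b, h⟩ =
      (-δ) • (lmul s a * lmul s b) :=
  CliffordAlgebra.even.lift_ι _ _ a b

theorem lmul_imUnit_zero (s : ℝ) (x : Oct) :
    lmul s (imUnit 0) x = ![-x 1, x 0, -x 3, x 2, x 5, -x 4, x 7, -x 6] := by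
  ext i
  fin_cases i <;>
  simp [imUnit, oim, obasis, omul_zero_coord, omul_one_coord, omul_two_coord, omul_three_coord,
    omul_four_coord, omul_five_coord, omul_six_coord, omul_seven_coord]

theorem lmul_imUnit_one (s : ℝ) (x : Oct) :
    lmul s (imUnit 1) x = ![-x 2, x 3, x 0, -x 1, x 6, -x 7, -x 4, x 5] := by
  ext i
  fin_cases i <;>
  simp [imUnit, oim, obasis, omul_zero_coord, omul_one_coord, omul_two_coord, omul_three_coord,
    omul_four_coord, omul_five_coord, omul_six_coord, omul_seven_coord]

theorem lmul_imUnit_two (s : ℝ) (x : Oct) :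
    lmul s (imUnit 2) x = ![-x 3, -x 2, x 1, x 0, x 7, x 6, -x 5, -x 4] := by
  ext i
  fin_cases i <;>
  simp [imUnit, oim, obasis, omul_zero_coord, omul_one_coord, omul_two_coord, omul_three_coord,
    omul_four_coord, omul_five_coord, omul_six_coord, omul_seven_coord]

theorem lmul_imUnit_three (s : ℝ) (x : Oct) :
    lmul s (imUnit 3) x = ![s * x 4, s * x 5, s * x 6, s * x 7, x 0, x 1, x 2, x 3] := by
  ext i
  fin_cases i <;>
  simp [imUnit, oim, obasis, omul_zero_coord, omul_one_coord, omul_two_coord, omul_three_coord,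
    omul_four_coord, omul_five_coord, omul_six_coord, omul_seven_coord]

theorem lmul_imUnit_four (s : ℝ) (x : Oct) :
    lmul s (imUnit 4) x = ![s * x 5, -(s * x 4), -(s * x 7), s * x 6, -x 1, x 0, x 3, -x 2] := by
  ext i
  fin_cases i <;>
  simp [imUnit, oim, obasis, omul_zero_coord, omul_one_coord, omul_two_coord, omul_three_coord,
    omul_four_coord, omul_five_coord, omul_six_coord, omul_seven_coord]

theorem lmul_imUnit_five (s : ℝ) (x : Oct) :
    lmul s (imUnit 5) x = ![s * x 6, s * x 7, -(s * x 4), -(s * x 5), -x 2, -x 3, x 0, x 1] := by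
  ext i
  fin_cases i <;>
  simp [imUnit, oim, obasis, omul_zero_coord, omul_one_coord, omul_two_coord, omul_three_coord,
    omul_four_coord, omul_five_coord, omul_six_coord, omul_seven_coord]

theorem lmul_imUnit_six (s : ℝ) (x : Oct) :
    lmul s (imUnit 6) x = ![s * x 7, -(s * x 6), s * x 5, -(s * x 4), -x 3, x 2, -x 1, x 0] := by
  ext i
  fin_cases i <;>
  simp [imUnit, oim, obasis, omul_zero_coord, omul_one_coord, omul_two_coord, omul_three_coord,
    omul_four_coord, omul_five_coord, omul_six_coord, omul_seven_coord]

theorem lmul_quaternion_units (s : ℝ) (x : Oct) :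
    (lmul s (imUnit 0) * lmul s (imUnit 1) * lmul s (imUnit 2)) x =
      ![-x 0, -x 1, -x 2, -x 3, x 4, x 5, x 6, x 7] := by
  ext j
  simp only [Module.End.mul_apply, lmul_imUnit_zero, lmul_imUnit_one, lmul_imUnit_two]
  fin_cases j <;> simp

/-- The volume element acts as a scalar. Thus a single L_a is an even product up to scale, and
nothing invertible can anticommute with all L_a. -/
theorem lmul_units_prod (s : ℝ) : lmul s (imUnit 0) * lmul s (imUnit 1) * lmul s (imUnit 2) *
    lmul s (imUnit 3) * lmul s (imUnit 4) * lmul s (imUnit 5) * lmul s (imUnit 6) =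
      (s ^ 2) • 1 := by
  have h2 : ∀ x, (lmul s (imUnit 3) * lmul s (imUnit 4)) x =
      s • ![-x 1, x 0, x 3, -x 2, x 5, -x 4, -x 7, x 6] := by
    intro x
    ext j
    simp only [Module.End.mul_apply, lmul_imUnit_three, lmul_imUnit_four]
    fin_cases j <;> simp
  have h3 : ∀ x, (lmul s (imUnit 5) * lmul s (imUnit 6)) x =
      s • ![-x 1, x 0, x 3, -x 2, -x 5, x 4, x 7, -x 6] := by
    intro x
    ext j
    simp only [Module.End.mul_apply, lmul_imUnit_five, lmul_imUnit_six]
    fin_cases j <;> simp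
  rw [mul_assoc _ (lmul s (imUnit 3)), mul_assoc _ (lmul s (imUnit 5))]
  refine LinearMap.ext fun x => ?_
  rw [Module.End.mul_apply, Module.End.mul_apply, h3, map_smul, h2, map_smul, map_smul,
    lmul_quaternion_units, smul_smul, ← pow_two, LinearMap.smul_apply, Module.End.one_apply]
  congr 1
  ext j
  fin_cases j <;> simp

/-- The projection to the real part. -/
def reProj : Module.End ℝ Oct := (LinearMap.proj 0).smulRight (obasis 0)

theorem reProj_apply (x : Oct) : reProj x = x 0 • obasis 0 := rfl

/-- The three triple products are commuting diagonal sign matrices whose only common eigenvector for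
−1, up to scale, is e₀. So (1 − A)(1 − B)(1 − C) is 8 times the projection onto e₀. -/
theorem reProj_eq (hs : s ≠ 0) : (8 : ℝ) • reProj =
    (1 - lmul s (imUnit 0) * lmul s (imUnit 1) * lmul s (imUnit 2)) *
    ((1 - s⁻¹ • (lmul s (imUnit 0) * lmul s (imUnit 3) * lmul s (imUnit 4))) *
    (1 - s⁻¹ • (lmul s (imUnit 1) * lmul s (imUnit 3) * lmul s (imUnit 5)))) := by
  have h1 := lmul_quaternion_units s
  have h2 : ∀ x, (s⁻¹ • (lmul s (imUnit 0) * lmul s (imUnit 3) * lmul s (imUnit 4))) x =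
      ![-x 0, -x 1, x 2, x 3, -x 4, -x 5, x 6, x 7] := by
    intro x
    ext j
    simp only [Module.End.mul_apply, lmul_imUnit_zero, lmul_imUnit_three, lmul_imUnit_four,
      LinearMap.smul_apply]
    fin_cases j <;> simp [hs]
  have h3 : ∀ x, (s⁻¹ • (lmul s (imUnit 1) * lmul s (imUnit 3) * lmul s (imUnit 5))) x =
      ![-x 0, x 1, -x 2, x 3, -x 4, x 5, -x 6, x 7] := by
    intro x
    ext j
    simp only [Module.End.mul_apply, lmul_imUnit_one, lmul_imUnit_three, lmul_imUnit_five,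
      LinearMap.smul_apply]
    fin_cases j <;> simp [hs]
  refine LinearMap.ext fun x => ?_
  rw [Module.End.mul_apply, Module.End.mul_apply]
  simp only [LinearMap.sub_apply, Module.End.one_apply, h1, h2, h3, LinearMap.smul_apply,
    reProj_apply]
  ext j
  fin_cases j <;> simp [obasis, Matrix.vecHead, Matrix.vecTail] <;> ring

variable (hδ : δ ^ 2 = 1)
include hδ

theorem lmul_mul_mem_range (a b : imOct) : lmul s a * lmul s b ∈ (spinHom s δ).range := by
  have h := spinHom_ι_mul_ι (s := s) (δ := δ) a b (CliffordAlgebra.ι_mul_ι_mem_evenOdd_zero _ a b)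
  have h2 : lmul s a * lmul s b = (-δ) • ((-δ) • (lmul s a * lmul s b)) := by
    rw [smul_smul, neg_mul_neg, ← pow_two, hδ, one_smul]
  rw [h2, ← h]
  exact Subalgebra.smul_mem _ (AlgHom.mem_range_self _ _) _

/-- By the volume element, the first left multiplication is a multiple of the product of the other
six, which is even; any other one is then obtained from pairs. -/
theorem lmul_mem_range (hs : s ≠ 0) (a : imOct) : lmul s a ∈ (spinHom s δ).range := by
  have hp := lmul_units_prod s
  have h0 : lmul s (imUnit 0) * lmul s (imUnit 0) = (-1 : ℝ) • 1 := by
    rw [lmul_mul_self]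
    congr 1
    simp [imUnit, oim, obasis, onorm_eq_obilin, obilin_coord]
  have h1 : lmul s (imUnit 0) ∈ (spinHom s δ).range := by
    have e : lmul s (imUnit 0) = (-(s ^ 2)⁻¹) • (lmul s (imUnit 1) * lmul s (imUnit 2) *
        (lmul s (imUnit 3) * lmul s (imUnit 4)) * (lmul s (imUnit 5) * lmul s (imUnit 6))) := by
      have := congrArg (lmul s (imUnit 0) * ·) hp
      simp only [mul_smul_comm, mul_one, ← mul_assoc, h0] at this
      rw [← inv_smul_smul₀ (pow_ne_zero 2 hs) (lmul s (imUnit 0)), ← this]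
      simp only [smul_mul_assoc, one_mul, smul_smul, mul_assoc, mul_neg, mul_one]
    rw [e]
    exact Subalgebra.smul_mem _ (mul_mem (mul_mem (lmul_mul_mem_range hδ _ _)
      (lmul_mul_mem_range hδ _ _)) (lmul_mul_mem_range hδ _ _)) _
  have h2 : lmul s a = (-1 : ℝ) • (lmul s a * lmul s (imUnit 0) * lmul s (imUnit 0)) := by
    rw [mul_assoc, h0, mul_smul_comm, mul_one, smul_smul]; simp
  rw [h2]
  exact Subalgebra.smul_mem _ (mul_mem (lmul_mul_mem_range hδ _ _) h1) _

theorem reProj_mem_range (hs : s ≠ 0) : reProj ∈ (spinHom s δ).range := by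
  have h := reProj_eq hs
  have h2 : reProj = (8 : ℝ)⁻¹ • ((8 : ℝ) • reProj) := by simp
  rw [h2, h]
  have m := lmul_mem_range hδ hs
  exact Subalgebra.smul_mem _ (mul_mem (sub_mem (one_mem _) (mul_mem (mul_mem (m _) (m _)) (m _)))
    (mul_mem (sub_mem (one_mem _) (Subalgebra.smul_mem _ (mul_mem (mul_mem (m _) (m _)) (m _)) _))
      (sub_mem (one_mem _) (Subalgebra.smul_mem _ (mul_mem (mul_mem (m _) (m _)) (m _)) _)))) _

omit hδ in
theorem omulB_eq (a : Oct) : ∃ b : imOct, omulB s a = a 0 • 1 + lmul s b := by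
  refine ⟨⟨a - a 0 • obasis 0, mem_imOct.2 (by simp [obasis])⟩, ?_⟩
  refine LinearMap.ext fun x => ?_
  simp [sub_omul, smul_omul]

theorem omulB_mem_range (hs : s ≠ 0) (a : Oct) : omulB s a ∈ (spinHom s δ).range := by
  obtain ⟨b, hb⟩ := omulB_eq (s := s) a
  rw [hb]
  exact add_mem (Subalgebra.smul_mem _ (one_mem _) _) (lmul_mem_range hδ hs b)

/-- Applying the conjugate of eᵢ and then `reProj` extracts the i-th coordinate up to N(eᵢ), and
left multiplication by T(eᵢ) puts T(eᵢ) in its place; the sum over i is T. -/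
theorem spinHom_surjective (hs : s ≠ 0) : Function.Surjective (spinHom s δ) := by
  rw [← AlgHom.range_eq_top, eq_top_iff]
  intro T _
  have hunit : ∀ i, onorm s (obasis i) ≠ 0 := by
    intro i
    fin_cases i <;> simp [onorm_eq_obilin, obilin_coord, obasis, hs]
  have hcoord : ∀ i (x : Oct), x i = (onorm s (obasis i))⁻¹ * omul s (oconj (obasis i)) x 0 := by
    intro i x
    rw [← obilin_one s (omul s _ x), obilin_comm, obilin_omul_left, oconj_oconj, omul_one, eq_inv_mul_iff_mul_eq₀ (hunit i)]
    fin_cases i <;> simp [onorm_eq_obilin, obilin_coord, obasis]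
  have h : T = ∑ i, (onorm s (obasis i))⁻¹ •
      (omulB s (T (obasis i)) * reProj * omulB s (oconj (obasis i))) := by
    refine LinearMap.ext fun x => ?_
    conv_lhs => rw [pi_eq_sum_univ' x]
    rw [LinearMap.sum_apply, map_sum]
    refine Finset.sum_congr rfl fun i _ => ?_
    rw [map_smul, hcoord i x]
    simp only [LinearMap.smul_apply, Module.End.mul_apply, omulB_apply, reProj_apply, omul_smul,
      omul_one, smul_smul]
    rfl
  rw [h]
  exact sum_mem fun i _ => Subalgebra.smul_mem _ (mul_mem (mul_mem (omulB_mem_range hδ hs _)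
    (reProj_mem_range hδ hs)) (omulB_mem_range hδ hs _)) _

/-- Both sides have dimension 64: the even part of a Clifford algebra on a 7-dimensional space has
dimension 2⁷/2. -/
theorem spinHom_bijective (hs : s ≠ 0) : Function.Bijective (spinHom s δ) := by
  have hδ0 : δ ≠ 0 := by rintro rfl; norm_num at hδ
  have h1 := two_mul_finrank_even (imForm s δ) (v := imUnit 0) (by
    rw [imForm_apply]
    simpa [imUnit, oim, obasis, onorm_eq_obilin, obilin_coord] using hδ0)
  have h2 : Module.finrank ℝ (Module.End ℝ Oct) = 64 := by
    rw [Module.finrank_linearMap]; simp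
  rw [finrank_imOct] at h1
  have h3 : Module.finrank ℝ (CliffordAlgebra.even (imForm s δ)) =
      Module.finrank ℝ (Module.End ℝ Oct) := by omega
  exact ⟨(LinearMap.injective_iff_surjective_of_finrank_eq_finrank h3
    (f := (spinHom s δ).toLinearMap)).2 (spinHom_surjective hδ hs), spinHom_surjective hδ hs⟩

/-- The isomorphism from the even Clifford algebra to the endomorphisms. -/
def spinEquiv (hs : s ≠ 0) : CliffordAlgebra.even (imForm s δ) ≃ₐ[ℝ] Module.End ℝ Oct :=
  AlgEquiv.ofBijective (spinHom s δ) (spinHom_bijective hδ hs)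

end SpinRep


/-! ### Symmetries of the triple product -/

section Similitudes

variable (s : ℝ)

theorem omul_moufang_middle (a v y : Oct) :
    omul s (omul s a v) (omul s y a) = omul s (omul s a (omul s v y)) a := by
  ext i
  fin_cases i <;>
  simp only [Fin.zero_eta, Fin.mk_one, Fin.reduceFinMk, omul_zero_coord, omul_one_coord,
    omul_two_coord, omul_three_coord, omul_four_coord,
    omul_five_coord, omul_six_coord, omul_seven_coord] <;> ring

theorem omul_moufang_left (a y z : Oct) :
    omul s (omul s (omul s a y) a) z = omul s a (omul s y (omul s a z)) := by
  ext i
  fin_cases i <;>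
  simp only [Fin.zero_eta, Fin.mk_one, Fin.reduceFinMk, omul_zero_coord, omul_one_coord,
    omul_two_coord, omul_three_coord, omul_four_coord,
    omul_five_coord, omul_six_coord, omul_seven_coord] <;> ring

/-- `T` preserves the norm and the triple product up to the factor `ν`. -/
def IsTriSimilitude (ν : ℝ) (T : Module.End ℝ Oct) : Prop :=
  (∀ x, onorm s (T x) = ν * onorm s x) ∧
    ∀ v x u, otri s (T v) (T x) (T u) = ν • T (otri s v x u)

variable {s}

theorem IsTriSimilitude.one : IsTriSimilitude s 1 1 :=
  ⟨fun x => by simp, fun v x u => by simp⟩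

theorem IsTriSimilitude.mul {ν ν' : ℝ} {T T' : Module.End ℝ Oct} (h : IsTriSimilitude s ν T)
    (h' : IsTriSimilitude s ν' T') : IsTriSimilitude s (ν * ν') (T * T') :=
  ⟨fun x => by rw [Module.End.mul_apply, h.1, h'.1, mul_assoc], fun v x u => by
    simp only [Module.End.mul_apply, h.2, h'.2, map_smul, smul_smul]⟩

theorem IsTriSimilitude.smul {ν : ℝ} {T : Module.End ℝ Oct} (h : IsTriSimilitude s ν T) (c : ℝ) :
    IsTriSimilitude s (c ^ 2 * ν) (c • T) :=
  ⟨fun x => by rw [LinearMap.smul_apply, onorm_smul, h.1, mul_assoc], fun v x u => by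
    simp only [LinearMap.smul_apply, otri_smul_left, otri_smul_middle, otri_smul_right, h.2,
      smul_smul]
    congr 1; ring⟩

/-- With ā = −a, the middle Moufang identity gathers the first two factors as −(a(v x̄))a, the left
one moves `a` out to the front, and a(au) = −N(a)u provides the factor. -/
theorem isTriSimilitude_lmul (a : imOct) : IsTriSimilitude s (onorm s a) (lmul s a) := by
  refine ⟨fun x => by rw [lmul_apply, onorm_omul], fun v x u => ?_⟩
  have h : omul s (a : Oct) (omul s a u) = -(onorm s (a : Oct) • u) := by
    rw [← oconj_omul_omul s (a : Oct) u, imOct_oconj, neg_omul, neg_neg]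
  simp only [lmul_apply, otri, oconj_omul, imOct_oconj, omul_neg, neg_omul]
  rw [omul_moufang_middle, omul_moufang_left, h, omul_neg, omul_neg, neg_neg, omul_smul, omul_smul]

variable (s)

/-- The product of the left multiplications by the members of a list. -/
def lmulProd (l : List imOct) : Module.End ℝ Oct := (l.map (lmul s)).prod

/-- The product of the norms of the members of a list. -/
def normProd (l : List imOct) : ℝ := (l.map fun a : imOct => onorm s (a : Oct)).prod

/-- All members of the list have non-zero norm. -/
def IsAnisotropicList (l : List imOct) : Prop := ∀ a ∈ l, onorm s (a : Oct) ≠ 0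

@[simp] theorem lmulProd_nil : lmulProd s [] = 1 := rfl
@[simp] theorem lmulProd_cons (a : imOct) (l : List imOct) :
    lmulProd s (a :: l) = lmul s a * lmulProd s l := by simp [lmulProd]
@[simp] theorem normProd_nil : normProd s [] = 1 := rfl
@[simp] theorem normProd_cons (a : imOct) (l : List imOct) :
    normProd s (a :: l) = onorm s (a : Oct) * normProd s l := by simp [normProd]

variable {s}

theorem isAnisotropicList_nil : IsAnisotropicList s [] := by simp [IsAnisotropicList]

theorem isAnisotropicList_cons {a : imOct} {l : List imOct} :
    IsAnisotropicList s (a :: l) ↔ onorm s (a : Oct) ≠ 0 ∧ IsAnisotropicList s l := by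
  simp [IsAnisotropicList]

theorem IsAnisotropicList.normProd_ne_zero {l : List imOct} (h : IsAnisotropicList s l) :
    normProd s l ≠ 0 := by
  induction l with
  | nil => simp
  | cons a l ih =>
    rw [isAnisotropicList_cons] at h
    rw [normProd_cons]
    exact mul_ne_zero h.1 (ih h.2)

theorem isTriSimilitude_lmulProd (l : List imOct) :
    IsTriSimilitude s (normProd s l) (lmulProd s l) := by
  induction l with
  | nil => exact IsTriSimilitude.one
  | cons a l ih =>
    rw [lmulProd_cons, normProd_cons]
    exact (isTriSimilitude_lmul a).mul ih

/-- The reversed product is the inverse up to a factor. -/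
theorem lmulProd_reverse_mul (l : List imOct) :
    lmulProd s l.reverse * lmulProd s l = ((-1) ^ l.length * normProd s l) • 1 := by
  induction l with
  | nil => simp
  | cons a l ih =>
    have : lmulProd s (a :: l).reverse = lmulProd s l.reverse * lmul s a := by
      simp [lmulProd]
    rw [this, lmulProd_cons, mul_assoc, ← mul_assoc (lmul s a), lmul_mul_self, smul_mul_assoc,
      one_mul, mul_smul_comm, ih, smul_smul, List.length_cons, normProd_cons]
    congr 1
    ring

end Similitudes

/-! ### Reflections, Schur's lemma and products of left multiplications -/

section Reflections

variable (s : ℝ)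

/-- The reflection along an imaginary element. -/
def imRefl (v : imOct) : imOct →ₗ[ℝ] imOct :=
  LinearMap.id - ((2 / onorm s (v : Oct)) • ((obilin s v).comp imOct.subtype)).smulRight v

theorem imRefl_apply (v a : imOct) :
    imRefl s v a = a - (2 / onorm s (v : Oct) * obilin s v a) • v := rfl

variable {s}

theorem lmul_mul_lmul_add (v a : imOct) :
    lmul s v * lmul s a + lmul s a * lmul s v = (-(2 * obilin s v a)) • 1 := by
  refine LinearMap.ext fun x => ?_
  have := oconj_omul_add s v a x
  rw [imOct_oconj, imOct_oconj, neg_omul, neg_omul] at this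
  simp only [LinearMap.add_apply, Module.End.mul_apply, lmul_apply, LinearMap.smul_apply,
    Module.End.one_apply, neg_smul]
  rw [← this]; abel

/-- The Clifford relation read as a conjugation: L_v implements minus the reflection along `v`. The
sign is what the factor (−1)^length keeps account of below. -/
theorem lmul_mul_lmul {v : imOct} (hv : onorm s (v : Oct) ≠ 0) (a : imOct) :
    lmul s v * lmul s a = (-1 : ℝ) • (lmul s (imRefl s v a) * lmul s v) := by
  rw [imRefl_apply, map_sub, sub_mul, map_smul, smul_mul_assoc, lmul_mul_self, smul_smul]
  have h := lmul_mul_lmul_add (s := s) v a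
  rw [eq_sub_of_add_eq h]
  have : 2 / onorm s (v : Oct) * obilin s v a * -onorm s (v : Oct) = -(2 * obilin s v a) := by
    field_simp
  rw [this]
  module

theorem obilin_imRefl {v : imOct} (hv : onorm s (v : Oct) ≠ 0) (a b : imOct) :
    obilin s (imRefl s v a) (imRefl s v b) = obilin s (a : Oct) b := by
  simp only [imRefl_apply, Submodule.coe_sub, Submodule.coe_smul, map_sub, map_smul,
    LinearMap.sub_apply, LinearMap.smul_apply, smul_eq_mul, obilin_comm s (a : Oct) v]
  rw [← onorm_eq_obilin]
  field_simp
  ring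

theorem imRefl_of_orthogonal {v a : imOct} (h : obilin s (v : Oct) a = 0) : imRefl s v a = a := by
  rw [imRefl_apply, h]; simp

theorem imRefl_sub {u w : imOct} (h : onorm s (u : Oct) = onorm s (w : Oct))
    (hne : onorm s ((u - w : imOct) : Oct) ≠ 0) : imRefl s (u - w) u = w := by
  have h1 : 2 / onorm s ((u - w : imOct) : Oct) * obilin s ((u - w : imOct) : Oct) u = 1 := by
    field_simp
    simp only [onorm_eq_obilin, Submodule.coe_sub, map_sub, LinearMap.sub_apply,
      obilin_comm s (u : Oct) w] at h ⊢
    linear_combination h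
  rw [imRefl_apply, h1, one_smul, sub_sub_cancel]

theorem imRefl_add {u w : imOct} (h : onorm s (u : Oct) = onorm s (w : Oct))
    (hne : onorm s ((u + w : imOct) : Oct) ≠ 0) : imRefl s (u + w) u = -w := by
  have h1 : 2 / onorm s ((u + w : imOct) : Oct) * obilin s ((u + w : imOct) : Oct) u = 1 := by
    field_simp
    simp only [onorm_eq_obilin, Submodule.coe_add, map_add, LinearMap.add_apply,
      obilin_comm s (u : Oct) w] at h ⊢
    linear_combination h
  rw [imRefl_apply, h1, one_smul]
  abel

theorem imRefl_self {w : imOct} (hw : onorm s (w : Oct) ≠ 0) : imRefl s w (-w) = w := by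
  rw [imRefl_apply, Submodule.coe_neg, map_neg, ← onorm_eq_obilin]
  have : 2 / onorm s (w : Oct) * -onorm s (w : Oct) = -2 := by field_simp
  rw [this]
  module

theorem onorm_imUnit_ne_zero (hs : s ≠ 0) (i : Fin 7) : onorm s (imUnit i : Oct) ≠ 0 :=
  oeta_self_ne_zero hs i

theorem obilin_imUnit {i j : Fin 7} (h : i ≠ j) :
    obilin s (imUnit i : Oct) (imUnit j) = 0 := by
  have := oeta_eq (s := s) i j
  rwa [if_neg h] at this

/-- An orthogonal map of the imaginary elements that is implemented by conjugation with `T` can be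
undone by reflections, one basis vector after the other. -/
theorem exists_list_fixing_imUnits (hs : s ≠ 0) {T : Module.End ℝ Oct} {A : imOct →ₗ[ℝ] imOct}
    (hA : ∀ a b, obilin s (A a : Oct) (A b) = obilin s (a : Oct) b)
    (hT : ∀ a, T * lmul s a = lmul s (A a) * T) (k : ℕ) (hk : k ≤ 7) :
    ∃ (l : List imOct) (A' : imOct →ₗ[ℝ] imOct), IsAnisotropicList s l ∧
      (∀ a b, obilin s (A' a : Oct) (A' b) = obilin s (a : Oct) b) ∧
      (∀ a, lmulProd s l * T * lmul s a =
        ((-1 : ℝ) ^ l.length) • (lmul s (A' a) * (lmulProd s l * T))) ∧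
      ∀ i : Fin 7, (i : ℕ) < k → A' (imUnit i) = imUnit i := by
  induction k with
  | zero => exact ⟨[], A, isAnisotropicList_nil, hA, fun a => by simp [hT], by simp⟩
  | succ k ih =>
    obtain ⟨l, A', hl, hA', hT', hfix⟩ := ih (by omega)
    have step : ∀ v : imOct, onorm s (v : Oct) ≠ 0 → ∀ l (A' : imOct →ₗ[ℝ] imOct),
        (∀ a, lmulProd s l * T * lmul s a =
          ((-1 : ℝ) ^ l.length) • (lmul s (A' a) * (lmulProd s l * T))) →
        ∀ a, lmulProd s (v :: l) * T * lmul s a = ((-1 : ℝ) ^ (v :: l).length) •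
          (lmul s ((imRefl s v ∘ₗ A') a) * (lmulProd s (v :: l) * T)) := by
      intro v hv l A' h a
      rw [lmulProd_cons, mul_assoc, mul_assoc, ← mul_assoc (lmulProd s l), h, mul_smul_comm,
        ← mul_assoc (lmul s v), lmul_mul_lmul hv, List.length_cons, pow_succ, mul_smul,
        smul_mul_assoc, LinearMap.comp_apply]
      simp only [mul_assoc]
    let j : Fin 7 := ⟨k, by omega⟩
    set u := A' (imUnit j) with hu
    have hN : onorm s (u : Oct) = onorm s (imUnit j : Oct) := hA' _ _
    have hj := onorm_imUnit_ne_zero hs j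
    -- The units fixed so far are orthogonal to the next unit and to its image, so the new
    -- reflections do not move them.
    have horth : ∀ i : Fin 7, (i : ℕ) < k → obilin s (u : Oct) (imUnit i) = 0 ∧
        obilin s (imUnit j : Oct) (imUnit i) = 0 := by
      intro i hi
      have hji : j ≠ i := by rintro rfl; exact lt_irrefl _ hi
      refine ⟨?_, obilin_imUnit hji⟩
      rw [hu, ← hfix i hi, hA', obilin_imUnit hji]
    -- In the indefinite case u − e_j may be isotropic. Then u + e_j is not, as the two norms add up
    -- to 4N(e_j), and two reflections do the work of one.
    by_cases hne : onorm s ((u - imUnit j : imOct) : Oct) = 0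
    · have hne' : onorm s ((u + imUnit j : imOct) : Oct) ≠ 0 := by
        intro h0
        apply hj
        simp only [onorm_eq_obilin, Submodule.coe_add, Submodule.coe_sub, map_add, map_sub,
          LinearMap.add_apply, LinearMap.sub_apply] at hne h0 hN ⊢
        linarith
      refine ⟨imUnit j :: (u + imUnit j) :: l, imRefl s (imUnit j) ∘ₗ (imRefl s (u + imUnit j) ∘ₗ A'),
        ?_, fun a b => ?_, step _ hj _ _ (step _ hne' _ _ hT'), fun i hi => ?_⟩
      · exact isAnisotropicList_cons.2 ⟨hj, isAnisotropicList_cons.2 ⟨hne', hl⟩⟩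
      · simp only [LinearMap.comp_apply]
        rw [obilin_imRefl hj, obilin_imRefl hne', hA']
      · rw [LinearMap.comp_apply, LinearMap.comp_apply]
        rcases Nat.lt_succ_iff_lt_or_eq.1 hi with hi | hi
        · obtain ⟨h1, h2⟩ := horth i hi
          rw [hfix i hi, imRefl_of_orthogonal (v := u + imUnit j), imRefl_of_orthogonal h2]
          rw [Submodule.coe_add, map_add, LinearMap.add_apply, h1, h2, add_zero]
        · obtain rfl : i = j := Fin.ext hi
          rw [← hu, imRefl_add hN hne', imRefl_self hj]
    · refine ⟨(u - imUnit j) :: l, imRefl s (u - imUnit j) ∘ₗ A', ?_, fun a b => ?_,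
        step _ hne _ _ hT', fun i hi => ?_⟩
      · exact isAnisotropicList_cons.2 ⟨hne, hl⟩
      · rw [LinearMap.comp_apply, LinearMap.comp_apply, obilin_imRefl hne, hA']
      · rw [LinearMap.comp_apply]
        rcases Nat.lt_succ_iff_lt_or_eq.1 hi with hi | hi
        · obtain ⟨h1, h2⟩ := horth i hi
          rw [hfix i hi, imRefl_of_orthogonal]
          rw [Submodule.coe_sub, map_sub, LinearMap.sub_apply, h1, h2, sub_zero]
        · obtain rfl : i = j := Fin.ext hi
          rw [← hu, imRefl_sub hN hne]

theorem eq_sum_imUnit (a : imOct) : a = ∑ i : Fin 7, ((a : Oct) i.succ) • imUnit i := by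
  apply Subtype.ext
  conv_lhs => rw [eq_sum_oim (imOct_zero a)]
  simp [imUnit]

/-- Schur's lemma for the left multiplications. -/
theorem exists_eq_smul_one_of_commute (hs : s ≠ 0) {X : Module.End ℝ Oct}
    (h : ∀ a, Commute X (lmul s a)) : ∃ c : ℝ, X = c • 1 := by
  have h8 : Commute X ((8 : ℝ) • reProj) := by
    rw [reProj_eq hs]
    refine Commute.mul_right (.sub_right (.one_right _) ?_)
      (.mul_right (.sub_right (.one_right _) (.smul_right ?_ _))
        (.sub_right (.one_right _) (.smul_right ?_ _))) <;>
    exact ((h _).mul_right (h _)).mul_right (h _)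
  have hre : Commute X reProj := by
    have := h8.smul_right ((8 : ℝ)⁻¹)
    rwa [smul_smul, inv_mul_cancel₀ (by norm_num), one_smul] at this
  -- Commuting with the projection onto e₀ makes X(1) real; commuting with left multiplication by x
  -- then gives X(x) = x·X(1).
  have h0 : X (obasis 0) = (X (obasis 0) 0) • obasis 0 := by
    have := LinearMap.congr_fun hre.eq (obasis 0)
    simp only [Module.End.mul_apply, reProj_apply] at this
    simpa [obasis] using this
  refine ⟨X (obasis 0) 0, LinearMap.ext fun x => ?_⟩
  have hx : Commute X (omulB s x) := by
    obtain ⟨b, hb⟩ := omulB_eq (s := s) x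
    rw [hb]
    exact ((Commute.one_right _).smul_right _).add_right (h b)
  have := LinearMap.congr_fun hx.eq (obasis 0)
  simp only [Module.End.mul_apply, omulB_apply, omul_one] at this
  rw [this, h0, omul_smul, omul_one]
  simp [obasis]

/-- Invertible maps that normalise the imaginary left multiplications orthogonally are products of
an even number of imaginary left multiplications. -/
theorem exists_list_of_normalizes (hs : s ≠ 0) {T : Module.End ℝ Oct} (hinj : Function.Injective T)
    {A : imOct →ₗ[ℝ] imOct} (hA : ∀ a b, obilin s (A a : Oct) (A b) = obilin s (a : Oct) b)
    (hT : ∀ a, T * lmul s a = lmul s (A a) * T) :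
    ∃ (r : ℝ) (l : List imOct), r ≠ 0 ∧ IsAnisotropicList s l ∧ Even l.length ∧
      T = r • lmulProd s l := by
  obtain ⟨l, A', hl, hA', hT', hfix⟩ := exists_list_fixing_imUnits hs hA hT 7 le_rfl
  have hid : ∀ a, A' a = a := by
    intro a
    rw [eq_sum_imUnit a]
    simp only [map_sum, map_smul]
    exact Finset.sum_congr rfl fun i _ => by rw [hfix i i.2]
  simp only [hid] at hT'
  set X := lmulProd s l * T with hX
  have hd : (-1 : ℝ) ^ l.length * normProd s l ≠ 0 :=
    mul_ne_zero (pow_ne_zero _ (by norm_num)) hl.normProd_ne_zero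
  have hrev : lmulProd s l.reverse * X = ((-1 : ℝ) ^ l.length * normProd s l) • T := by
    rw [hX, ← mul_assoc, lmulProd_reverse_mul, smul_mul_assoc, one_mul]
  have hT0 : T ≠ 0 := by
    rintro rfl
    have := hinj (a₁ := obasis 0) (a₂ := 0) (by simp)
    have := congrFun this 0
    simp [obasis] at this
  have hX0 : X ≠ 0 := by
    intro h0
    rw [h0, mul_zero] at hrev
    exact hT0 ((smul_eq_zero.1 hrev.symm).resolve_left hd)
  -- Otherwise X would anticommute with seven left multiplications, hence with their product, a
  -- non-zero scalar, and X would be 0.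
  have heven : (-1 : ℝ) ^ l.length = 1 := by
    rcases neg_one_pow_eq_or ℝ l.length with h | h
    · exact h
    exfalso
    rw [h] at hT'
    have h1 : ∀ (a : imOct) (Y : Module.End ℝ Oct),
        X * (lmul s a * Y) = (-1 : ℝ) • (lmul s a * (X * Y)) := by
      intro a Y
      rw [← mul_assoc, hT', smul_mul_assoc, mul_assoc]
    have h2 := congrArg (X * ·) (lmul_units_prod s)
    simp only [mul_assoc, h1, hT', mul_smul_comm, smul_smul, mul_one] at h2
    have h3 := congrArg (· * X) (lmul_units_prod s)
    simp only [mul_assoc, smul_mul_assoc, one_mul] at h3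
    rw [h3, smul_smul] at h2
    have h4 := smul_left_injective ℝ hX0 h2
    have : s ^ 2 ≠ 0 := pow_ne_zero 2 hs
    norm_num at h4
    apply this
    linarith
  rw [heven] at hT'
  obtain ⟨c, hc⟩ := exists_eq_smul_one_of_commute hs (X := X) (fun a => by
    have := hT' a; rwa [one_smul] at this)
  have hc0 : c ≠ 0 := by
    rintro rfl
    exact hX0 (by rw [hc, zero_smul])
  rw [heven, one_mul] at hd hrev
  refine ⟨(normProd s l)⁻¹ * c, l.reverse, mul_ne_zero (inv_ne_zero hd) hc0,
    fun a ha => hl a (List.mem_reverse.1 ha), ?_, ?_⟩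
  · rw [List.length_reverse]
    exact (neg_one_pow_eq_one_iff_even (by norm_num)).1 heven
  · rw [hc, mul_smul_comm, mul_one] at hrev
    rw [mul_smul, hrev, inv_smul_smul₀ hd]

end Reflections


/-! ### The symmetry group of the triple product is the spin group -/

section SpinLists

open CliffordAlgebra

variable {s δ : ℝ}

/-- The product of the members of a list in the Clifford algebra. -/
def iotaProd (s δ : ℝ) (l : List imOct) : CliffordAlgebra (imForm s δ) :=
  (l.map (ι (imForm s δ))).prod

@[simp] theorem iotaProd_nil : iotaProd s δ [] = 1 := rfl
@[simp] theorem iotaProd_cons (a : imOct) (l : List imOct) :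
    iotaProd s δ (a :: l) = ι (imForm s δ) a * iotaProd s δ l := by simp [iotaProd]
theorem iotaProd_append (l l' : List imOct) :
    iotaProd s δ (l ++ l') = iotaProd s δ l * iotaProd s δ l' := by simp [iotaProd]

theorem iotaProd_mem_evenOdd (l : List imOct) :
    iotaProd s δ l ∈ evenOdd (imForm s δ) (l.length : ZMod 2) := by
  induction l with
  | nil =>
    rw [List.length_nil, Nat.cast_zero]
    exact Submodule.one_le.1 (one_le_evenOdd_zero _)
  | cons a l ih =>
    rw [iotaProd_cons, List.length_cons, Nat.cast_succ, add_comm]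
    exact evenOdd_mul_le _ _ _ (Submodule.mul_mem_mul (ι_mem_evenOdd_one _ a) ih)

theorem iotaProd_mem_even {l : List imOct} (hl : Even l.length) :
    iotaProd s δ l ∈ even (imForm s δ) := by
  have := iotaProd_mem_evenOdd (s := s) (δ := δ) l
  rwa [(ZMod.natCast_eq_zero_iff_even).2 hl] at this

theorem spinHom_iotaProd (n : ℕ) (l : List imOct) (hl : l.length = 2 * n)
    (h : iotaProd s δ l ∈ even (imForm s δ)) :
    spinHom s δ ⟨iotaProd s δ l, h⟩ = ((-δ) ^ n) • lmulProd s l := by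
  induction n generalizing l with
  | zero =>
    obtain rfl := List.length_eq_zero_iff.1 hl
    rw [pow_zero, one_smul, lmulProd_nil]
    exact map_one (spinHom s δ)
  | succ n ih =>
    match l, hl with
    | a :: b :: l, hl =>
      have hl' : l.length = 2 * n := by simp at hl; omega
      have h' : iotaProd s δ l ∈ even (imForm s δ) :=
        iotaProd_mem_even (by rw [hl']; exact even_two_mul n)
      have hab : ι (imForm s δ) a * ι (imForm s δ) b ∈ even (imForm s δ) :=
        ι_mul_ι_mem_evenOdd_zero _ a b
      have e : (⟨iotaProd s δ (a :: b :: l), h⟩ : even (imForm s δ)) =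
          ⟨ι _ a * ι _ b, hab⟩ * ⟨iotaProd s δ l, h'⟩ := by
        apply Subtype.ext
        change iotaProd s δ (a :: b :: l) = ι _ a * ι _ b * iotaProd s δ l
        rw [iotaProd_cons, iotaProd_cons, mul_assoc]
      rw [e, map_mul, spinHom_ι_mul_ι, ih l hl' h', smul_mul_smul_comm, lmulProd_cons,
        lmulProd_cons, pow_succ', mul_assoc]

/-- The star is Clifford conjugation, so it changes the sign of a vector, and each factor
contributes −δN(a). -/
theorem star_iotaProd_mul (l : List imOct) :
    star (iotaProd s δ l) * iotaProd s δ l =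
      algebraMap ℝ _ ((-δ) ^ l.length * normProd s l) := by
  induction l with
  | nil => simp
  | cons a l ih =>
    rw [iotaProd_cons, star_mul, star_ι, mul_assoc, ← mul_assoc (-ι _ a), neg_mul, ι_sq_scalar,
      ← map_neg, ← mul_assoc, ← Algebra.commutes, mul_assoc, ih, ← map_mul, imForm_apply,
      List.length_cons, normProd_cons]
    congr 1
    ring

theorem exists_mem_lipschitzGroup (hδ : δ ≠ 0) {l : List imOct} (hl : IsAnisotropicList s l) :
    ∃ u ∈ lipschitzGroup (imForm s δ), (u : CliffordAlgebra (imForm s δ)) = iotaProd s δ l := by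
  induction l with
  | nil => exact ⟨1, one_mem _, rfl⟩
  | cons a l ih =>
    obtain ⟨ha, hl⟩ := isAnisotropicList_cons.1 hl
    obtain ⟨u, hu, hul⟩ := ih hl
    have : Invertible (imForm s δ a) := invertibleOfNonzero (mul_ne_zero hδ ha)
    let := invertibleιOfInvertible (imForm s δ) a
    refine ⟨unitOfInvertible (ι (imForm s δ) a) * u,
      mul_mem (Subgroup.subset_closure ⟨a, rfl⟩) hu, ?_⟩
    rw [Units.val_mul, hul, iotaProd_cons]
    rfl

theorem exists_list_of_mem_lipschitzGroup (hδ : δ ≠ 0) {u : (CliffordAlgebra (imForm s δ))ˣ}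
    (hu : u ∈ lipschitzGroup (imForm s δ)) :
    ∃ l : List imOct, IsAnisotropicList s l ∧ (u : CliffordAlgebra (imForm s δ)) = iotaProd s δ l := by
  have hne : ∀ (v : (CliffordAlgebra (imForm s δ))ˣ) (a : imOct),
      ι (imForm s δ) a = v → onorm s (a : Oct) ≠ 0 := by
    intro v a ha h0
    have h := ι_sq_scalar (imForm s δ) a
    rw [imForm_apply, h0, mul_zero, map_zero, ha, ← Units.val_mul] at h
    exact (v * v).ne_zero h
  unfold lipschitzGroup at hu
  induction hu using Subgroup.closure_induction'' with
  | one => exact ⟨[], isAnisotropicList_nil, rfl⟩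
  | mem x hx =>
    obtain ⟨a, ha⟩ := hx
    exact ⟨[a], isAnisotropicList_cons.2 ⟨hne x a ha, isAnisotropicList_nil⟩, by simp [ha]⟩
  | inv_mem x hx =>
    obtain ⟨a, ha⟩ := hx
    have ha0 := hne x a ha
    have hc : δ * onorm s (a : Oct) ≠ 0 := mul_ne_zero hδ ha0
    -- The inverse of a vector in the Clifford algebra is again a vector, divided by its value
    -- δN(a).
    refine ⟨[(δ * onorm s (a : Oct))⁻¹ • a], isAnisotropicList_cons.2 ⟨?_, isAnisotropicList_nil⟩, ?_⟩
    · rw [Submodule.coe_smul, onorm_smul]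
      exact mul_ne_zero (pow_ne_zero _ (inv_ne_zero hc)) ha0
    · rw [iotaProd_cons, iotaProd_nil, mul_one, map_smul, Units.inv_eq_of_mul_eq_one_right]
      rw [← ha, mul_smul_comm, ι_sq_scalar, imForm_apply,
        Algebra.algebraMap_eq_smul_one, smul_smul, inv_mul_cancel₀ hc, one_smul]
  | mul x y _ _ hx hy =>
    obtain ⟨l, hl, hlx⟩ := hx
    obtain ⟨l', hl', hly⟩ := hy
    refine ⟨l ++ l', fun a ha => ?_, by rw [Units.val_mul, hlx, hly, iotaProd_append]⟩
    rcases List.mem_append.1 ha with h | h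
    · exact hl a h
    · exact hl' a h

variable (hδ : δ ^ 2 = 1)
include hδ

theorem neg_pow_even {n : ℕ} (hn : Even n) : (-δ) ^ n = 1 := by
  obtain ⟨k, rfl⟩ := hn
  rw [← two_mul, pow_mul, neg_sq, hδ, one_pow]

/-- For even length the signs −δ cancel, and unitarity is exactly the condition that the product of
the norms is 1. -/
theorem iotaProd_mem_spinGroup {l : List imOct} (hl : IsAnisotropicList s l)
    (heven : Even l.length) (h1 : normProd s l = 1) : iotaProd s δ l ∈ spinGroup (imForm s δ) := by
  have hδ0 : δ ≠ 0 := by rintro rfl; norm_num at hδ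
  obtain ⟨u, hu, hul⟩ := exists_mem_lipschitzGroup hδ0 hl
  have hstar : star (u : CliffordAlgebra (imForm s δ)) * u = 1 := by
    rw [hul, star_iotaProd_mul, neg_pow_even hδ heven, h1, mul_one, map_one]
  refine spinGroup.mem_iff.2 ⟨?_, iotaProd_mem_even heven⟩
  rw [← hul]
  refine pinGroup.units_mem_iff.2 ⟨hu, Unitary.mem_iff.2 ⟨hstar, ?_⟩⟩
  rw [← Units.inv_eq_of_mul_eq_one_left hstar, Units.mul_inv]

theorem exists_list_of_mem_spinGroup {g : CliffordAlgebra (imForm s δ)}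
    (hg : g ∈ spinGroup (imForm s δ)) :
    ∃ l : List imOct, Even l.length ∧ normProd s l = 1 ∧ g = iotaProd s δ l := by
  have hδ0 : δ ≠ 0 := by rintro rfl; norm_num at hδ
  obtain ⟨hpin, heven⟩ := spinGroup.mem_iff.1 hg
  obtain ⟨u, hu, rfl⟩ := pinGroup.mem_lipschitzGroup hpin
  obtain ⟨l, hl, hul⟩ := exists_list_of_mem_lipschitzGroup hδ0 hu
  -- An odd product would lie in both graded parts and vanish.
  have hle : Even l.length := by
    by_contra hodd
    have h1 := iotaProd_mem_evenOdd (s := s) (δ := δ) l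
    rw [(ZMod.natCast_eq_one_iff_odd).2 (Nat.not_even_iff_odd.1 hodd), ← hul] at h1
    have := (evenOdd_isCompl (imForm s δ)).disjoint.le_bot ⟨heven, h1⟩
    exact u.ne_zero this
  refine ⟨l, hle, ?_, hul⟩
  have h := pinGroup.star_mul_self_of_mem hpin
  have hul' : (Units.coeHom (CliffordAlgebra (imForm s δ))) u = iotaProd s δ l := hul
  rw [hul', star_iotaProd_mul, neg_pow_even hδ hle, one_mul, ← map_one (algebraMap ℝ _)] at h
  exact (algebraMap ℝ (CliffordAlgebra (imForm s δ))).injective h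

end SpinLists

/-! ### The group preserving norm and triple product -/

section TriGroup

variable (s : ℝ)

/-- The group of linear automorphisms that preserve the norm and the triple product. -/
def triGroup : Subgroup (Oct ≃ₗ[ℝ] Oct) where
  carrier := {T | IsTriSimilitude s 1 (T : Oct →ₗ[ℝ] Oct)}
  mul_mem' := by
    intro T T' h h'
    have := IsTriSimilitude.mul h h'
    rw [one_mul] at this
    exact this
  one_mem' := IsTriSimilitude.one
  inv_mem' := by
    intro T h
    have key : ∀ x, T (T⁻¹ x) = x := fun x => T.apply_symm_apply x
    have h2 : ∀ v x u, otri s (T v) (T x) (T u) = T (otri s v x u) := fun v x u => by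
      have := h.2 v x u
      rwa [one_smul] at this
    refine ⟨fun x => ?_, fun v x u => T.injective ?_⟩
    · have : onorm s (T (T⁻¹ x)) = 1 * onorm s (T⁻¹ x) := h.1 (T⁻¹ x)
      rw [key, one_mul] at this
      rw [one_mul, this]
      rfl
    · rw [one_smul, ← h2]
      change otri s (T (T⁻¹ v)) (T (T⁻¹ x)) (T (T⁻¹ u)) = T (T⁻¹ _)
      simp only [key]

variable {s}

theorem mem_triGroup {T : Oct ≃ₗ[ℝ] Oct} : T ∈ triGroup s ↔
    (∀ x, onorm s (T x) = onorm s x) ∧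
      ∀ v x u, otri s (T v) (T x) (T u) = T (otri s v x u) := by
  constructor
  · rintro ⟨h1, h2⟩
    exact ⟨fun x => by simpa using h1 x, fun v x u => by simpa using h2 v x u⟩
  · rintro ⟨h1, h2⟩
    exact ⟨fun x => by simpa using h1 x, fun v x u => by simpa using h2 v x u⟩

theorem obilin_of_onorm {T : Oct → Oct} (hadd : ∀ x y, T (x + y) = T x + T y)
    (h : ∀ x, onorm s (T x) = onorm s x) (x y : Oct) :
    obilin s (T x) (T y) = obilin s x y := by
  have h1 := h (x + y)
  rw [hadd, onorm_add, onorm_add, h, h] at h1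
  linarith

theorem injective_of_onorm (hs : s ≠ 0) {T : Module.End ℝ Oct}
    (h : ∀ x, onorm s (T x) = onorm s x) : Function.Injective T := by
  rw [← LinearMap.ker_eq_bot, LinearMap.ker_eq_bot']
  intro x hx
  refine obilin_nondegenerate hs fun y => ?_
  rw [← obilin_of_onorm (map_add T) h, hx]
  simp

/-- A similitude with factor one as an element of the group. -/
theorem IsTriSimilitude.exists_mem_triGroup (hs : s ≠ 0) {T : Module.End ℝ Oct}
    (h : IsTriSimilitude s 1 T) :
    ∃ T' ∈ triGroup s, ((T' : Oct ≃ₗ[ℝ] Oct) : Oct →ₗ[ℝ] Oct) = T := by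
  have hinj := injective_of_onorm hs (T := T) (fun x => by simpa using h.1 x)
  have e : ((LinearEquiv.ofInjectiveEndo T hinj : Oct ≃ₗ[ℝ] Oct) : Oct →ₗ[ℝ] Oct) = T := by
    ext1 i; rfl
  refine ⟨LinearEquiv.ofInjectiveEndo T hinj, ?_, e⟩
  change IsTriSimilitude s 1 _
  rw [e]
  exact h

/-- Preserving (v x̄)u with x = 1 means T(au) = A(a)T(u), where A(a) = T(a)·conj(T(1)) is imaginary
and orthogonal in `a`. So `T` normalises the left multiplications and `exists_list_of_normalizes`
applies; an extra pair of vectors absorbs the remaining scalar. -/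
theorem exists_list_of_mem_triGroup (hs : s ≠ 0) {δ : ℝ} (hδ : δ ^ 2 = 1) {T : Oct ≃ₗ[ℝ] Oct}
    (hT : T ∈ triGroup s) : ∃ (n : ℕ) (l : List imOct), l.length = 2 * n ∧ IsAnisotropicList s l ∧
      normProd s l = 1 ∧ (T : Oct →ₗ[ℝ] Oct) = ((-δ) ^ n) • lmulProd s l := by
  obtain ⟨hN, ht⟩ := mem_triGroup.1 hT
  have hB := obilin_of_onorm (map_add T) hN
  let f : imOct →ₗ[ℝ] Oct :=
    ((omulB s).flip (oconj (T (obasis 0)))) ∘ₗ ((T : Oct →ₗ[ℝ] Oct) ∘ₗ imOct.subtype)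
  have hf : ∀ a, f a ∈ imOct := by
    intro a
    rw [mem_imOct]
    change obilin s (T a) (T (obasis 0)) = 0
    rw [hB, obilin_comm, obilin_one, imOct_zero]
  let A : imOct →ₗ[ℝ] imOct := f.codRestrict imOct hf
  have hAa : ∀ a, (A a : Oct) = omul s (T a) (oconj (T (obasis 0))) := fun a => rfl
  obtain ⟨r, l, hr, hl, heven, hTl⟩ := exists_list_of_normalizes hs (T := (T : Oct →ₗ[ℝ] Oct))
    T.injective (A := A)
    (fun a b => by
      rw [hAa, hAa, obilin_omul_omul_right, onorm_oconj, hN, onorm_one, one_mul, hB])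
    (fun a => LinearMap.ext fun x => by
      have := ht a (obasis 0) x
      rw [otri, otri, oconj_one, omul_one] at this
      exact this.symm)
  obtain ⟨m, hm⟩ := heven
  have hsq : ((-δ) ^ (m + 1)) * ((-δ) ^ (m + 1)) = 1 := by
    rw [← mul_pow, neg_mul_neg, ← pow_two, hδ, one_pow]
  -- Chosen so that the prefactor (−δ)^(m+1), times the product −c of the left multiplications by c
  -- e₁ and e₁, equals `r`.
  set c : ℝ := -(r * (-δ) ^ (m + 1)) with hc
  have hc0 : c ≠ 0 := by
    refine neg_ne_zero.2 (mul_ne_zero hr ?_)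
    intro h0
    rw [h0, mul_zero] at hsq
    exact zero_ne_one hsq
  have h0 := onorm_imUnit_ne_zero hs 0
  have hn1 : onorm s (imUnit 0 : Oct) = 1 := by
    simp [imUnit, oim, obasis, onorm_eq_obilin, obilin_coord]
  have hTl2 : (T : Oct →ₗ[ℝ] Oct) =
      ((-δ) ^ (m + 1)) • lmulProd s ((c • imUnit 0) :: imUnit 0 :: l) := by
    rw [lmulProd_cons, lmulProd_cons, map_smul, smul_mul_assoc, ← mul_assoc, lmul_mul_self, hn1,
      smul_mul_assoc, one_mul, smul_smul, smul_smul, hTl, hc]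
    congr 1
    linear_combination -r * hsq
  refine ⟨m + 1, (c • imUnit 0) :: imUnit 0 :: l, ?_, ?_, ?_, hTl2⟩
  · simp only [List.length_cons]; omega
  · refine isAnisotropicList_cons.2 ⟨?_, isAnisotropicList_cons.2 ⟨h0, hl⟩⟩
    rw [Submodule.coe_smul, onorm_smul]
    exact mul_ne_zero (pow_ne_zero 2 hc0) h0
  -- The value of the norm product is forced: compare N(T 1) = 1 with the similitude factor of the
  -- product.
  · have h1 := ((isTriSimilitude_lmulProd (s := s) ((c • imUnit 0) :: imUnit 0 :: l)).smul
      ((-δ) ^ (m + 1))).1 (obasis 0)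
    rw [← hTl2, LinearEquiv.coe_coe, hN, onorm_one, pow_two, hsq, one_mul, mul_one] at h1
    exact h1.symm

end TriGroup

/-! ### The image of the spin group -/

section SpinRepresentation

variable {s δ : ℝ}

/-- The spin representation of the spin group. -/
def spinRep (s δ : ℝ) : spinGroup (imForm s δ) →* (Oct ≃ₗ[ℝ] Oct) :=
  (LinearMap.GeneralLinearGroup.generalLinearEquiv ℝ Oct).toMonoidHom.comp
    (MonoidHom.toHomUnits ((spinHom s δ : _ →* Module.End ℝ Oct).comp
      { toFun := fun g : spinGroup (imForm s δ) =>
          (⟨(g : CliffordAlgebra (imForm s δ)), spinGroup.mem_even g.2⟩ :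
            CliffordAlgebra.even (imForm s δ))
        map_one' := rfl
        map_mul' := fun _ _ => rfl }))

theorem spinRep_coe (g : spinGroup (imForm s δ)) :
    (spinRep s δ g : Oct →ₗ[ℝ] Oct) =
      spinHom s δ ⟨(g : CliffordAlgebra (imForm s δ)), spinGroup.mem_even g.2⟩ := rfl

variable (hs : s ≠ 0) (hδ : δ ^ 2 = 1)
include hs hδ

theorem spinRep_injective : Function.Injective (spinRep s δ) := by
  intro g g' h
  have h1 : (spinRep s δ g : Oct →ₗ[ℝ] Oct) = spinRep s δ g' := by rw [h]
  rw [spinRep_coe, spinRep_coe] at h1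
  have := (spinHom_bijective hδ hs).1 h1
  exact Subtype.ext (congrArg (fun z : CliffordAlgebra.even (imForm s δ) => z.1) this)

/-- Both groups consist of the maps (−δ)ⁿ L_{a₁}⋯L_{a₂ₙ} whose norms multiply to 1. -/
theorem mem_range_spinRep {T : Oct ≃ₗ[ℝ] Oct} : T ∈ (spinRep s δ).range ↔ T ∈ triGroup s := by
  constructor
  · rintro ⟨g, rfl⟩
    obtain ⟨l, ⟨n, hn⟩, h1, hg⟩ := exists_list_of_mem_spinGroup hδ g.2
    change IsTriSimilitude s 1 _
    have e : (⟨(g : CliffordAlgebra (imForm s δ)), spinGroup.mem_even g.2⟩ :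
        CliffordAlgebra.even (imForm s δ)) = ⟨iotaProd s δ l, iotaProd_mem_even ⟨n, hn⟩⟩ :=
      Subtype.ext hg
    rw [spinRep_coe, e, spinHom_iotaProd n l (by omega)]
    have := (isTriSimilitude_lmulProd (s := s) l).smul ((-δ) ^ n)
    rwa [h1, mul_one, ← pow_mul, neg_pow_even hδ (by simp)] at this
  · intro hT
    obtain ⟨n, l, hn, hl, h1, hTl⟩ := exists_list_of_mem_triGroup hs hδ hT
    have heven : Even l.length := by rw [hn]; exact even_two_mul n
    refine ⟨⟨iotaProd s δ l, iotaProd_mem_spinGroup hδ hl heven h1⟩, ?_⟩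
    apply LinearEquiv.toLinearMap_injective
    rw [spinRep_coe, hTl]
    exact spinHom_iotaProd n l hn (iotaProd_mem_even heven)

end SpinRepresentation


/-! ### Automorphisms, and symmetries of the torsion -/

section Symmetries

variable {s : ℝ}

theorem omul_self (x : Oct) : omul s x x = (2 * x 0) • x - onorm s x • obasis 0 := by
  have h := omul_oconj s x
  rw [oconj_eq, omul_sub, omul_smul, omul_one] at h
  rw [← h]; abel

/-- The automorphism group is the stabiliser of the unit in the symmetry group of the triple
product. -/
theorem mem_autOct_iff {g : Oct ≃ₗ[ℝ] Oct} :
    g ∈ autOct s ↔ g ∈ triGroup s ∧ g (obasis 0) = obasis 0 := by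
  constructor
  · intro (h : ∀ x y, g (omul s x y) = omul s (g x) (g y))
    have h1 : g (obasis 0) = obasis 0 := by
      have := h (obasis 0) (g.symm (obasis 0))
      rw [one_omul, g.apply_symm_apply, omul_one] at this
      exact this.symm
    have hre : ∀ x, g x 0 = x 0 ∧ onorm s (g x) = onorm s x := by
      intro x
      have h2 := h x x
      rw [omul_self, omul_self, map_sub, map_smul, map_smul, h1] at h2
      -- Both g(x)² and g(x²) satisfy quadratic equations; their difference makes g(x) real unless
      -- `g` preserves the real part of `x`, and real elements are fixed anyway.
      have h3 : (2 * (g x 0 - x 0)) • g x = (onorm s (g x) - onorm s x) • obasis 0 := by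
        rw [mul_sub, sub_smul, sub_smul, sub_eq_sub_iff_add_eq_add]
        rw [sub_eq_sub_iff_add_eq_add] at h2
        rw [← h2]; abel
      have h4 : g x 0 = x 0 := by
        by_contra hne
        have hne' : 2 * (g x 0 - x 0) ≠ 0 := mul_ne_zero two_ne_zero (sub_ne_zero.2 hne)
        obtain ⟨c, hc⟩ : ∃ c : ℝ, g x = c • obasis 0 :=
          ⟨(2 * (g x 0 - x 0))⁻¹ * (onorm s (g x) - onorm s x), by
            rw [mul_smul, ← h3, inv_smul_smul₀ hne']⟩
        have hx : x = c • obasis 0 := g.injective (by rw [hc, map_smul, h1])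
        rw [hc, hx] at hne
        exact hne rfl
      refine ⟨h4, ?_⟩
      rw [h4, sub_self, mul_zero, zero_smul] at h3
      have := congrFun h3 0
      simp [obasis] at this
      linarith
    refine ⟨mem_triGroup.2 ⟨fun x => (hre x).2, fun v x u => ?_⟩, h1⟩
    have hconj : oconj (g x) = g (oconj x) := by
      rw [oconj_eq, oconj_eq, (hre x).1, map_sub, map_smul, h1]
    rw [otri, otri, hconj, h, h]
  · rintro ⟨h, h1⟩ x y
    have := (mem_triGroup.1 h).2 x (obasis 0) y
    rw [h1, otri, otri, oconj_one, omul_one, omul_one] at this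
    exact this.symm

/-- A linear isometry that preserves the triple product on orthogonal elements, with a unit in the
middle, preserves the triple product. -/
theorem otri_map_of_orthogonal {U : Oct ≃ₗ[ℝ] Oct} (hN : ∀ x, onorm s (U x) = onorm s x)
    (h : ∀ y a b, onorm s y = 1 → obilin s y a = 0 → obilin s y b = 0 →
      otri s (U a) (U y) (U b) = U (otri s a y b)) (v x u : Oct) :
    otri s (U v) (U x) (U u) = U (otri s v x u) := by
  have h1 : ∀ y, onorm s y = 1 → ∀ v u, otri s (U v) (U y) (U u) = U (otri s v y u) := by
    intro y hy v u
    have hdec : ∀ w, ∃ a, ∃ c : ℝ, obilin s y a = 0 ∧ w = a + c • y := fun w =>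
      ⟨w - obilin s y w • y, obilin s y w, by
        rw [map_sub, map_smul, ← onorm_eq_obilin, hy, smul_eq_mul, mul_one, sub_self], by abel⟩
    obtain ⟨a, c, ha, rfl⟩ := hdec v
    obtain ⟨b, d, hb, rfl⟩ := hdec u
    have key := h y a b hy ha hb
    simp only [map_add, map_smul, otri_add_left, otri_add_right, otri_smul_left, otri_smul_right,
      key, otri_self_left, otri_self_right, hN, hy]
  -- Unit norm is relaxed to positive norm by scaling the middle argument, which enters linearly.
  have h2 : ∀ y, 0 < onorm s y → ∀ v u, otri s (U v) (U y) (U u) = U (otri s v y u) := by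
    intro y hy v u
    have hr : √(onorm s y) ≠ 0 := (Real.sqrt_pos.2 hy).ne'
    have hy1 : y = √(onorm s y) • ((√(onorm s y))⁻¹ • y) := (smul_inv_smul₀ hr y).symm
    have := h1 ((√(onorm s y))⁻¹ • y) (by
      rw [onorm_smul, inv_pow, Real.sq_sqrt hy.le, inv_mul_cancel₀ hy.ne']) v u
    rw [hy1, map_smul, otri_smul_middle, otri_smul_middle, this, map_smul]
  -- Large enough for x + c·1 to have positive norm. The identity holds for x + c·1 and for 1, hence
  -- for `x` by linearity in the middle slot.
  set c : ℝ := 1 + |onorm s x| + 2 * |x 0| with hc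
  have hpos : 0 < onorm s (x + c • obasis 0) := by
    rw [onorm_add, onorm_smul, onorm_one, map_smul, obilin_comm, obilin_one, smul_eq_mul]
    have e1 := neg_abs_le (onorm s x)
    have e2 := neg_abs_le (x 0)
    have e3 := abs_nonneg (onorm s x)
    have e4 := abs_nonneg (x 0)
    nlinarith [mul_nonneg e3 e4, mul_nonneg e3 e3, mul_nonneg e4 (by linarith : 0 ≤ x 0 + |x 0|),
      mul_nonneg e3 (by linarith : 0 ≤ x 0 + |x 0|)]
  have h3 := h2 _ hpos v u
  have h4 := h1 (obasis 0) (onorm_one s) v u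
  rw [map_add, map_smul, otri_add_middle, otri_add_middle, otri_smul_middle, otri_smul_middle, h4,
    map_add, map_smul] at h3
  exact add_right_cancel h3

theorem torsionAt_contorsion (S : Oct ≃ₗ[ℝ] Oct) (x u v : Oct) :
    torsionAt (contorsion s S) x u v =
      S.symm (otri s (S u) (S x) (S v) - otri s (S v) (S x) (S u)) := by
  rw [torsionAt, contorsion_swap s S x v u, contorsion_apply, sub_neg_eq_add, ← add_smul]
  norm_num

variable {S : Oct ≃ₗ[ℝ] Oct} {δ γ : ℝ} (hS : IsUnitChart s S δ γ) (hδ : δ ^ 2 = 1) (hγ : γ ≠ 0)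
include hS hδ hγ

theorem IsUnitChart.symm_mem {y : Oct} (hy : onorm s y = 1) :
    S.symm y ∈ pseudoSphere s δ γ := by
  have := hS (S.symm y)
  rw [S.apply_symm_apply, hy] at this
  rw [mem_pseudoSphere]
  field_simp at this
  linear_combination -δ * this - onorm s (S.symm y) * hδ

theorem IsUnitChart.obilin_eq_zero_iff {x y : Oct} :
    _root_.obilin s (S x) (S y) = 0 ↔ _root_.obilin s x y = 0 := by
  have hδ0 : δ ≠ 0 := by rintro rfl; norm_num at hδ
  rw [hS.obilin, mul_eq_zero, or_iff_right (by positivity)]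

/-- The symmetries of the torsion. -/
theorem isTorsionSymmetry_iff {T : Oct ≃ₗ[ℝ] Oct} :
    IsTorsionSymmetry s δ γ (contorsion s S) T ↔ S * T * S⁻¹ ∈ triGroup s := by
  have hδ0 : δ ≠ 0 := by rintro rfl; norm_num at hδ
  have hU : ∀ x, (S * T * S⁻¹) x = S (T (S.symm x)) := fun _ => rfl
  have hN : IsNormIsometry s T ↔ ∀ x, onorm s ((S * T * S⁻¹) x) = onorm s x := by
    constructor
    · intro h x
      rw [hU, hS, h, ← hS, S.apply_symm_apply]
    · intro h x
      have := h (S x)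
      rw [hU, S.symm_apply_apply, hS, hS] at this
      exact mul_left_cancel₀ (by positivity) this
  rw [mem_triGroup, IsTorsionSymmetry, hN]
  refine and_congr_right fun hN => ?_
  have hB := obilin_of_onorm (map_add (S * T * S⁻¹)) hN
  have hST : ∀ x, S (T x) = (S * T * S⁻¹) (S x) := fun x => by rw [hU, S.symm_apply_apply]
  have hTS : ∀ x, T (S.symm x) = S.symm ((S * T * S⁻¹) x) := fun x => by
    rw [hU, S.symm_apply_apply]
  constructor
  · intro h
    refine otri_map_of_orthogonal hN fun y a b hy ha hb => ?_
    have hmem := hS.symm_mem hδ hγ hy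
    have h1 := h _ hmem (S.symm a)
      ((hS.obilin_eq_zero_iff hδ hγ).1 (by simpa only [S.apply_symm_apply] using ha)) (S.symm b)
      ((hS.obilin_eq_zero_iff hδ hγ).1 (by simpa only [S.apply_symm_apply] using hb))
    simp only [torsionAt_contorsion, S.apply_symm_apply, hTS] at h1
    have h2 := S.symm.injective h1
    -- For vectors orthogonal to `y` the antisymmetrised product is twice the triple product plus a
    -- multiple of `y` given by the metric, which every isometry preserves.
    have hdiff : ∀ y a b, obilin s y a = 0 → obilin s y b = 0 →
        otri s a y b - otri s b y a = (2 : ℝ) • otri s a y b + (2 * obilin s a b) • y := by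
      intro y a b ha hb
      rw [otri_swap_outer s b y a, ha, obilin_comm s b y, hb, obilin_comm s b a]
      module
    rw [hdiff y a b ha hb, hdiff _ _ _ (by rw [hB, ha]) (by rw [hB, hb]), hB, map_add, map_smul,
      map_smul] at h2
    exact smul_right_injective Oct (two_ne_zero' ℝ) (add_right_cancel h2)
  · intro h x _ u _ v _
    rw [torsionAt_contorsion, torsionAt_contorsion, hTS]
    simp only [hST, h, map_sub]

end Symmetries

/-! ### Transitivity and local sections -/

section Transitivity

variable {s : ℝ}

/-- The product of the left multiplications by `x b` and `b`, normalised. -/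
def transvection (s : ℝ) (x b : Oct) : Module.End ℝ Oct :=
  (-(onorm s b)⁻¹) • (omulB s (omul s x b) * omulB s b)

theorem transvection_apply (x b v : Oct) : transvection s x b v =
    (-(onorm s b)⁻¹) • omul s (omul s x b) (omul s b v) := rfl

/-- Orthogonality of `x` and the imaginary `b` makes xb imaginary as well, so the map is a product
of two imaginary left multiplications; the normalisation makes the similitude factor 1. -/
theorem isTriSimilitude_transvection {x b : Oct} (hb : b 0 = 0) (hN : onorm s b ≠ 0)
    (hxb : obilin s x b = 0) (hx : onorm s x = 1) : IsTriSimilitude s 1 (transvection s x b) := by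
  have hxb0 : omul s x b 0 = 0 := by
    rw [← obilin_one s (omul s x b), obilin_comm, obilin_omul_right, one_omul, oconj_eq_neg hb, map_neg, hxb,
      neg_zero]
  have := ((isTriSimilitude_lmul (s := s) ⟨omul s x b, mem_imOct.2 hxb0⟩).mul
    (isTriSimilitude_lmul (s := s) ⟨b, mem_imOct.2 hb⟩)).smul (-(onorm s b)⁻¹)
  have e : (-(onorm s b)⁻¹) ^ 2 * (onorm s (omul s x b) * onorm s b) = 1 := by
    rw [onorm_omul, hx]; field_simp
  rwa [e] at this

theorem transvection_one {x b : Oct} (hb : b 0 = 0) (hN : onorm s b ≠ 0) :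
    transvection s x b (obasis 0) = x := by
  have h := omul_omul_oconj s b x
  rw [oconj_eq_neg hb, omul_neg] at h
  rw [transvection_apply, omul_one, neg_smul, ← smul_neg, h, inv_smul_smul₀ hN]

/-- An imaginary element orthogonal to `x`. -/
def orthIm : Oct →ₗ[ℝ] Oct :=
  (LinearMap.proj 1).smulRight (obasis 2) - (LinearMap.proj 2).smulRight (obasis 1)

theorem orthIm_apply (x : Oct) : orthIm x = x 1 • obasis 2 - x 2 • obasis 1 := rfl

theorem orthIm_zero (x : Oct) : orthIm x 0 = 0 := by simp [orthIm_apply, obasis]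

/-- Only e₁ and e₂ are involved, so this is non-negative for every `s`; it vanishes at 1 but not
near e₁. -/
theorem onorm_orthIm (x : Oct) : onorm s (orthIm x) = x 1 ^ 2 + x 2 ^ 2 := by
  simp [orthIm_apply, onorm_eq_obilin, obilin_coord, obasis]; ring

theorem obilin_orthIm (x : Oct) : obilin s x (orthIm x) = 0 := by
  simp [orthIm_apply, obilin_coord, obasis]; ring

theorem contDiffOn_transvection_orthIm (v : Oct) :
    ContDiffOn ℝ ∞ (fun x => transvection s x (orthIm x) v) {x | onorm s (orthIm x) ≠ 0} := by
  have hL : ContDiff ℝ ∞ orthIm := (LinearMap.toContinuousLinearMap orthIm).contDiff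
  have hN : ContDiffOn ℝ ∞ (fun x => onorm s (orthIm x)) {x | onorm s (orthIm x) ≠ 0} := by
    simp only [onorm_orthIm]
    have h (i : Fin 8) : ContDiff ℝ ∞ (fun x : Oct => x i) := contDiff_apply ℝ ℝ i
    exact (((h 1).pow 2).add ((h 2).pow 2)).contDiffOn
  simp only [transvection_apply]
  refine (hN.inv fun x hx => hx).neg.smul ?_
  exact ContDiffOn.bilin (omulB s) (ContDiffOn.bilin (omulB s) contDiffOn_id hL.contDiffOn)
    ((LinearMap.toContinuousLinearMap ((omulB s).flip v)).contDiff.comp hL).contDiffOn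

variable (hs : s ≠ 0)
include hs

/-- If the vector `orthIm x` is isotropic, then x₁ = 0 and e₁ can serve as `b` instead. -/
theorem exists_mem_triGroup_one {x : Oct} (hx : onorm s x = 1) :
    ∃ T ∈ triGroup s, T (obasis 0) = x := by
  have key : ∀ b : Oct, b 0 = 0 → onorm s b ≠ 0 → obilin s x b = 0 →
      ∃ T ∈ triGroup s, T (obasis 0) = x := by
    intro b hb hN hxb
    obtain ⟨T, hT, e⟩ := (isTriSimilitude_transvection hb hN hxb hx).exists_mem_triGroup hs
    exact ⟨T, hT, (LinearMap.congr_fun e _).trans (transvection_one hb hN)⟩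
  by_cases h : onorm s (orthIm x) = 0
  · have h1 : x 1 = 0 := by
      rw [onorm_orthIm] at h
      nlinarith [sq_nonneg (x 1), sq_nonneg (x 2)]
    refine key (obasis 1) (by simp [obasis]) ?_ ?_
    · simp [onorm_eq_obilin, obilin_coord, obasis]
    · simp [obilin_coord, obasis, h1]
  · exact key _ (orthIm_zero x) h (obilin_orthIm x)

theorem exists_mem_triGroup {x y : Oct} (hx : onorm s x = 1) (hy : onorm s y = 1) :
    ∃ T ∈ triGroup s, T x = y := by
  obtain ⟨A, hA, rfl⟩ := exists_mem_triGroup_one hs hx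
  obtain ⟨B, hB, rfl⟩ := exists_mem_triGroup_one hs hy
  exact ⟨B * A⁻¹, mul_mem hB (inv_mem hA), congrArg B (A.symm_apply_apply _)⟩

/-- The orbit maps of the symmetry group of the triple product have smooth local sections. -/
theorem exists_local_section {p q : Oct} (hp : onorm s p = 1) (hq : onorm s q = 1) :
    ∃ W, IsOpen W ∧ q ∈ W ∧ ∃ σ : Oct → Oct →ₗ[ℝ] Oct,
      (∀ v, ContDiffOn ℝ ∞ (fun x => σ x v) W) ∧ ∀ x ∈ W, onorm s x = 1 →
        σ x p = x ∧ ∃ T ∈ triGroup s, σ x = ((T : Oct ≃ₗ[ℝ] Oct) : Oct →ₗ[ℝ] Oct) := by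
  -- The sections are built near e₁, where `orthIm` has non-zero norm, and moved to `q` by `A`; `B`
  -- moves `p` to 1.
  have h1 : onorm s (obasis 1) = 1 := by simp [onorm_eq_obilin, obilin_coord, obasis]
  obtain ⟨A, hA, rfl⟩ := exists_mem_triGroup hs h1 hq
  obtain ⟨B, hB, hBp⟩ := exists_mem_triGroup hs hp (onorm_one s)
  have hAc : Continuous A.symm := A.symm.toLinearMap.continuous_of_finiteDimensional
  have hNc : Continuous (fun x : Oct => onorm s (orthIm x)) := by
    simp only [onorm_orthIm]; fun_prop
  refine ⟨A.symm ⁻¹' {x | onorm s (orthIm x) ≠ 0},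
    (isOpen_ne.preimage hNc).preimage hAc, ?_, fun x =>
      A.toLinearMap ∘ₗ transvection s (A.symm x) (orthIm (A.symm x)) ∘ₗ B.toLinearMap, ?_, ?_⟩
  · change onorm s (orthIm (A.symm (A (obasis 1)))) ≠ 0
    rw [A.symm_apply_apply, onorm_orthIm]
    simp [obasis]
  · intro v
    exact (LinearMap.toContinuousLinearMap A.toLinearMap).contDiff.comp_contDiffOn
      ((contDiffOn_transvection_orthIm (B v)).comp
        (LinearMap.toContinuousLinearMap A.symm.toLinearMap).contDiff.contDiffOn fun x hx => hx)
  · intro x hx hx1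
    have hx2 : onorm s (A.symm x) = 1 := by
      have := (mem_triGroup.1 (inv_mem hA)).1 x
      rw [hx1] at this
      exact this
    refine ⟨?_, ?_⟩
    · change A (transvection s (A.symm x) (orthIm (A.symm x)) (B p)) = x
      rw [hBp, transvection_one (orthIm_zero _) hx, A.apply_symm_apply]
    · obtain ⟨T, hT, e⟩ := (isTriSimilitude_transvection (orthIm_zero _) hx (obilin_orthIm _)
        hx2).exists_mem_triGroup hs
      exact ⟨A * T * B, mul_mem (mul_mem hA hT) hB, by dsimp only; rw [← e]; rfl⟩

end Transitivity


/-! ### Orientation -/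

section Determinants

variable {s : ℝ}

theorem det_smul_oct (c : ℝ) (f : Module.End ℝ Oct) :
    LinearMap.det (c • f) = c ^ 8 * LinearMap.det f := by
  rw [LinearMap.det_smul]; simp

theorem det_conj_oct (f : Module.End ℝ Oct) (e : Oct ≃ₗ[ℝ] Oct) :
    LinearMap.det ((e : Oct →ₗ[ℝ] Oct) ∘ₗ f ∘ₗ (e.symm : Oct →ₗ[ℝ] Oct)) = LinearMap.det f :=
  LinearMap.det_conj f e

theorem det_oconjL : LinearMap.det (oconjL : Oct →ₗ[ℝ] Oct) = -1 := by
  have : (oconjL : Oct →ₗ[ℝ] Oct) =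
      Matrix.toLin' (Matrix.diagonal ![1, -1, -1, -1, -1, -1, -1, -1]) := by
    refine LinearMap.ext fun x => ?_
    ext i
    rw [Matrix.toLin'_apply, Matrix.mulVec_diagonal]
    fin_cases i <;> simp [oconj, ofPair]
  rw [this, LinearMap.det_toLin', Matrix.det_diagonal]
  simp [Fin.prod_univ_succ]

theorem omulB_mul_self (y : Oct) : omulB s y * omulB s y = omulB s (omul s y y) := by
  refine LinearMap.ext fun z => ?_
  have h := oconj_omul_omul s y z
  rw [oconj_eq, sub_omul, smul_omul, one_omul] at h
  rw [Module.End.mul_apply, omulB_apply, omulB_apply, omulB_apply, omul_self, sub_omul, smul_omul,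
    smul_omul, one_omul, ← h]
  abel

/-- Up to sign, an element of positive norm is a square up to a positive factor, and L_y² is left
multiplication by y². -/
theorem det_omulB_nonneg_of_pos {x : Oct} (hx : 0 < onorm s x) :
    0 ≤ LinearMap.det (omulB s x) := by
  have key : ∀ z : Oct, 0 ≤ z 0 → 0 < onorm s z → 0 ≤ LinearMap.det (omulB s z) := by
    intro z hz hN
    -- By the quadratic equation of z, y² is 2(z₀ + √N(z)) z.
    set y := z + √(onorm s z) • obasis 0 with hy
    have hr := Real.sqrt_pos.2 hN
    have hyy : omul s y y = (2 * (z 0 + √(onorm s z))) • z := by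
      rw [hy, omul_add, add_omul, omul_smul, smul_omul, omul_one, one_omul, omul_self]
      rw [smul_add, smul_smul, Real.mul_self_sqrt hN.le]
      module
    have h := congrArg LinearMap.det (omulB_mul_self (s := s) y)
    rw [hyy, map_mul, map_smul, det_smul_oct] at h
    have hc : (0 : ℝ) < (2 * (z 0 + √(onorm s z))) ^ 8 := by positivity
    exact nonneg_of_mul_nonneg_right (h ▸ mul_self_nonneg _) hc
  rcases le_total 0 (x 0) with h | h
  · exact key x h hx
  · have := key (-x) (by simpa using h) (by rwa [QuadraticMap.map_neg])
    rwa [map_neg, ← neg_one_smul ℝ (omulB s x), det_smul_oct, Even.neg_one_pow (by decide),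
      one_mul] at this

theorem det_omulB_ne_zero {x : Oct} (hx : onorm s x ≠ 0) : LinearMap.det (omulB s x) ≠ 0 := by
  have h : omulB s (oconj x) * omulB s x = onorm s x • 1 := by
    refine LinearMap.ext fun z => ?_
    exact oconj_omul_omul s x z
  have h2 := congrArg LinearMap.det h
  rw [map_mul, det_smul_oct, map_one, mul_one] at h2
  intro h0
  rw [h0, mul_zero] at h2
  exact pow_ne_zero 8 hx h2.symm

/-- Right multiplication in terms of left multiplication. -/
theorem det_rmul (α : Oct) :
    LinearMap.det ((omulB s).flip α) = LinearMap.det (omulB s (oconj α)) := by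
  rw [← det_conj_oct _ oconjL]
  congr 1
  refine LinearMap.ext fun z => ?_
  simp [oconj_omul]

/-- Left multiplications by `ℓ` exchange the two quaternionic summands. -/
theorem det_omulB_ell (s : ℝ) : LinearMap.det (omulB s (obasis 4)) = s ^ 4 := by
  let σ : Equiv.Perm (Fin 8) := Equiv.addRight 4
  have h : omulB s (obasis 4) = Matrix.toLin' (Matrix.diagonal
      ![s, s, s, s, 1, 1, 1, 1] * σ.permMatrix ℝ) := by
    refine LinearMap.ext fun x => ?_
    ext i
    rw [Matrix.toLin'_mul, LinearMap.comp_apply, Matrix.toLin'_apply, Matrix.mulVec_diagonal,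
      Matrix.toLin'_apply, Matrix.permMatrix_mulVec]
    fin_cases i <;> simp [σ, omul_zero_coord, omul_one_coord, omul_two_coord, omul_three_coord, omul_four_coord,
      omul_five_coord, omul_six_coord, omul_seven_coord, obasis]
  have hσ : Equiv.Perm.sign σ = 1 := by decide
  rw [h, LinearMap.det_toLin', Matrix.det_mul, Matrix.det_diagonal, Matrix.det_permutation, hσ]
  simp [Fin.prod_univ_succ]
  ring

/-- Negative norms occur only for s = 1. There N(ℓ) = −1, so xℓ has positive norm, and the Moufang
identity relates L_x to left multiplication by xℓ through multiplications by ±ℓ, all of determinant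
1. -/
theorem det_omulB_pos (hs : s ^ 2 = 1) {x : Oct} (hx : onorm s x ≠ 0) :
    0 < LinearMap.det (omulB s x) := by
  refine lt_of_le_of_ne ?_ (det_omulB_ne_zero hx).symm
  rcases lt_or_gt_of_ne hx with h | h
  swap
  · exact det_omulB_nonneg_of_pos h
  have hs1 : s = 1 := by
    rcases mul_self_eq_one_iff.1 ((pow_two s).symm.trans hs) with h1 | h1
    · exact h1
    · exfalso
      rw [onorm_eq_obilin, obilin_coord, h1] at h
      nlinarith [mul_self_nonneg (x 0), mul_self_nonneg (x 1), mul_self_nonneg (x 2), mul_self_nonneg (x 3),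
        mul_self_nonneg (x 4), mul_self_nonneg (x 5), mul_self_nonneg (x 6), mul_self_nonneg (x 7)]
  subst hs1
  have hN : onorm 1 (obasis 4) = -1 := by simp [onorm_eq_obilin, obilin_coord, obasis]
  have hc : oconj (obasis 4) = -obasis 4 := oconj_eq_neg (by simp [obasis])
  have hm : omulB 1 (omul 1 x (obasis 4)) * omulB 1 (oconj (obasis 4)) =
      (omulB 1).flip (oconj (obasis 4)) * omulB 1 x * (omulB 1).flip (obasis 4) := by
    refine LinearMap.ext fun z => ?_
    exact omul_moufang 1 (obasis 4) x z
  have h2 := congrArg LinearMap.det hm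
  have h3 : 0 ≤ LinearMap.det (omulB 1 (omul 1 x (obasis 4))) :=
    det_omulB_nonneg_of_pos (by rw [onorm_omul, hN]; linarith)
  rw [map_mul, map_mul, map_mul, det_rmul, det_rmul, oconj_oconj, hc, map_neg,
    ← neg_one_smul ℝ (omulB 1 (obasis 4)), det_smul_oct, det_omulB_ell] at h2
  norm_num at h2
  rwa [← h2]

theorem det_rmul_pos (hs : s ^ 2 = 1) {α : Oct} (hα : onorm s α ≠ 0) :
    0 < LinearMap.det ((omulB s).flip α) := by
  rw [det_rmul]
  exact det_omulB_pos hs (by rwa [onorm_oconj])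

theorem det_lmulProd_pos (hs : s ^ 2 = 1) {l : List imOct} (hl : IsAnisotropicList s l) :
    0 < LinearMap.det (lmulProd s l) := by
  induction l with
  | nil => simp
  | cons a l ih =>
    rw [isAnisotropicList_cons] at hl
    rw [lmulProd_cons, map_mul]
    exact mul_pos (det_omulB_pos hs hl.1) (ih hl.2)

theorem det_pos_of_mem_triGroup (hs : s ^ 2 = 1) {T : Oct ≃ₗ[ℝ] Oct} (hT : T ∈ triGroup s) :
    0 < LinearMap.det (T : Oct →ₗ[ℝ] Oct) := by
  have hs0 : s ≠ 0 := by rintro rfl; norm_num at hs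
  obtain ⟨n, l, -, hl, -, h⟩ := exists_list_of_mem_triGroup hs0 (δ := 1) (by norm_num) hT
  rw [h, det_smul_oct, ← pow_mul, Even.neg_one_pow ((by decide : Even 8).mul_left n),
    one_mul]
  exact det_lmulProd_pos hs hl

/-- Right charts preserve the orientation; the left ones contain the conjugation, of determinant −1.
-/
theorem det_sideChart (hs : s ^ 2 = 1) {γ : ℝ} (hγ : γ ≠ 0) {α : Oct} (hα : onorm s α ≠ 0)
    (side : Side) :
    0 < -side.sgn * LinearMap.det (sideChart hγ α hα side : Oct →ₗ[ℝ] Oct) := by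
  have hr : ∀ α (hα : onorm s α ≠ 0),
      0 < LinearMap.det (rightChart hγ α hα : Oct →ₗ[ℝ] Oct) := by
    intro α hα
    have : (rightChart hγ α hα : Oct →ₗ[ℝ] Oct) = (γ ^ 2)⁻¹ • (omulB s).flip α := by
      refine LinearMap.ext fun z => ?_
      exact rightChart_apply hγ α hα z
    rw [this, det_smul_oct]
    have := det_rmul_pos hs hα
    positivity
  cases side
  · simpa [Side.sgn, sideChart] using hr α hα
  · have : (sideChart hγ α hα .left : Oct →ₗ[ℝ] Oct) =
        (rightChart hγ (oconj α) (onorm_oconj_ne_zero hα) : Oct →ₗ[ℝ] Oct) * oconjL := rfl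
    rw [this, map_mul, det_oconjL]
    simpa [Side.sgn] using hr _ (onorm_oconj_ne_zero hα)

/-- There are seven frame vectors, so their common sign ε enters to an odd power and compensates the
orientation of the chart. -/
theorem det_symm_mul_pos {S T : Oct ≃ₗ[ℝ] Oct} {ε γ : ℝ}
    (hS : 0 < ε * LinearMap.det (S : Oct →ₗ[ℝ] Oct)) (hT : 0 < LinearMap.det (T : Oct →ₗ[ℝ] Oct))
    (hγ : 0 < γ) :
    0 < LinearMap.det (S.symm : Oct →ₗ[ℝ] Oct) * LinearMap.det (T : Oct →ₗ[ℝ] Oct) *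
      (ε / γ) ^ 7 := by
  have h1 : LinearMap.det (S.symm : Oct →ₗ[ℝ] Oct) * LinearMap.det (S : Oct →ₗ[ℝ] Oct) = 1 :=
    S.det_symm_mul_det
  set a := LinearMap.det (S.symm : Oct →ₗ[ℝ] Oct)
  set d := LinearMap.det (S : Oct →ₗ[ℝ] Oct)
  have ha : a ≠ 0 := left_ne_zero_of_mul_eq_one h1
  have h2 : 0 < ε * a := by
    have e : ε * a = a ^ 2 * (ε * d) := by linear_combination -(ε * a) * h1
    rw [e]; positivity
  have hε : ε ≠ 0 := left_ne_zero_of_mul h2.ne'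
  have e : a * LinearMap.det (T : Oct →ₗ[ℝ] Oct) * (ε / γ) ^ 7 =
      (ε * a) * (LinearMap.det (T : Oct →ₗ[ℝ] Oct) * (ε ^ 2) ^ 3 / γ ^ 7) := by
    field_simp
  rw [e]
  positivity

end Determinants

/-! ### Adapted frames -/

section Frames

variable {s δ γ : ℝ} {S : Oct ≃ₗ[ℝ] Oct}

/-- The frame obtained from a section of the orbit map. -/
def sectionFrame (S : Oct ≃ₗ[ℝ] Oct) (r : ℝ) (σ : Oct → Oct →ₗ[ℝ] Oct) (a : Fin 7) (x : Oct) : Oct :=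
  r • S.symm (σ (S x) (oim a))

/-- The frame takes the standard basis, up to a factor, to the basis given by the point and the
frame. -/
theorem det_sectionFrame (r : ℝ) {σ : Oct → Oct →ₗ[ℝ] Oct} {x : Oct}
    (h : σ (S x) (obasis 0) = S x) :
    (Matrix.of (Fin.cons x (fun a => sectionFrame S r σ a x) : Fin 8 → Oct)).det =
      LinearMap.det (S.symm : Oct →ₗ[ℝ] Oct) * LinearMap.det (σ (S x)) * r ^ 7 := by
  have e : (Matrix.of (Fin.cons x (fun a => sectionFrame S r σ a x) : Fin 8 → Oct)).transpose =
      LinearMap.toMatrix' ((S.symm : Oct →ₗ[ℝ] Oct) ∘ₗ σ (S x)) *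
        Matrix.diagonal (Fin.cons 1 fun _ => r) := by
    ext i j
    rw [Matrix.mul_diagonal, LinearMap.toMatrix'_apply, Matrix.transpose_apply, Matrix.of_apply]
    refine Fin.cases ?_ (fun a => ?_) j
    · have : (Pi.single 0 1 : Oct) = obasis 0 := rfl
      simp [this, h]
    · have : (Pi.single a.succ 1 : Oct) = oim a := rfl
      simp [this, sectionFrame, mul_comm]
  rw [← Matrix.det_transpose, e, Matrix.det_mul, LinearMap.det_toMatrix', Matrix.det_diagonal,
    Fin.prod_univ_succ]
  have := LinearMap.det_comp (S.symm : Oct →ₗ[ℝ] Oct) (σ (S x))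
  rw [this]
  simp

variable (hS : IsUnitChart s S δ γ) (hδ : δ ^ 2 = 1) (hγ : γ ≠ 0) {W : Set Oct}
  {σ : Oct → Oct →ₗ[ℝ] Oct}
  (hσ : ∀ x ∈ W, onorm s x = 1 → σ x (obasis 0) = x ∧
    ∃ T ∈ triGroup s, σ x = ((T : Oct ≃ₗ[ℝ] Oct) : Oct →ₗ[ℝ] Oct))
include hS hδ hγ hσ

/-- The section at `Sx` is an isometry taking 1 to `Sx`, so it takes the imaginary units to an
orthonormal basis of the complement of `Sx`. -/
theorem isLorentzFrame_sectionFrame (hsm : ∀ v, ContDiffOn ℝ ∞ (fun x => σ x v) W) {ε : ℝ}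
    (hε : ε ^ 2 = 1) :
    IsLorentzFrame s δ γ (S ⁻¹' W) (sectionFrame S (ε / γ) σ) := by
  have hB : ∀ x ∈ pseudoSphere s δ γ ∩ S ⁻¹' W, ∀ v w,
      obilin s (σ (S x) v) (σ (S x) w) = obilin s v w := by
    intro x hx v w
    obtain ⟨-, T, hT, e⟩ := hσ (S x) hx.2 (hS.onorm_eq_one hδ hγ hx.1)
    rw [e]
    exact obilin_of_onorm (map_add T) (mem_triGroup.1 hT).1 v w
  refine ⟨fun a => ⟨?_, fun x hx => ?_⟩, fun x hx a b => ?_⟩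
  · exact ContDiffOn.const_smul (ε / γ)
      ((LinearMap.toContinuousLinearMap S.symm.toLinearMap).contDiff.comp_contDiffOn
        ((hsm (oim a)).comp
          (LinearMap.toContinuousLinearMap S.toLinearMap).contDiff.contDiffOn fun x hx => hx))
  · have h1 := (hσ (S x) hx.2 (hS.onorm_eq_one hδ hγ hx.1)).1
    rw [mem_tangentAt, sectionFrame, map_smul, obilin_comm, hS.obilin_symm hδ hγ]
    nth_rewrite 2 [← h1]
    rw [hB x hx, obilin_comm, obilin_one, oim_zero]
    simp
  · rw [sectionFrame, sectionFrame, map_smul, map_smul, LinearMap.smul_apply,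
      hS.obilin_symm hδ hγ, S.apply_symm_apply, hB x hx, oeta, smul_eq_mul, smul_eq_mul]
    field_simp
    rw [hε]; ring

/-- As T preserves the triple product and T(1) = Sx, one gets (T e_b·conj(Sx))T e_c = T(e_b e_c): in
the adapted frame the contorsion is the multiplication table of the algebra. -/
theorem contorsion_sectionFrame {ε : ℝ} (hε : ε ^ 2 = 1) {x : Oct}
    (hx : x ∈ pseudoSphere s δ γ ∩ S ⁻¹' W) (b c : Fin 7) :
    contorsion s S x (sectionFrame S (ε / γ) σ c x) (sectionFrame S (ε / γ) σ b x) =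
      (-ε / γ) • ∑ a, ostruct s a b c • sectionFrame S (ε / γ) σ a x := by
  obtain ⟨h1, T, hT, e⟩ := hσ (S x) hx.2 (hS.onorm_eq_one hδ hγ hx.1)
  have hTx : T (obasis 0) = S x := by rw [← h1, e]; rfl
  have hB := obilin_of_onorm (map_add T) (mem_triGroup.1 hT).1
  have hE : ∀ a, sectionFrame S (ε / γ) σ a x = (ε / γ) • S.symm (T (oim a)) := fun a => by
    rw [sectionFrame, e]; rfl
  have htan : ∀ a, (ε / γ) • S.symm (T (oim a)) ∈ tangentAt s x := by
    intro a
    rw [mem_tangentAt, map_smul, obilin_comm, hS.obilin_symm hδ hγ, ← hTx, hB, obilin_comm,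
      obilin_one, oim_zero]
    simp
  -- Adding η e₀ removes the real part of e_b e_c; in `contorsion_eq` this is the term along `x`.
  have hsum : ∑ a, ostruct s a b c • sectionFrame S (ε / γ) σ a x = (ε / γ) • S.symm (T
      (omul s (oim b) (oim c) + obilin s (oim c) (oim b) • obasis 0)) := by
    have h0 : (omul s (oim b) (oim c) + obilin s (oim c) (oim b) • obasis 0) 0 = 0 := by
      have h2 := obilin_one (omul s (oim b) (oim c)) (s := s)
      rw [obilin_comm, obilin_omul_right, one_omul, oconj_eq_neg (oim_zero c), map_neg,
        obilin_comm] at h2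
      simp [← h2, obasis]
    rw [eq_sum_oim h0]
    simp only [map_sum, map_smul, Finset.smul_sum, hE]
    refine Finset.sum_congr rfl fun a _ => ?_
    rw [smul_comm]
    congr 1
    simp [ostruct, obasis]
  rw [hE, hE, contorsion_eq hS (htan c) (htan b), hsum]
  simp only [map_smul, LinearMap.smul_apply, S.apply_symm_apply, otri_smul_left, otri_smul_right,
    ← hTx, hB, (mem_triGroup.1 hT).2]
  rw [otri, oconj_one, omul_one, map_add, map_add, map_smul, map_smul, hTx, S.symm_apply_apply]
  simp only [smul_eq_mul, smul_add, smul_smul]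
  have e1 : ε / γ * (ε / γ) = 1 / γ ^ 2 := by field_simp; linear_combination hε
  have e2 : -ε / γ * (ε / γ) = -(1 / γ ^ 2) := by rw [← e1]; ring
  rw [← mul_assoc, ← mul_assoc, e1, e2]
  module

end Frames

/-! ### Isometries that do not preserve the torsion -/

section SymmetryBreaking

/-- The sign changes of the components along `e₁` and `e₂`. -/
def signChange : Oct ≃ₗ[ℝ] Oct :=
  LinearEquiv.ofInvolutive (Matrix.toLin' (Matrix.diagonal ![1, -1, -1, 1, 1, 1, 1, 1])) (by
    intro x
    ext i
    simp only [Matrix.toLin'_apply, Matrix.mulVec_diagonal]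
    fin_cases i <;> simp)

theorem signChange_apply (x : Oct) :
    signChange x = ![x 0, -x 1, -x 2, x 3, x 4, x 5, x 6, x 7] := by
  ext i
  change (Matrix.toLin' (Matrix.diagonal ![1, -1, -1, 1, 1, 1, 1, 1])) x i = _
  rw [Matrix.toLin'_apply, Matrix.mulVec_diagonal]
  fin_cases i <;> simp

theorem det_signChange : LinearMap.det (signChange : Oct →ₗ[ℝ] Oct) = 1 := by
  change LinearMap.det (Matrix.toLin' (Matrix.diagonal ![(1 : ℝ), -1, -1, 1, 1, 1, 1, 1])) = 1
  rw [LinearMap.det_toLin', Matrix.det_diagonal]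
  simp [Fin.prod_univ_succ]

theorem onorm_signChange (s : ℝ) (x : Oct) : onorm s (signChange x) = onorm s x := by
  simp [signChange_apply, onorm_eq_obilin, obilin_coord]

/-- The map fixes 1, so it would be an automorphism. But it reverses e₁ and fixes e₄ and e₅, while
e₁e₄ = −e₅. -/
theorem signChange_notMem_triGroup (s : ℝ) : signChange ∉ triGroup s := by
  intro h
  have h1 : signChange ∈ autOct s := mem_autOct_iff.2 ⟨h, by
    rw [signChange_apply]; ext i; fin_cases i <;> simp [obasis]⟩
  have := congrFun (h1 (obasis 1) (obasis 4)) 5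
  simp [signChange_apply, omul_five_coord, obasis] at this
  norm_num at this

variable {s δ γ : ℝ} {S : Oct ≃ₗ[ℝ] Oct} (hS : IsUnitChart s S δ γ) (hδ : δ ^ 2 = 1) (hγ : γ ≠ 0)
include hS hδ hγ

theorem exists_not_isTorsionSymmetry : ∃ g : Oct ≃ₗ[ℝ] Oct, IsNormIsometry s g ∧
    LinearMap.det (g : Oct →ₗ[ℝ] Oct) = 1 ∧
      ¬ IsTorsionSymmetry s δ γ (contorsion s S) g := by
  have hδ0 : δ ≠ 0 := by rintro rfl; norm_num at hδ
  refine ⟨S⁻¹ * signChange * S, fun x => ?_, ?_, ?_⟩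
  · have h := hS (S.symm (signChange (S x)))
    rw [S.apply_symm_apply, onorm_signChange, hS] at h
    exact (mul_left_cancel₀ (by positivity) h).symm
  · exact (det_conj_oct _ S.symm).trans det_signChange
  · rw [isTorsionSymmetry_iff hS hδ hγ]
    have : S * (S⁻¹ * signChange * S) * S⁻¹ = signChange := by group
    rw [this]
    exact signChange_notMem_triGroup s

end SymmetryBreaking


/-! ### The pseudo-sphere as a homogeneous space of the spin group -/

section Homogeneous

open CliffordAlgebra

variable {s δ γ : ℝ} {S : Oct ≃ₗ[ℝ] Oct}

instance cliffordIsModuleTopology (s δ : ℝ) :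
    IsModuleTopology ℝ (CliffordAlgebra (imForm s δ)) := ⟨rfl⟩

/-- Linear maps on the even subalgebra are continuous on the spin group. -/
theorem continuous_spinGroup_of_linearMap (f : even (imForm s δ) →ₗ[ℝ] Oct) :
    Continuous fun g : spinGroup (imForm s δ) => f ⟨g, spinGroup.mem_even g.2⟩ := by
  obtain ⟨F, hF⟩ := LinearMap.exists_extend (p := (even (imForm s δ)).toSubmodule) f
  have h : (fun g : spinGroup (imForm s δ) => f ⟨g, spinGroup.mem_even g.2⟩) =
      fun g : spinGroup (imForm s δ) => F g := by
    funext g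
    exact (LinearMap.congr_fun hF ⟨(g : CliffordAlgebra (imForm s δ)),
      spinGroup.mem_even g.2⟩).symm
  rw [h]
  exact (IsModuleTopology.continuous_of_linearMap F).comp continuous_subtype_val

/-- Maps to the spin group are continuous if they depend linearly on continuous matrices. -/
theorem continuous_to_spinGroup {X : Type*} [TopologicalSpace X]
    (Λ : Module.End ℝ Oct →ₗ[ℝ] CliffordAlgebra (imForm s δ)) {f : X → Module.End ℝ Oct}
    (hf : ∀ v, Continuous fun x => f x v) {G : X → spinGroup (imForm s δ)}
    (hG : ∀ x, (G x : CliffordAlgebra (imForm s δ)) = Λ (f x)) : Continuous G := by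
  refine continuous_induced_rng.2 ?_
  let Λ' : (Fin 8 → Fin 8 → ℝ) →ₗ[ℝ] CliffordAlgebra (imForm s δ) :=
    Λ ∘ₗ (Matrix.toLin' : Matrix (Fin 8) (Fin 8) ℝ ≃ₗ[ℝ] Module.End ℝ Oct).toLinearMap
  have : ContinuousAdd (CliffordAlgebra (imForm s δ)) := IsModuleTopology.toContinuousAdd ℝ _
  have hΛ : Continuous Λ' := IsModuleTopology.continuous_of_linearMap Λ'
  have h : (Subtype.val ∘ G) = fun x => Λ' (fun i j => f x (Pi.single j 1) i) := by
    funext x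
    refine (hG x).trans (congrArg Λ ?_)
    exact (Matrix.toLin'_toMatrix' (f x)).symm.trans (by rfl)
  rw [h]
  refine hΛ.comp (continuous_pi fun i => continuous_pi fun j => ?_)
  exact (continuous_apply i).comp (hf _)

/-- An orbit map onto a space with continuous local sections induces a homeomorphism. -/
theorem exists_homeomorph_quotient {G X : Type*} [Group G] [TopologicalSpace G]
    [TopologicalSpace X] (H : Subgroup G) {f : G → X} (hf : Continuous f)
    (hH : ∀ g g', f g = f g' ↔ g⁻¹ * g' ∈ H)
    (hsec : ∀ x, ∃ W : Set X, IsOpen W ∧ x ∈ W ∧ ∃ τ : W → G, Continuous τ ∧ ∀ y, f (τ y) = y) :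
    ∃ Φ : (G ⧸ H) ≃ₜ X, ∀ g : G, Φ (QuotientGroup.mk g) = f g := by
  let F : G ⧸ H → X := Quotient.lift f fun g g' h => (hH g g').2 (QuotientGroup.leftRel_apply.1 h)
  have hF : ∀ g : G, F (QuotientGroup.mk g) = f g := fun g => rfl
  have hinj : Function.Injective F := by
    intro a b
    induction a using QuotientGroup.induction_on
    induction b using QuotientGroup.induction_on
    intro h
    exact QuotientGroup.eq.2 ((hH _ _).1 h)
  have hsurj : Function.Surjective F := by
    intro x
    obtain ⟨W, -, hx, τ, -, hτ⟩ := hsec x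
    exact ⟨QuotientGroup.mk (τ ⟨x, hx⟩), hτ ⟨x, hx⟩⟩
  let e := Equiv.ofBijective F ⟨hinj, hsurj⟩
  refine ⟨⟨e, continuous_quot_lift _ hf, continuous_iff_continuousAt.2 fun x => ?_⟩, hF⟩
  obtain ⟨W, hW, hx, τ, hτc, hτ⟩ := hsec x
  have h : W.domRestrict e.symm = fun y => (QuotientGroup.mk (τ y) : G ⧸ H) := by
    funext y
    exact e.symm_apply_eq.2 (hτ y).symm
  have hc : ContinuousOn e.symm W := by
    rw [continuousOn_iff_continuous_domRestrict, h]
    exact continuous_quot_mk.comp hτc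
  exact hc.continuousAt (hW.mem_nhds hx)

variable (hS : IsUnitChart s S δ γ) (hδ : δ ^ 2 = 1) (hγ : γ ≠ 0) (hs : s ≠ 0)
include hS hδ hγ hs

/-- All statements are those for `triGroup` acting on the elements of norm 1, conjugated by the
chart `S`. -/
theorem spinHomogeneous_contorsion : SpinHomogeneous s δ γ (contorsion s S) := by
  let Ψ : even (imForm s δ) ≃ₐ[ℝ] Module.End ℝ Oct :=
    (spinEquiv hδ hs).trans (S.symm.conjAlgEquiv ℝ)
  let ρ : spinGroup (imForm s δ) →* (Oct ≃ₗ[ℝ] Oct) :=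
    (MulAut.conj S⁻¹).toMonoidHom.comp (spinRep s δ)
  have hρ : ∀ g, ρ g = S⁻¹ * spinRep s δ g * S := fun g => by simp [ρ]
  have hΨ : ∀ g : spinGroup (imForm s δ), (ρ g : Oct →ₗ[ℝ] Oct) =
      Ψ ⟨(g : CliffordAlgebra (imForm s δ)), spinGroup.mem_even g.2⟩ := fun g => by
    rw [hρ]; rfl
  have hrange : ∀ T, T ∈ ρ.range ↔ S * T * S⁻¹ ∈ triGroup s := by
    intro T
    rw [← mem_range_spinRep hs hδ]
    constructor
    · rintro ⟨g, rfl⟩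
      exact ⟨g, by rw [hρ]; group⟩
    · rintro ⟨g, hg⟩
      exact ⟨g, by rw [hρ, hg]; group⟩
  have hpres : ∀ g, ∀ x ∈ pseudoSphere s δ γ, ρ g x ∈ pseudoSphere s δ γ := by
    intro g x hx
    have h := ((isTorsionSymmetry_iff hS hδ hγ).2 ((hrange _).1 ⟨g, rfl⟩)).1 x
    rw [mem_pseudoSphere, h, mem_pseudoSphere.1 hx]
  have hsec : ∀ p ∈ pseudoSphere s δ γ, ∀ q ∈ pseudoSphere s δ γ, ∃ W, IsOpen W ∧ q ∈ W ∧
      ∃ σ : Oct → Oct →ₗ[ℝ] Oct, (∀ v, ContDiffOn ℝ ∞ (fun x => σ x v) W) ∧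
        ∀ x ∈ pseudoSphere s δ γ ∩ W, σ x p = x ∧ ∃ g, σ x = ρ g := by
    intro p hp q hq
    obtain ⟨W, hW, hqW, σ, hσ, h⟩ := exists_local_section hs (hS.onorm_eq_one hδ hγ hp)
      (hS.onorm_eq_one hδ hγ hq)
    have hSc : ContDiff ℝ ∞ S := (LinearMap.toContinuousLinearMap S.toLinearMap).contDiff
    refine ⟨S ⁻¹' W, hW.preimage hSc.continuous, hqW, fun x =>
      S.symm.toLinearMap ∘ₗ σ (S x) ∘ₗ S.toLinearMap, fun v => ?_, fun x hx => ?_⟩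
    · exact (LinearMap.toContinuousLinearMap S.symm.toLinearMap).contDiff.comp_contDiffOn
        ((hσ (S v)).comp hSc.contDiffOn fun x hx => hx)
    · obtain ⟨h1, T, hT, e⟩ := h (S x) hx.2 (hS.onorm_eq_one hδ hγ hx.1)
      refine ⟨?_, ?_⟩
      · change S.symm (σ (S x) (S p)) = x
        rw [h1, S.symm_apply_apply]
      · obtain ⟨g, hg⟩ := (mem_range_spinRep hs hδ).2 hT
        exact ⟨g, by rw [hρ, hg]; dsimp only; rw [e]; rfl⟩
  refine ⟨Ψ, ρ, hΨ, ?_, fun T => ?_, fun p hp => ?_⟩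
  · exact (MulAut.conj S⁻¹).injective.comp (spinRep_injective hs hδ)
  · rw [hrange, isTorsionSymmetry_iff hS hδ hγ]
  let H : Subgroup (spinGroup (imForm s δ)) := (MulAction.stabilizer (Oct ≃ₗ[ℝ] Oct) p).comap ρ
  have hH : ∀ g, g ∈ H ↔ ρ g p = p := fun g => Iff.rfl
  refine ⟨H, hH, ?_, ?_, hsec p hp⟩
  -- Since A S takes `p` to 1, it conjugates the stabiliser of `p` to the stabiliser of 1 in
  -- `triGroup`, the automorphism group.
  · obtain ⟨A, hA, hAp⟩ := exists_mem_triGroup hs (hS.onorm_eq_one hδ hγ hp) (onorm_one s)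
    have hh : (A * S) p = obasis 0 := hAp
    have hh' : (A * S)⁻¹ (obasis 0) = p := by
      rw [← hh]; exact (A * S).symm_apply_apply p
    refine ⟨A * S, hh, Subgroup.ext fun g => ?_⟩
    rw [mem_autOct_iff]
    constructor
    · rintro ⟨_, ⟨T, hT, rfl⟩, rfl⟩
      refine ⟨?_, ?_⟩
      · have h1 := (hrange _).1 ⟨T, rfl⟩
        have h2 := mul_mem (mul_mem hA h1) (inv_mem hA)
        have e : A * (S * ρ T * S⁻¹) * A⁻¹ = (MulAut.conj (A * S)).toMonoidHom (ρ T) := by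
          simp [mul_assoc]
        rwa [e] at h2
      · change (A * S) (ρ T ((A * S)⁻¹ (obasis 0))) = obasis 0
        rw [hh', (hH T).1 hT, hh]
    · rintro ⟨hg, hg1⟩
      have h1 := mul_mem (mul_mem (inv_mem hA) hg) hA
      have e : S * ((A * S)⁻¹ * g * (A * S)) * S⁻¹ = A⁻¹ * g * A := by group
      rw [← e] at h1
      obtain ⟨T, hT⟩ := (hrange _).2 h1
      refine ⟨_, ⟨T, ?_, rfl⟩, ?_⟩
      · refine (hH T).2 ?_
        rw [hT]
        change (A * S)⁻¹ (g ((A * S) p)) = p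
        rw [hh, hg1, hh']
      · rw [hT]
        simp [mul_assoc]
  · let f : spinGroup (imForm s δ) → pseudoSphere s δ γ := fun g => ⟨ρ g p, hpres g p hp⟩
    suffices h : ∃ Φ : (spinGroup (imForm s δ) ⧸ H) ≃ₜ pseudoSphere s δ γ,
        ∀ g : spinGroup (imForm s δ), Φ (QuotientGroup.mk g) = f g by
      obtain ⟨Φ, hΦ⟩ := h
      exact ⟨Φ, fun g => congrArg Subtype.val (hΦ g)⟩
    refine exists_homeomorph_quotient H ?_ ?_ ?_
    · refine continuous_induced_rng.2 ?_
      have h : Subtype.val ∘ f =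
          fun g : spinGroup (imForm s δ) =>
            ((LinearMap.applyₗ p : Module.End ℝ Oct →ₗ[ℝ] Oct) ∘ₗ Ψ.toLinearMap)
              ⟨g, spinGroup.mem_even g.2⟩ := by
        funext g
        exact LinearMap.congr_fun (hΨ g) p
      rw [h]
      exact continuous_spinGroup_of_linearMap _
    · intro g g'
      rw [Subtype.mk.injEq, hH, map_mul, map_inv]
      constructor
      · intro h
        change (ρ g)⁻¹ (ρ g' p) = p
        rw [← h]
        exact (ρ g).symm_apply_apply p
      · intro h
        have : ρ g ((ρ g)⁻¹ (ρ g' p)) = ρ g' p := (ρ g).apply_symm_apply _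
        rw [← this]
        exact congrArg (ρ g) h.symm
    · rintro ⟨q, hq⟩
      obtain ⟨W, hW, hqW, σ, hσ, h⟩ := hsec p hp q hq
      -- The lift of the section to the spin group is continuous because `ρ` is inverted by the
      -- linear map Ψ⁻¹.
      choose! g hg using fun x hx => (h x hx).2
      refine ⟨Subtype.val ⁻¹' W, hW.preimage continuous_subtype_val, hqW, fun y => g y.1.1, ?_, ?_⟩
      · refine continuous_to_spinGroup
          ((even (imForm s δ)).val.toLinearMap ∘ₗ Ψ.symm.toLinearMap)
          (f := fun y => σ y.1.1) (fun v => ?_) fun y => ?_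
        · exact (hσ v).continuousOn.comp_continuous
            (continuous_subtype_val.comp continuous_subtype_val) fun y => y.2
        · have := hg y.1.1 ⟨y.1.2, y.2⟩
          rw [this, hΨ]
          simp
      · intro y
        apply Subtype.ext
        have h1 := (h y.1.1 ⟨y.1.2, y.2⟩).1
        rw [hg y.1.1 ⟨y.1.2, y.2⟩] at h1
        exact h1

end Homogeneous

end

/-- Here `s = ℓ²`: the split octonions are `s = 1`, with `S^{3,4}` for `δ = 1` and `H^{4,3}` for
`δ = -1`, and the octonions are `s = -1`, with `S⁷` for `δ = 1`. The radius is `γ`. -/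
theorem mainTheorem12 (s δ γ : ℝ) (hγ : 0 < γ)
    (hs : s = 1 ∧ (δ = 1 ∨ δ = -1) ∨ s = -1 ∧ δ = 1) :
    -- the reference connection `∇̄` is metric-compatible and torsion-free
    (IsMetricConn s δ γ 0 ∧
      ∀ W, IsOpen W → ∀ X Y, IsTangentField s δ γ W X → IsTangentField s δ γ W Y →
        ∀ x ∈ pseudoSphere s δ γ ∩ W, torsion s 0 X Y x = 0) ∧
    -- each side and each reference point `α` give an absolute parallelism
    (∀ (side : Side), ∀ α ∈ pseudoSphere s δ γ,
      IsLorentzFrame s δ γ Set.univ (multFrame s γ α side) ∧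
      ∃ κ : Oct → Oct →ₗ[ℝ] Oct →ₗ[ℝ] Oct,
        IsConnection s δ γ κ ∧
        (∀ i, IsParallel s δ γ κ (multFrame s γ α side i)) ∧
        IsMetricConn s δ γ κ ∧
        (∀ W, IsOpen W → IsFlatOn s δ γ W κ) ∧
        (∀ W, IsOpen W → ∀ X Y, IsTangentField s δ γ W X → IsTangentField s δ γ W Y →
          ∀ x ∈ pseudoSphere s δ γ ∩ W, torsion s κ X Y x = torsionAt κ x (X x) (Y x)) ∧
        -- around each point, in a suitable frame, `ω = ω̄ ± (1/γ) f e`, and the torsion is given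
        -- by the structure constants
        (∀ p ∈ pseudoSphere s δ γ, ∃ (W : Set Oct) (E : Fin 7 → Oct → Oct),
          IsOpen W ∧ p ∈ W ∧ IsLorentzFrame s δ γ W E ∧ IsPosOriented s δ γ W E ∧
          HasStructForms s δ γ (side.sgn / γ) W E κ ∧
          ∀ x ∈ pseudoSphere s δ γ ∩ W, ∀ b c,
            torsion s κ (E b) (E c) x =
              -(2 * side.sgn / γ) • ∑ a, ostruct s a b c • E a x) ∧
        -- the torsion breaks the symmetry to the spin group, and the coset description
        (∃ g : Oct ≃ₗ[ℝ] Oct, IsNormIsometry s g ∧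
          LinearMap.det (g : Oct →ₗ[ℝ] Oct) = 1 ∧ ¬ IsTorsionSymmetry s δ γ κ g) ∧
        SpinHomogeneous s δ γ κ) ∧
    -- the two families are infinite and disjoint
    (pseudoSphere s δ γ).Infinite ∧
    (∀ (side : Side), ∀ α ∈ pseudoSphere s δ γ, ∀ β ∈ pseudoSphere s δ γ,
      (∃ κ, IsConnection s δ γ κ ∧ (∀ i, IsParallel s δ γ κ (multFrame s γ α side i)) ∧
        ∀ i, IsParallel s δ γ κ (multFrame s γ β side i)) ↔ (β = α ∨ β = -α)) ∧
    (∀ α ∈ pseudoSphere s δ γ, ∀ β ∈ pseudoSphere s δ γ,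
      ¬ ∃ κ, IsConnection s δ γ κ ∧
        (∀ i, IsParallel s δ γ κ (multFrame s γ α .right i)) ∧
        ∀ i, IsParallel s δ γ κ (multFrame s γ β .left i)) ∧
    -- `± 1/γ` are the only possible coefficients, even locally
    (∀ (β : ℝ) (W : Set Oct) (E : Fin 7 → Oct → Oct) (κ : Oct → Oct →ₗ[ℝ] Oct →ₗ[ℝ] Oct),
      (pseudoSphere s δ γ ∩ W).Nonempty → IsConnectionOn s δ γ W κ →
      IsLorentzFrame s δ γ W E → HasStructForms s δ γ β W E κ → IsFlatOn s δ γ W κ →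
      β ^ 2 = 1 / γ ^ 2) := by

  have hδ : δ ^ 2 = 1 := by
    rcases hs with ⟨-, rfl | rfl⟩ | ⟨-, rfl⟩ <;> norm_num
  have hs2 : s ^ 2 = 1 := by
    rcases hs with ⟨rfl, -⟩ | ⟨rfl, -⟩ <;> norm_num
  have hs0 : s ≠ 0 := by rintro rfl; norm_num at hs2
  have hδ0 : δ ≠ 0 := by rintro rfl; norm_num at hδ
  have hγ0 : γ ≠ 0 := hγ.ne'
  have hn : δ * γ ^ 2 ≠ 0 := mul_ne_zero hδ0 (pow_ne_zero 2 hγ0)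
  refine ⟨⟨isMetricConn_of_skew 0 fun x _ u v w => by simp, fun W hW X Y hX hY x hx => ?_⟩,
    fun side α hα => ?_, infinite_pseudoSphere hγ hs, fun side α hα β hβ => ⟨?_, ?_⟩, ?_, ?_⟩
  · rw [torsion_eq_torsionAt hn 0 hW hX hY hx]
    simp [torsionAt]
  · have hα0 := onorm_ne_zero_of_mem hδ hγ0 hα
    have hS := sideChart_isUnitChart hγ0 hα0 hα side
    refine ⟨multFrame_isLorentzFrame hδ hγ0 hα side, contorsion s (sideChart hγ0 α hα0 side),
      ⟨Set.univ, Set.subset_univ _, contorsion_isConnectionOn hS hδ hγ0 isOpen_univ⟩,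
      isParallel_multFrame hδ hγ0 hα side,
      isMetricConn_of_skew _ fun x _ => contorsion_skew hS hδ hγ0 x,
      fun W hW => contorsion_isFlatOn hS hδ hγ0 hW,
      fun W hW X Y hX hY x hx => torsion_eq_torsionAt hn _ hW hX hY hx, fun p hp => ?_,
      exists_not_isTorsionSymmetry hS hδ hγ0, spinHomogeneous_contorsion hS hδ hγ0 hs0⟩
    obtain ⟨W, hW, hpW, σ, hσ, h⟩ := exists_local_section hs0 (onorm_one s)
      (hS.onorm_eq_one hδ hγ0 hp)
    have hW' : IsOpen (sideChart hγ0 α hα0 side ⁻¹' W) :=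
      hW.preimage (sideChart hγ0 α hα0 side).toLinearMap.continuous_of_finiteDimensional
    -- The sign ε = `-side.sgn` serves twice: it makes the adapted frame positively oriented, and it
    -- turns the coefficient −ε/γ of the contorsion into `side.sgn / γ`.
    have hε : (-side.sgn) ^ 2 = 1 := by cases side <;> norm_num [Side.sgn]
    have hE := isLorentzFrame_sectionFrame hS hδ hγ0 h hσ hε
    have hκ := fun x hx b c => contorsion_sectionFrame hS hδ hγ0 h hε (x := x) hx b c
    refine ⟨_, _, hW', hpW, hE, fun x hx => ?_, fun x hx b c => ?_, fun x hx b c => ?_⟩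
    · obtain ⟨h1, T, hT, e⟩ := h _ hx.2 (hS.onorm_eq_one hδ hγ0 hx.1)
      rw [det_sectionFrame _ h1, e]
      exact det_symm_mul_pos (det_sideChart hs2 hγ0 hα0 side) (det_pos_of_mem_triGroup hs2 hT) hγ
    · rw [covD, covD, hκ x hx b c, neg_neg]
      simp
    · rw [torsion_eq_torsionAt hn _ hW' (hE.tangent b) (hE.tangent c) hx, torsionAt,
        contorsion_swap, hκ x hx b c, neg_neg]
      module
  · rintro ⟨κ, -, h, h'⟩
    exact eq_or_eq_neg_of_isParallel hδ hγ0 hα hβ side h h'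
  · intro h
    have hS := sideChart_isUnitChart hγ0 (onorm_ne_zero_of_mem hδ hγ0 hα) hα side
    have hpar := isParallel_multFrame hδ hγ0 hα side
    refine ⟨_, ⟨Set.univ, Set.subset_univ _, contorsion_isConnectionOn hS hδ hγ0 isOpen_univ⟩,
      hpar, ?_⟩
    rcases h with rfl | rfl
    · exact hpar
    · rw [multFrame_neg]
      exact hpar
  · rintro α hα β hβ ⟨κ, -, h, h'⟩
    exact not_isParallel_right_left hδ hγ0 hα hβ h h'
  · intro β W E κ hne hκ hE hform hflat
    exact sq_eq_of_isFlatOn hδ hγ0 hs0 hne hκ hE hform hflat
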